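/- Let $(M,g)$ be a smooth Lorentzian manifold of dimension $n+2$ with signature $(-,+,\dots,+)$, let $\Sigma\subset TM$ be the bundle of nonzero null vectors, and suppose that the space of unparametrized (oriented) null geodesics, i.e. the quotient of $\Sigma$ by the geodesic flow and positive scaling, is a smooth $(2n+1)$-manifold $\mathcal N$ for which the quotient map $q:\Sigma\to\mathcal N$ is a submersion. Let $\alpha_v(\xi)=g(v,d\pi\,\xi)$ be the tautological $1$-form (transported to $\Sigma$ by $g$, with $\pi:TM\to M$), let $\mathcal C=dq(\ker\alpha|_{\Sigma})\subset T\mathcal N$ be the contact distribution and $L=T\mathcal N/\mathcal C$ the contact line. Let $\gamma:I\to M$ be an affinely parametrized null geodesic on an open interval, $k=\dot\gamma$, and let $E_u=k^\perp/\langle k\rangle$, $N_u=T_{\gamma(u)}M/k^\perp$; the weighted normal model $E_u\oplus N_u$ carries the dilations $\delta_r(X,V)=(rX,r^2V)$. Choose a contact scale near $[\gamma]$, i.e. a smooth nowhere vanishing $1$-form $\theta$ with $\ker\theta=\mathcal C$, and a Lagrangian polarization $\Lambda\subset\mathcal C_{[\gamma]}$ (a subspace equal to its own $d\theta$-orthogonal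 in $\mathcal C_{[\gamma]}$). Let $\mathfrak h=\mathcal C_{[\gamma]}\oplus L_{[\gamma]}$ be the Heisenberg tangent model, with the bracket $\mathcal C_{[\gamma]}\times\mathcal C_{[\gamma]}\to L_{[\gamma]}$, $\theta([X,Y])=-d\theta(X,Y)$, and the dilations $\delta_r(X,V)=(rX,r^2V)$. Then: 1. $\dim\mathcal C_{[\gamma]}=2n$, $\dim L_{[\gamma]}=1$, the centre of $\mathfrak h$ is $L_{[\gamma]}$, and there is a unique Reeb vector $R\in T_{[\gamma]}\mathcal N$, $\theta(R)=1$, $\iota_Rd\theta=0$. 2. For every $u\in I$, evaluating variations of $\gamma$ at $u$ (that is, $dq(\xi)\mapsto d\pi(\xi)$ for $\xi\in T_{\dot\gamma(u)}\Sigma$) induces a surjective graded linear map $\Phi_u:\mathfrak h\to E_u\oplus N_u$ that maps $\mathcal C_{[\gamma]}$ to $E_u$ and $L_{[\gamma]}$ to $N_u$ and commutes with the dilations. Its kernel is the Lagrangian subspace $H_u\subset\mathcal C_{[\gamma]}$ of the variations vanishing at $u$, so $E_u\oplus N_u$ is the quotient of $\mathfrak h$ by $H_u$. The maps $\Phi_u$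 depend smoothly on $u$: for each $\eta\in T_{[\gamma]}\mathcal N$ the images of its class in $L_{[\gamma]}$ and, when $\eta\in\mathcal C_{[\gamma]}$, of $\eta$ itself, are near each parameter the classes of a single smooth vector field along $\gamma$. 3. For every $u\in I$ there is a linear isomorphism $\Psi_u:\Lambda\oplus L_{[\gamma]}\to E_u\oplus N_u$ that commutes with the dilations, maps the polarized contact space $\Lambda$ onto the weight-one part $E_u$ and the contact line $L_{[\gamma]}$ onto the weight-two part $N_u$, and agrees with $\Phi_u$ on $L_{[\gamma]}$. Whenever $\Lambda\cap H_u=0$, the spaces $\Lambda$ and $H_u$ are complementary in $\mathcal C_{[\gamma]}$, and $\Psi_u$ can be taken to be the restriction of $\Phi_u$ to $\Lambda\oplus L_{[\gamma]}$; so there the polarized quotient $\mathfrak h/H_u\cong\Lambda\oplus L_{[\gamma]}$ is canonically identified with $E_u\oplus N_u$. 4. The parameters $u$ with $\Lambda\cap H_u\neq0$ are isolated: each $u_0\in I$ has a punctured neighbourhood in which $\Lambda\cap H_u=0$. -/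

import Mathlib

open Set Filter Topology
open scoped Manifold ContDiff Bundle

noncomputable section

namespace PenroseLimit

/-! ## Lorentzian metrics, geodesics, and the weighted normal model -/

section Spacetime

variable {n : ℕ} {M : Type*} [TopologicalSpace M]
  [ChartedSpace (EuclideanSpace ℝ (Fin (n + 2))) M]
  [IsManifold (𝓡 (n + 2)) ∞ M]

/-- A smooth Lorentzian metric, of signature `(-, +, ..., +)`, on a manifold of dimension `n + 2`. -/
structure LorentzMetric (n : ℕ) (M : Type*) [TopologicalSpace M]
    [ChartedSpace (EuclideanSpace ℝ (Fin (n + 2))) M] [IsManifold (𝓡 (n + 2)) ∞ M] where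
  form : ∀ x : M, TangentSpace (𝓡 (n + 2)) x →L[ℝ] TangentSpace (𝓡 (n + 2)) x →L[ℝ] ℝ
  symm : ∀ x v w, form x v w = form x w v
  lorentzian : ∀ x, ∃ t, form x t t < 0 ∧ ∀ w, form x t w = 0 → w ≠ 0 → 0 < form x w w
  contMDiff : ContMDiff (𝓡 (n + 2))
    ((𝓡 (n + 2)).prod 𝓘(ℝ, EuclideanSpace ℝ (Fin (n + 2)) →L[ℝ]
      EuclideanSpace ℝ (Fin (n + 2)) →L[ℝ] ℝ)) ∞
    (fun x ↦ Bundle.TotalSpace.mk' (EuclideanSpace ℝ (Fin (n + 2)) →L[ℝ]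
      EuclideanSpace ℝ (Fin (n + 2)) →L[ℝ] ℝ)
      (E := fun x : M ↦ TangentSpace (𝓡 (n + 2)) x →L[ℝ] TangentSpace (𝓡 (n + 2)) x →L[ℝ] ℝ)
      x (form x))

/-- The velocity of a curve, as a point of the tangent bundle. -/
def velocity (n : ℕ) {M : Type*} [TopologicalSpace M]
    [ChartedSpace (EuclideanSpace ℝ (Fin (n + 2))) M]
    (σ : ℝ → M) (t : ℝ) : TangentBundle (𝓡 (n + 2)) M :=
  ⟨σ t, mfderiv 𝓘(ℝ, ℝ) (𝓡 (n + 2)) σ t (1 : ℝ)⟩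

/-- The coordinate expression `z ↦ g_{ij}(z)` of the metric in the preferred chart at `x₀`. -/
def LorentzMetric.inChart (g : LorentzMetric n M) (x₀ : M) (z : EuclideanSpace ℝ (Fin (n + 2))) :
    EuclideanSpace ℝ (Fin (n + 2)) →L[ℝ] EuclideanSpace ℝ (Fin (n + 2)) →L[ℝ] ℝ :=
  let A : EuclideanSpace ℝ (Fin (n + 2)) →L[ℝ] EuclideanSpace ℝ (Fin (n + 2)) :=
    mfderiv 𝓘(ℝ, EuclideanSpace ℝ (Fin (n + 2))) (𝓡 (n + 2)) (extChartAt (𝓡 (n + 2)) x₀).symm z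
  let B : EuclideanSpace ℝ (Fin (n + 2)) →L[ℝ] EuclideanSpace ℝ (Fin (n + 2)) →L[ℝ] ℝ :=
    g.form ((extChartAt (𝓡 (n + 2)) x₀).symm z)
  B.bilinearComp A A

/-- Christoffel symbols of the first kind of the Levi-Civita connection,
`Γ(a, b; w) = (∂_a g(b, w) + ∂_b g(a, w) - ∂_w g(a, b)) / 2`. -/
def LorentzMetric.christoffel (g : LorentzMetric n M) (x₀ : M)
    (z a b w : EuclideanSpace ℝ (Fin (n + 2))) : ℝ :=
  (fderiv ℝ (g.inChart x₀) z a b w + fderiv ℝ (g.inChart x₀) z b a w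
    - fderiv ℝ (g.inChart x₀) z w a b) / 2

/-- The curve `σ` is an affinely parametrized geodesic on the (open) set `J` of parameters:
`g(∇_σ' σ', w) = 0` for every `w`, written in the preferred chart at each point. -/
def LorentzMetric.IsGeodesicOn (g : LorentzMetric n M) (σ : ℝ → M) (J : Set ℝ) : Prop :=
  ContMDiffOn 𝓘(ℝ, ℝ) (𝓡 (n + 2)) ∞ σ J ∧
  ∀ t ∈ J, ∀ w : EuclideanSpace ℝ (Fin (n + 2)),
    let c : ℝ → EuclideanSpace ℝ (Fin (n + 2)) := fun s ↦ extChartAt (𝓡 (n + 2)) (σ t) (σ s)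
    g.inChart (σ t) (c t) (deriv (deriv c) t) w
      + g.christoffel (σ t) (c t) (deriv c t) (deriv c t) w = 0

/-- The bundle of nonzero null vectors; the metric identifies it with the nonzero null cone in the
cotangent bundle. -/
def LorentzMetric.nullCone (g : LorentzMetric n M) : Set (TangentBundle (𝓡 (n + 2)) M) :=
  {v | v.snd ≠ 0 ∧ g.form v.proj v.snd v.snd = 0}

/-- An affinely parametrized null geodesic on the set `J` of parameters. -/
def LorentzMetric.IsNullGeodesicOn (g : LorentzMetric n M) (σ : ℝ → M) (J : Set ℝ) : Prop :=
  g.IsGeodesicOn σ J ∧ ∀ t ∈ J, velocity n σ t ∈ g.nullCone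

/-- Two null vectors generate the same unparametrized null geodesic: some affinely parametrized null
geodesic passes through both, up to a positive rescaling. -/
def LorentzMetric.SameNullGeodesic (g : LorentzMetric n M)
    (v w : TangentBundle (𝓡 (n + 2)) M) : Prop :=
  ∃ (σ : ℝ → M) (J : Set ℝ), IsOpen J ∧ J.OrdConnected ∧ g.IsNullGeodesicOn σ J ∧
    ∃ a ∈ J, ∃ b ∈ J, velocity n σ a = v ∧
      ∃ c : ℝ, 0 < c ∧ velocity n σ b = ⟨w.proj, c • w.snd⟩

/-- `T_vΣ`, the tangent space of the null cone at `v`: the kernel of the differential of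
`v ↦ g(v, v)`. -/
def LorentzMetric.coneTangent (g : LorentzMetric n M) (v : TangentBundle (𝓡 (n + 2)) M) :
    Submodule ℝ (TangentSpace (𝓡 (n + 2)).tangent v) :=
  LinearMap.ker (mfderiv (𝓡 (n + 2)).tangent 𝓘(ℝ, ℝ)
    (fun w : TangentBundle (𝓡 (n + 2)) M ↦ g.form w.proj w.snd w.snd) v).toLinearMap

/-- The differential at `v` of the projection `TM → M`. -/
def dproj (v : TangentBundle (𝓡 (n + 2)) M) :
    TangentSpace (𝓡 (n + 2)).tangent v →L[ℝ] TangentSpace (𝓡 (n + 2)) v.proj :=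
  mfderiv (𝓡 (n + 2)).tangent (𝓡 (n + 2))
    (fun w : TangentBundle (𝓡 (n + 2)) M ↦ w.proj) v

/-- The tautological `1`-form, transported to `TM` by the metric: `α_v(ξ) = g(v, dπ ξ)`. -/
def LorentzMetric.tautological (g : LorentzMetric n M) (v : TangentBundle (𝓡 (n + 2)) M)
    (ξ : TangentSpace (𝓡 (n + 2)).tangent v) : ℝ :=
  g.form v.proj v.snd (dproj v ξ)

/-- The hyperplane `k^⊥ ⊂ T_xM` attached to `v = (x, k)`. -/
def LorentzMetric.perp (g : LorentzMetric n M) (v : TangentBundle (𝓡 (n + 2)) M) :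
    Submodule ℝ (TangentSpace (𝓡 (n + 2)) v.proj) :=
  LinearMap.ker (g.form v.proj v.snd).toLinearMap

/-- The screen quotient `E = k^⊥ / ⟨k⟩`. -/
abbrev LorentzMetric.Screen (g : LorentzMetric n M) (v : TangentBundle (𝓡 (n + 2)) M) : Type :=
  g.perp v ⧸ (Submodule.span ℝ {v.snd}).submoduleOf (g.perp v)

/-- The null quotient line `N = T_xM / k^⊥`. -/
abbrev LorentzMetric.NullLine (g : LorentzMetric n M) (v : TangentBundle (𝓡 (n + 2)) M) : Type :=
  TangentSpace (𝓡 (n + 2)) v.proj ⧸ g.perp v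

/-- The weighted normal model `E ⊕ N`. -/
abbrev LorentzMetric.WeightedNormal (g : LorentzMetric n M)
    (v : TangentBundle (𝓡 (n + 2)) M) : Type :=
  g.Screen v × g.NullLine v

end Spacetime

/-- The dilation `(X, V) ↦ (r X, r² V)` of a sum of a weight-one and a weight-two space. -/
def dilation (X V : Type*) [AddCommGroup X] [Module ℝ X] [AddCommGroup V] [Module ℝ V] (r : ℝ) :
    X × V →ₗ[ℝ] X × V :=
  LinearMap.prodMap (r • LinearMap.id) (r ^ 2 • LinearMap.id)

/-! ## The contact manifold of null geodesics -/

section ContactManifold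

variable {n : ℕ} {M : Type*} [TopologicalSpace M]
  [ChartedSpace (EuclideanSpace ℝ (Fin (n + 2))) M]
  [IsManifold (𝓡 (n + 2)) ∞ M]
  {𝒩 : Type*} [TopologicalSpace 𝒩]
  [ChartedSpace (EuclideanSpace ℝ (Fin (2 * n + 1))) 𝒩]
  [IsManifold (𝓡 (2 * n + 1)) ∞ 𝒩]

/-- The `(2n+1)`-dimensional manifold `𝒩` is the space of unparametrized null geodesics of `(M, g)`:
it is the quotient manifold of the null cone `Σ` by the geodesic flow and the positive scalings, that
is, there is a smooth surjective submersion `Σ → 𝒩` whose fibres are the classes of null vectors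
generating the same unparametrized null geodesic. The quotient map is extended to an
open neighbourhood of `Σ` in `TM` (arbitrarily), only in order to speak of its smoothness. -/
structure NullGeodesicSpace (g : LorentzMetric n M) (𝒩 : Type*) [TopologicalSpace 𝒩]
    [ChartedSpace (EuclideanSpace ℝ (Fin (2 * n + 1))) 𝒩]
    [IsManifold (𝓡 (2 * n + 1)) ∞ 𝒩] where
  proj : TangentBundle (𝓡 (n + 2)) M → 𝒩
  dom : Set (TangentBundle (𝓡 (n + 2)) M)
  isOpen_dom : IsOpen dom
  nullCone_subset : g.nullCone ⊆ dom
  contMDiffOn : ContMDiffOn (𝓡 (n + 2)).tangent (𝓡 (2 * n + 1)) ∞ proj dom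
  surjective : ∀ y, ∃ v ∈ g.nullCone, proj v = y
  submersion : ∀ v ∈ g.nullCone, ∀ η : TangentSpace (𝓡 (2 * n + 1)) (proj v),
    ∃ ξ ∈ g.coneTangent v, mfderiv (𝓡 (n + 2)).tangent (𝓡 (2 * n + 1)) proj v ξ = η
  fiber : ∀ v ∈ g.nullCone, ∀ w ∈ g.nullCone, proj v = proj w ↔ g.SameNullGeodesic v w

namespace NullGeodesicSpace

variable {g : LorentzMetric n M} (q : NullGeodesicSpace g 𝒩)

/-- The first-order variation `ξ ∈ T_vΣ` of the null vector `v` represents the tangent vector `η` at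
the point `y = [γ]` of `𝒩`, i.e. `v` lies over `y` and `dq(ξ) = η`. -/
def Represents (v : TangentBundle (𝓡 (n + 2)) M) (ξ : TangentSpace (𝓡 (n + 2)).tangent v)
    (y : 𝒩) (η : TangentSpace (𝓡 (2 * n + 1)) y) : Prop :=
  ξ ∈ g.coneTangent v ∧
    tangentMap (𝓡 (n + 2)).tangent (𝓡 (2 * n + 1)) q.proj ⟨v, ξ⟩ = ⟨y, η⟩

/-- The contact hyperplane `C_y ⊂ T_y𝒩`, the image of the kernel of the tautological form on the null
cone (the abreast variations). The images from the various null vectors over `y` coincide. -/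
def contactHyperplane (y : 𝒩) : Submodule ℝ (TangentSpace (𝓡 (2 * n + 1)) y) :=
  Submodule.span ℝ {η | ∃ v ∈ g.nullCone, ∃ ξ, g.tautological v ξ = 0 ∧ q.Represents v ξ y η}

/-- The contact line `L_y = T_y𝒩 / C_y`. -/
abbrev ContactLine (y : 𝒩) : Type :=
  TangentSpace (𝓡 (2 * n + 1)) y ⧸ q.contactHyperplane y

/-- The contact directions at `y` represented by variations of `v` that are vertical for `TM → M`,
i.e. by variations of the null geodesic that vanish at the base point of `v`. -/
def vertical (v : TangentBundle (𝓡 (n + 2)) M) (y : 𝒩) :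
    Submodule ℝ (q.contactHyperplane y) :=
  Submodule.span ℝ {X | ∃ ξ, dproj v ξ = 0 ∧ q.Represents v ξ y X}

end NullGeodesicSpace

/-- A contact scale near `y`: a nowhere vanishing smooth `1`-form `θ` on a neighbourhood of `y` whose
kernel is the contact distribution. -/
structure ContactScale {g : LorentzMetric n M} (q : NullGeodesicSpace g 𝒩) (y : 𝒩) where
  form : ∀ z : 𝒩, TangentSpace (𝓡 (2 * n + 1)) z →L[ℝ] ℝ
  dom : Set 𝒩
  isOpen_dom : IsOpen dom
  mem_dom : y ∈ dom
  contMDiffOn : ContMDiffOn (𝓡 (2 * n + 1))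
    ((𝓡 (2 * n + 1)).prod 𝓘(ℝ, EuclideanSpace ℝ (Fin (2 * n + 1)) →L[ℝ] ℝ)) ∞
    (fun z ↦ Bundle.TotalSpace.mk' (EuclideanSpace ℝ (Fin (2 * n + 1)) →L[ℝ] ℝ)
      (E := fun z : 𝒩 ↦ TangentSpace (𝓡 (2 * n + 1)) z →L[ℝ] ℝ) z (form z)) dom
  form_ne_zero : ∀ z ∈ dom, form z ≠ 0
  ker_form : ∀ z ∈ dom, LinearMap.ker (form z).toLinearMap = q.contactHyperplane z

namespace ContactScale

variable {g : LorentzMetric n M} {q : NullGeodesicSpace g 𝒩} {y : 𝒩} (θ : ContactScale q y)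

/-- The coordinate expression of the `1`-form `θ` in the preferred chart at `y`. -/
def inChart (z : EuclideanSpace ℝ (Fin (2 * n + 1))) :
    EuclideanSpace ℝ (Fin (2 * n + 1)) →L[ℝ] ℝ :=
  (θ.form ((extChartAt (𝓡 (2 * n + 1)) y).symm z)).comp
    (mfderiv 𝓘(ℝ, EuclideanSpace ℝ (Fin (2 * n + 1))) (𝓡 (2 * n + 1))
      (extChartAt (𝓡 (2 * n + 1)) y).symm z)

/-- The exterior derivative `dθ` at `y`, computed in the preferred chart at `y` (through which
Mathlib identifies `T_y𝒩` with the model space). -/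
def extDeriv :
    TangentSpace (𝓡 (2 * n + 1)) y →L[ℝ] TangentSpace (𝓡 (2 * n + 1)) y →L[ℝ] ℝ :=
  let A : EuclideanSpace ℝ (Fin (2 * n + 1)) →L[ℝ] EuclideanSpace ℝ (Fin (2 * n + 1)) →L[ℝ] ℝ :=
    fderiv ℝ θ.inChart (extChartAt (𝓡 (2 * n + 1)) y y)
  A - A.flip

/-- `R` is the value at `y` of the Reeb field: `θ(R) = 1` and `ι_R dθ = 0`. -/
def IsReeb (R : TangentSpace (𝓡 (2 * n + 1)) y) : Prop :=
  θ.form y R = 1 ∧ ∀ X, θ.extDeriv R X = 0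

/-- A subspace `Λ` of the contact hyperplane is Lagrangian for the Levi form `dθ|_C`: it
equals its own orthogonal. -/
def IsLagrangian (Λ : Submodule ℝ (q.contactHyperplane y)) : Prop :=
  ∀ X : q.contactHyperplane y, X ∈ Λ ↔ ∀ Y ∈ Λ, θ.extDeriv X Y = 0

theorem form_surjective : Function.Surjective (θ.form y).toLinearMap := by
  apply LinearMap.surjective
  intro h
  exact θ.form_ne_zero y θ.mem_dom (by ext x; exact congrArg (fun f ↦ f x) h)

/-- The trivialization `L_y ≃ ℝ` of the contact line induced by `θ`. -/
def lineEquiv : q.ContactLine y ≃ₗ[ℝ] ℝ :=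
  (Submodule.quotEquivOfEq _ _ (θ.ker_form y θ.mem_dom).symm).trans
    ((θ.form y).toLinearMap.quotKerEquivOfSurjective θ.form_surjective)

/-- The Heisenberg tangent model `C_y ⊕ L_y` at `y` (the nilpotent approximation). -/
def HeisenbergTangent (_θ : ContactScale q y) : Type :=
  q.contactHyperplane y × q.ContactLine y

instance : AddCommGroup θ.HeisenbergTangent :=
  inferInstanceAs (AddCommGroup (q.contactHyperplane y × q.ContactLine y))

instance : Module ℝ θ.HeisenbergTangent :=
  inferInstanceAs (Module ℝ (q.contactHyperplane y × q.ContactLine y))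

/-- The bracket `C_y × C_y → L_y` induced by the Lie bracket of sections of the contact distribution,
through the identity `θ([X, Y]) = -dθ(X, Y)` for such sections. -/
instance : Bracket θ.HeisenbergTangent θ.HeisenbergTangent :=
  ⟨fun X Y ↦ (0, θ.lineEquiv.symm (-(θ.extDeriv X.1 Y.1)))⟩

theorem extDeriv_self (v : TangentSpace (𝓡 (2 * n + 1)) y) : θ.extDeriv v v = 0 := by
  simp only [extDeriv]
  exact sub_self _

theorem bracket_def (X Y : θ.HeisenbergTangent) :
    ⁅X, Y⁆ = ((0, θ.lineEquiv.symm (-(θ.extDeriv X.1 Y.1))) :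
      q.contactHyperplane y × q.ContactLine y) := rfl

theorem ext_heisenberg {X Y : θ.HeisenbergTangent} (h₁ : X.1 = Y.1) (h₂ : X.2 = Y.2) : X = Y :=
  Prod.ext h₁ h₂

@[simp] theorem fst_add (X Y : θ.HeisenbergTangent) : (X + Y).1 = X.1 + Y.1 := rfl

@[simp] theorem snd_add (X Y : θ.HeisenbergTangent) : (X + Y).2 = X.2 + Y.2 := rfl

@[simp] theorem fst_smul (r : ℝ) (X : θ.HeisenbergTangent) : (r • X).1 = r • X.1 := rfl

@[simp] theorem snd_smul (r : ℝ) (X : θ.HeisenbergTangent) : (r • X).2 = r • X.2 := rfl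

@[simp] theorem fst_bracket (X Y : θ.HeisenbergTangent) : ⁅X, Y⁆.1 = 0 := rfl

@[simp] theorem snd_bracket (X Y : θ.HeisenbergTangent) :
    ⁅X, Y⁆.2 = θ.lineEquiv.symm (-(θ.extDeriv X.1 Y.1)) := rfl

instance : LieRing θ.HeisenbergTangent where
  add_lie X Y Z := by
    apply θ.ext_heisenberg
    · simp
    · simp only [snd_bracket, snd_add, fst_add, ← map_add]
      congr 1
      simp
      ring
  lie_add X Y Z := by
    apply θ.ext_heisenberg
    · simp
    · simp only [snd_bracket, snd_add, fst_add, ← map_add]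
      congr 1
      simp
      ring
  lie_self X := by
    apply θ.ext_heisenberg
    · rfl
    · rw [snd_bracket, extDeriv_self, neg_zero, map_zero]
      rfl
  leibniz_lie X Y Z := by
    apply θ.ext_heisenberg
    · simp
    · simp

instance : LieAlgebra ℝ θ.HeisenbergTangent where
  lie_smul r X Y := by
    apply θ.ext_heisenberg
    · simp
    · simp only [snd_bracket, snd_smul, fst_smul, ← map_smul]
      congr 1
      simp

/-- The Heisenberg dilation `(X, V) ↦ (r X, r² V)`. -/
def heisenbergDilation (r : ℝ) : θ.HeisenbergTangent →ₗ[ℝ] θ.HeisenbergTangent :=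
  dilation (q.contactHyperplane y) (q.ContactLine y) r

/-- The slice `Λ ⊕ L_y` of the Heisenberg tangent model along a polarization `Λ ⊂ C_y`. For every
complement `Λ'` of `Λ` in `C_y` it projects isomorphically to the quotient of `C_y ⊕ L_y` by `Λ'`. -/
abbrev Polarized (_θ : ContactScale q y) (Λ : Submodule ℝ (q.contactHyperplane y)) : Type :=
  Λ × q.ContactLine y

/-- The inclusion of the slice `Λ ⊕ L_y` in the Heisenberg tangent model. -/
def polarizedInclusion (Λ : Submodule ℝ (q.contactHyperplane y)) :
    θ.Polarized Λ →ₗ[ℝ] θ.HeisenbergTangent :=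
  LinearMap.prodMap Λ.subtype LinearMap.id

/-- `Φ` is the graded evaluation map at `v = (x, k)`: if the variation `ξ` of `v` represents
`η ∈ T_y𝒩`, with displacement `dπ ξ ∈ T_xM`, then the class of `η` in `L_y` goes to the class of the
displacement in `N`, and, for `η ∈ C_y`, the displacement lies in `k^⊥` and `η` goes to its
class in `E`. -/
def IsGradedEvaluation (v : TangentBundle (𝓡 (n + 2)) M)
    (Φ : θ.HeisenbergTangent →ₗ[ℝ] g.WeightedNormal v) : Prop :=
  ∃ (Φ₁ : q.contactHyperplane y →ₗ[ℝ] g.Screen v) (Φ₂ : q.ContactLine y →ₗ[ℝ] g.NullLine v),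
    (∀ X, Φ X = (Φ₁ X.1, Φ₂ X.2)) ∧
    (∀ ξ η, q.Represents v ξ y η →
      Φ₂ ((q.contactHyperplane y).mkQ η) = (g.perp v).mkQ (dproj v ξ)) ∧
    (∀ ξ (X : q.contactHyperplane y), q.Represents v ξ y X →
      ∃ h : dproj v ξ ∈ g.perp v, Φ₁ X = Submodule.Quotient.mk ⟨dproj v ξ, h⟩)

end ContactScale

end ContactManifold

end PenroseLimit

end

open PenroseLimit

/-!
The points of the space `𝒩` of null geodesics are fibres of `q : Σ → 𝒩`, and everything is read
off from the variations `ξ ∈ T_vΣ` of one null vector `v = (x, k)`: the tangent vector `dq(ξ)` of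
`𝒩` and the displacement `dπ(ξ)` in `T_xM`. The kernel of `dq` on `T_vΣ` has dimension two; it is
spanned by the geodesic direction, whose displacement is `k`, and the scaling direction, whose
displacement is `0`. Hence `dπ(ξ)` is determined modulo `k` by `dq(ξ)`, and conversely a variation
with displacement proportional to `k` can be replaced by a vertical one. Since a contact scale
pulls back to a multiple of the tautological form `α`
(`ContactScale.form_mfderiv_proj_eq_zero_iff`), `dq(ξ)` is in the contact hyperplane exactly when
`dπ(ξ)` is in `k^⊥`. This gives the graded evaluation `C ⊕ L → E ⊕ N`, with kernel the vertical
variations (`ContactScale.IsGradedEvaluation.exists_components`).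

The symplectic statements come from `dθ = f dα` on the abreast variations, with `f ≠ 0`
(`IsLocalModel.exists_dOne_eq`). In coordinates `dα` pairs a vertical variation `(0, κ)` with a
variation of displacement `w` to `g(κ, w)`; as the metric is definite on `k^⊥ / ⟨k⟩`, the vertical
variations form a Lagrangian subspace and the Levi form is nondegenerate on `C`. The dimensions,
the centre of the Heisenberg algebra and the Reeb vector follow by linear algebra, and so does the
isomorphism of the slice `Λ ⊕ L` with `E ⊕ N`, because two Lagrangian subspaces have equal
dimension.

For the behaviour along a geodesic, tangent vectors of `𝒩` are lifted to variations at all null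
vectors near a given one, smoothly (`IsLocalModel.exists_frame`). The displacements of the lifts
are smooth fields along the geodesic. Suppose that `Λ` meets the vertical subspaces at parameters
accumulating at `u₀`. A limit of unit vectors in the intersections is a nonzero `X ∈ Λ` that is
represented by a vertical variation `(0, κ)` at `u₀`, and the derivative of its displacement along
the geodesic, which is `κ` modulo `k`, lies among the displacements of `Λ`
(`exists_kernel_derivative_mem_map`). As `Λ` is isotropic, the pairing above makes `κ` orthogonal
to itself; so `κ` is a multiple of `k`, and `X = 0`, a contradiction. The identification of the
derivative of the displacement with `κ` takes the place of the Jacobi equation: the geodesics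
enter only through the direction field they define on the null cone, and no differential equation
is solved.
-/

open Set Filter Topology
open scoped Manifold ContDiff Bundle

namespace PenroseLimit

set_option synthInstance.maxHeartbeats 200000

/-! ### Calculus on regular level sets -/

section Calculus

variable {P V Y : Type*} [NormedAddCommGroup P] [NormedSpace ℝ P]
  [NormedAddCommGroup V] [NormedSpace ℝ V] [NormedAddCommGroup Y] [NormedSpace ℝ Y]

/-- A function vanishing on a regular level set has zero derivative in the directions tangent to
that level set. -/
theorem fderiv_apply_eq_zero_of_vanishing_on_zeroLocus [FiniteDimensional ℝ P]
    {F : P → ℝ} {p : P} (hF : ContDiffAt ℝ 1 F p) (hFp : F p = 0) (hdF : fderiv ℝ F p ≠ 0)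
    {h : P → Y} (hh : DifferentiableAt ℝ h p) (hv : ∀ᶠ z in 𝓝 p, F z = 0 → h z = 0)
    {ξ : P} (hξ : fderiv ℝ F p ξ = 0) : fderiv ℝ h p ξ = 0 := by
  have : CompleteSpace P := FiniteDimensional.complete ℝ P
  have hs : HasStrictFDerivAt F (fderiv ℝ F p) p := hF.hasStrictFDerivAt one_ne_zero
  have hsurj : (fderiv ℝ F p).range = ⊤ := by
    rw [LinearMap.range_eq_top]
    exact LinearMap.surjective (fun h0 ↦ hdF (ContinuousLinearMap.coe_injective h0))
  set φ := hs.implicitFunction F (fderiv ℝ F p) hsurj (F p) with hφ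
  have hφd : HasFDerivAt φ (fderiv ℝ F p).ker.subtypeL 0 :=
    (hs.to_implicitFunction hsurj).hasFDerivAt
  have hφ0 : φ 0 = p := hs.implicitFunction_apply_image hsurj
  have hFφ : ∀ᶠ z in 𝓝 (0 : (fderiv ℝ F p).ker), F (φ z) = F p := by
    have := hs.map_implicitFunction_eq hsurj
    have := this.curry_nhds.self_of_nhds
    simpa using this
  have hcont : Tendsto φ (𝓝 0) (𝓝 p) := by
    have := hφd.continuousAt.tendsto
    rwa [hφ0] at this
  have hz : (fun z ↦ h (φ z)) =ᶠ[𝓝 0] fun _ ↦ 0 := by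
    filter_upwards [hFφ, hcont.eventually hv] with z h1 h2
    exact h2 (h1.trans hFp)
  have hd : HasFDerivAt (fun z ↦ h (φ z)) ((fderiv ℝ h p).comp (fderiv ℝ F p).ker.subtypeL) 0 := by
    refine HasFDerivAt.comp (g := h) _ ?_ hφd
    rw [hφ0]
    exact hh.hasFDerivAt
  have h0 := hd.unique ((hasFDerivAt_const (0 : Y) _).congr_of_eventuallyEq hz)
  exact congrArg (fun f ↦ f ⟨ξ, hξ⟩) h0

theorem contDiffAt_clm_prod {D : Type*} [NormedAddCommGroup D] [NormedSpace ℝ D] {m : ℕ∞ω}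
    {A : D → P →L[ℝ] V} {B : D → P →L[ℝ] Y} {p : D} (hA : ContDiffAt ℝ m A p)
    (hB : ContDiffAt ℝ m B p) : ContDiffAt ℝ m (fun z ↦ (A z).prod (B z)) p :=
  (ContinuousLinearMap.prodₗᵢ (𝕜 := ℝ) (E := P) (F := V) (G := Y) ℝ).contDiff.contDiffAt.comp p
    (hA.prodMk hB)

/-- A smooth family of linear maps that is surjective at one point has a family of right inverses
near that point, smooth wherever the given family is. -/
theorem exists_contDiffAt_rightInverse {D : Type*} [NormedAddCommGroup D] [NormedSpace ℝ D]
    [FiniteDimensional ℝ V] {m : ℕ∞ω} {B : D → P →L[ℝ] V} {p : D}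
    (hB : ContDiffAt ℝ m B p) (hs : Function.Surjective (B p)) :
    ∃ R : D → V →L[ℝ] P, ContDiffAt ℝ m R p ∧
      ∀ᶠ z in 𝓝 p, (ContDiffAt ℝ m B z → ContDiffAt ℝ m R z) ∧ ∀ v, B z (R z v) = v := by
  have : CompleteSpace V := FiniteDimensional.complete ℝ V
  obtain ⟨R₀', hR₀'⟩ := (B p).toLinearMap.exists_rightInverse_of_surjective
    (LinearMap.range_eq_top.2 hs)
  set R₀ : V →L[ℝ] P := LinearMap.toContinuousLinearMap R₀'
  have hR₀ : (B p).comp R₀ = ContinuousLinearMap.id ℝ V := by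
    ext v; exact congrArg (fun f ↦ f v) hR₀'
  have hC : ContDiffAt ℝ m (fun z ↦ (B z).comp R₀) p := hB.clm_comp contDiffAt_const
  have hinv : ∀ z, ((B z).comp R₀).IsInvertible → ContDiffAt ℝ m B z →
      ContDiffAt ℝ m (fun z ↦ R₀.comp ((B z).comp R₀).inverse) z := by
    rintro z ⟨e, he⟩ hz
    refine contDiffAt_const.clm_comp
      (ContDiffAt.comp (g := ContinuousLinearMap.inverse) z ?_ (hz.clm_comp contDiffAt_const))
    rw [← he]
    exact contDiffAt_map_inverse e
  refine ⟨fun z ↦ R₀.comp ((B z).comp R₀).inverse,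
    hinv p ⟨ContinuousLinearEquiv.refl ℝ V, hR₀.symm⟩ hB, ?_⟩
  have hev : ∀ᶠ z in 𝓝 p, ((B z).comp R₀).IsInvertible := by
    have h1 := (ContinuousLinearEquiv.nhds (ContinuousLinearEquiv.refl ℝ V))
    have h2 : Tendsto (fun z ↦ (B z).comp R₀) (𝓝 p)
        (𝓝 ((ContinuousLinearEquiv.refl ℝ V : V ≃L[ℝ] V) : V →L[ℝ] V)) := by
      have := hC.continuousAt.tendsto
      rw [hR₀] at this
      exact this
    filter_upwards [h2 h1] with z hz
    exact hz
  filter_upwards [hev] with z hz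
  refine ⟨hinv z hz, fun v ↦ ?_⟩
  have := hz.self_comp_inverse
  exact congrArg (fun f ↦ f v) this

/-- Near a point where `B` is surjective, a solution `ξ` of `B p ξ = c` extends to a smooth field of
solutions. -/
theorem exists_contDiffAt_solution [FiniteDimensional ℝ V] {m : ℕ∞ω} {B : P → P →L[ℝ] V} {p : P}
    (hB : ContDiffAt ℝ m B p) (hs : Function.Surjective (B p)) {ξ : P} {c : V} (hξ : B p ξ = c) :
    ∃ s : P → P, ContDiffAt ℝ m s p ∧ s p = ξ ∧ ∀ᶠ z in 𝓝 p, B z (s z) = c := by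
  obtain ⟨R, hR, hBR⟩ := exists_contDiffAt_rightInverse hB hs
  refine ⟨fun z ↦ ξ + R z (c - B z ξ), ?_, by simp [hξ], ?_⟩
  · exact contDiffAt_const.add (hR.clm_apply (contDiffAt_const.sub (hB.clm_apply contDiffAt_const)))
  · filter_upwards [hBR] with z hz
    simp [hz.2]

/-- The exterior derivative of a `1`-form on a vector space. -/
noncomputable def dOne (β : P → P →L[ℝ] ℝ) (p ξ ξ' : P) : ℝ :=
  fderiv ℝ β p ξ ξ' - fderiv ℝ β p ξ' ξ

theorem fderiv_clm_apply_field {W : Type*} [NormedAddCommGroup W] [NormedSpace ℝ W]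
    {β : P → W →L[ℝ] V} {s : P → W} {p : P}
    (hβ : DifferentiableAt ℝ β p) (hs : DifferentiableAt ℝ s p) (ξ : P) :
    fderiv ℝ (fun z ↦ β z (s z)) p ξ = fderiv ℝ β p ξ (s p) + β p (fderiv ℝ s p ξ) := by
  rw [fderiv_clm_apply hβ hs]
  simp [add_comm]

/-- If along the hypersurface `F = 0` the form `β` is a multiple of `α` on tangent directions,
with factor `f` at `p`, then `dβ = f dα` on the tangent directions at `p` annihilated by `α`.
Extending two such directions to fields annihilated by `dF` and `α`, both sides are computed by the
bracket of the fields, which is again tangent to the hypersurface. -/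
theorem dOne_eq_mul_dOne [FiniteDimensional ℝ P] {F : P → ℝ} {α β : P → P →L[ℝ] ℝ} {p : P}
    (hF : ContDiffAt ℝ 2 F p) (hα : ContDiffAt ℝ 1 α p) (hβ : DifferentiableAt ℝ β p)
    (hFp : F p = 0) (hker : ∀ᶠ z in 𝓝 p, F z = 0 → ∀ ξ, fderiv ℝ F z ξ = 0 → α z ξ = 0 → β z ξ = 0)
    (hdF : fderiv ℝ F p ≠ 0) (hα0 : ∃ ζ, fderiv ℝ F p ζ = 0 ∧ α p ζ ≠ 0) {f : ℝ}
    (hf : ∀ ξ, fderiv ℝ F p ξ = 0 → β p ξ = f * α p ξ)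
    {ξ ξ' : P} (hξ : fderiv ℝ F p ξ = 0) (hξα : α p ξ = 0)
    (hξ' : fderiv ℝ F p ξ' = 0) (hξα' : α p ξ' = 0) :
    dOne β p ξ ξ' = f * dOne α p ξ ξ' := by
  have hdFs : ContDiffAt ℝ 1 (fderiv ℝ F) p := hF.fderiv_right (by norm_num)
  set B : P → P →L[ℝ] ℝ × ℝ := fun z ↦ (fderiv ℝ F z).prod (α z) with hBdef
  have hB : ContDiffAt ℝ 1 B p := contDiffAt_clm_prod hdFs hα
  have hsurj : Function.Surjective (B p) := by
    obtain ⟨ζ, hζ, hζα⟩ := hα0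
    obtain ⟨w, hw⟩ : ∃ w, fderiv ℝ F p w ≠ 0 := by
      by_contra! h
      exact hdF (ContinuousLinearMap.ext h)
    rintro ⟨a, b⟩
    refine ⟨(a / fderiv ℝ F p w) • w +
      ((b - a / fderiv ℝ F p w * α p w) / α p ζ) • ζ, ?_⟩
    simp only [hBdef, ContinuousLinearMap.prod_apply, map_add, map_smul, hζ]
    ext <;> simp <;> field_simp
    ring
  obtain ⟨s, hs, hsp, hBs⟩ := exists_contDiffAt_solution hB hsurj (ξ := ξ) (c := 0)
    (by simp [hBdef, hξ, hξα])
  obtain ⟨s', hs', hsp', hBs'⟩ := exists_contDiffAt_solution hB hsurj (ξ := ξ') (c := 0)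
    (by simp [hBdef, hξ', hξα'])
  have key : ∀ (r : P → P), ContDiffAt ℝ 1 r p → (∀ᶠ z in 𝓝 p, B z (r z) = 0) →
      ∀ ζ, fderiv ℝ F p ζ = 0 →
      fderiv ℝ (fderiv ℝ F) p ζ (r p) + fderiv ℝ F p (fderiv ℝ r p ζ) = 0 ∧
      fderiv ℝ α p ζ (r p) + α p (fderiv ℝ r p ζ) = 0 ∧
      fderiv ℝ β p ζ (r p) + β p (fderiv ℝ r p ζ) = 0 := by
    intro r hr hBr ζ hζ
    have hrd := hr.differentiableAt one_ne_zero
    have hαd := hα.differentiableAt one_ne_zero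
    have hFd := hdFs.differentiableAt one_ne_zero
    refine ⟨?_, ?_, ?_⟩
    · rw [← fderiv_clm_apply_field hFd hrd]
      have : (fun z ↦ fderiv ℝ F z (r z)) =ᶠ[𝓝 p] fun _ ↦ 0 := by
        filter_upwards [hBr] with z hz
        exact congrArg Prod.fst hz
      rw [this.fderiv_eq]; simp
    · rw [← fderiv_clm_apply_field hαd hrd]
      have : (fun z ↦ α z (r z)) =ᶠ[𝓝 p] fun _ ↦ 0 := by
        filter_upwards [hBr] with z hz
        exact congrArg Prod.snd hz
      rw [this.fderiv_eq]; simp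
    · rw [← fderiv_clm_apply_field hβ hrd]
      refine fderiv_apply_eq_zero_of_vanishing_on_zeroLocus (hF.of_le (by norm_num)) hFp hdF
        (hβ.clm_apply hrd) ?_ hζ
      filter_upwards [hBr, hker] with z hz hk hFz
      exact hk hFz _ (congrArg Prod.fst hz) (congrArg Prod.snd hz)
  obtain ⟨a1, a2, a3⟩ := key s' hs' hBs' ξ hξ
  obtain ⟨b1, b2, b3⟩ := key s hs hBs ξ' hξ'
  rw [hsp'] at a1 a2 a3
  rw [hsp] at b1 b2 b3
  have hsymm : fderiv ℝ (fderiv ℝ F) p ξ ξ' = fderiv ℝ (fderiv ℝ F) p ξ' ξ :=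
    hF.isSymmSndFDerivAt (by simp) ξ ξ'
  have h4 := hf (fderiv ℝ s' p ξ - fderiv ℝ s p ξ') (by rw [map_sub]; linarith)
  rw [map_sub, map_sub] at h4
  simp only [dOne]
  linear_combination a3 - b3 - f * (a2 - b2) - h4

/-- If `β = Q^* Θ`, then `dβ = Q^* dΘ`. -/
theorem dOne_pullback {T : Type*} [NormedAddCommGroup T] [NormedSpace ℝ T] {Q : P → T}
    {Θ : T → T →L[ℝ] ℝ} {p : P} (hQ : ContDiffAt ℝ 2 Q p) (hΘ : DifferentiableAt ℝ Θ (Q p))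
    (ξ ξ' : P) :
    dOne (fun z ↦ (Θ (Q z)).comp (fderiv ℝ Q z)) p ξ ξ' =
      dOne Θ (Q p) (fderiv ℝ Q p ξ) (fderiv ℝ Q p ξ') := by
  have hdQ : DifferentiableAt ℝ (fderiv ℝ Q) p :=
    (hQ.fderiv_right (m := 1) (by norm_num)).differentiableAt one_ne_zero
  have hQd : DifferentiableAt ℝ Q p := hQ.differentiableAt (by norm_num)
  have hΘQ : DifferentiableAt ℝ (fun z ↦ Θ (Q z)) p := hΘ.comp p hQd
  have hsymm : fderiv ℝ (fderiv ℝ Q) p ξ ξ' = fderiv ℝ (fderiv ℝ Q) p ξ' ξ :=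
    hQ.isSymmSndFDerivAt (by simp) ξ ξ'
  have hcomp : ∀ ζ, fderiv ℝ (fun z ↦ Θ (Q z)) p ζ = fderiv ℝ Θ (Q p) (fderiv ℝ Q p ζ) := by
    intro ζ
    rw [show (fun z ↦ Θ (Q z)) = Θ ∘ Q from rfl, fderiv_comp p hΘ hQd]
    rfl
  simp only [dOne]
  rw [fderiv_clm_comp hΘQ hdQ]
  simp [hcomp, hsymm]

end Calculus

/-! ### Null variations in a coordinate model -/

section LocalModel

variable {E T : Type*} [NormedAddCommGroup E] [NormedSpace ℝ E]
  [NormedAddCommGroup T] [NormedSpace ℝ T]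

/-- The function `(x, k) ↦ G_x(k, k)` whose zeros are the null vectors. -/
noncomputable def nullFun (G : E → E →L[ℝ] E →L[ℝ] ℝ) (p : E × E) : ℝ := G p.1 p.2 p.2

/-- The tautological form `(x, k) ↦ G_x(k, dx)`. -/
noncomputable def tautForm (G : E → E →L[ℝ] E →L[ℝ] ℝ) (p : E × E) : E × E →L[ℝ] ℝ :=
  (G p.1 p.2).comp (ContinuousLinearMap.fst ℝ E E)

/-- The coordinate expression, near a null vector `p₀ = (x₀, k₀)`, of a Lorentzian metric `G`, of
the quotient map `Q` to the space of null geodesics and of a contact scale `Θ` there. The null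
geodesic through a null vector enters only through its direction on the null cone, i.e. through one
vector `(k, a)` in the kernel of `dQ`. The signature of `G` enters only through `mem_span`. -/
structure IsLocalModel (G : E → E →L[ℝ] E →L[ℝ] ℝ) (Q : E × E → T) (Θ : T → T →L[ℝ] ℝ)
    (p₀ : E × E) : Prop where
  finrank_eq : 2 * Module.finrank ℝ E = Module.finrank ℝ T + 3
  symm : ∀ x a b, G x a b = G x b a
  contDiffAt_metric : ContDiffAt ℝ ∞ G p₀.1
  contDiffAt_quotient : ContDiffAt ℝ ∞ Q p₀
  contDiffAt_scale : ContDiffAt ℝ ∞ Θ (Q p₀)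
  ne_zero : p₀.2 ≠ 0
  null : G p₀.1 p₀.2 p₀.2 = 0
  metric_ne_zero : G p₀.1 p₀.2 ≠ 0
  mem_span : ∀ w, G p₀.1 p₀.2 w = 0 → G p₀.1 w w = 0 → w ∈ Submodule.span ℝ {p₀.2}
  submersion : ∀ᶠ p in 𝓝 p₀, nullFun G p = 0 → ∀ η, ∃ ξ, fderiv ℝ (nullFun G) p ξ = 0 ∧
    fderiv ℝ Q p ξ = η
  geodesic : ∀ᶠ p in 𝓝 p₀, nullFun G p = 0 → ∃ a, fderiv ℝ (nullFun G) p (p.2, a) = 0 ∧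
    fderiv ℝ Q p (p.2, a) = 0
  scaling : ∀ᶠ p in 𝓝 p₀, nullFun G p = 0 → fderiv ℝ Q p (0, p.2) = 0
  contact : ∀ᶠ p in 𝓝 p₀, nullFun G p = 0 → ∀ ξ, fderiv ℝ (nullFun G) p ξ = 0 →
    (Θ (Q p) (fderiv ℝ Q p ξ) = 0 ↔ G p.1 p.2 ξ.1 = 0)

theorem differentiableAt_metric_fst {G : E → E →L[ℝ] E →L[ℝ] ℝ} {p : E × E}
    (hG : DifferentiableAt ℝ G p.1) : DifferentiableAt ℝ (fun z : E × E ↦ G z.1) p :=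
  DifferentiableAt.comp (𝕜 := ℝ) (g := G) (f := Prod.fst) p hG (by fun_prop)

theorem contDiffAt_metric_fst {G : E → E →L[ℝ] E →L[ℝ] ℝ} {p : E × E} {m : ℕ∞ω}
    (hG : ContDiffAt ℝ m G p.1) : ContDiffAt ℝ m (fun z : E × E ↦ G z.1) p :=
  ContDiffAt.comp (g := G) (f := Prod.fst) p hG contDiffAt_fst

theorem contDiffAt_nullFun {G : E → E →L[ℝ] E →L[ℝ] ℝ} {p : E × E} {m : ℕ∞ω}
    (hG : ContDiffAt ℝ m G p.1) : ContDiffAt ℝ m (nullFun G) p :=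
  ((contDiffAt_metric_fst hG).clm_apply contDiffAt_snd).clm_apply contDiffAt_snd

theorem fderiv_metric_apply {G : E → E →L[ℝ] E →L[ℝ] ℝ} {p : E × E}
    (hG : DifferentiableAt ℝ G p.1) (ξ : E × E) :
    fderiv ℝ (fun z : E × E ↦ G z.1 z.2) p ξ = fderiv ℝ G p.1 ξ.1 p.2 + G p.1 ξ.2 := by
  have h1 : fderiv ℝ (fun z : E × E ↦ G z.1) p =
      (fderiv ℝ G p.1).comp (ContinuousLinearMap.fst ℝ E E) := by
    rw [← fderiv_fst (p := p)]
    exact fderiv_comp (𝕜 := ℝ) (g := G) (f := Prod.fst) p hG (by fun_prop)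
  rw [fderiv_clm_apply_field (differentiableAt_metric_fst hG) differentiableAt_snd, h1, fderiv_snd]
  simp

theorem fderiv_nullFun {G : E → E →L[ℝ] E →L[ℝ] ℝ} (hs : ∀ x a b, G x a b = G x b a) {p : E × E}
    (hG : DifferentiableAt ℝ G p.1) (ξ : E × E) :
    fderiv ℝ (nullFun G) p ξ = fderiv ℝ G p.1 ξ.1 p.2 p.2 + 2 * G p.1 p.2 ξ.2 := by
  have h1 : DifferentiableAt ℝ (fun z : E × E ↦ G z.1 z.2) p :=
    (differentiableAt_metric_fst hG).clm_apply differentiableAt_snd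
  have := fderiv_clm_apply_field h1 (differentiableAt_snd (𝕜 := ℝ) (p := p)) ξ
  rw [show nullFun G = fun z : E × E ↦ G z.1 z.2 z.2 from rfl, this, fderiv_metric_apply hG,
    fderiv_snd]
  simp [hs p.1 ξ.2 p.2]
  ring

theorem contDiffAt_tautForm {G : E → E →L[ℝ] E →L[ℝ] ℝ} {p : E × E} {m : ℕ∞ω}
    (hG : ContDiffAt ℝ m G p.1) : ContDiffAt ℝ m (tautForm G) p :=
  ((contDiffAt_metric_fst hG).clm_apply contDiffAt_snd).clm_comp contDiffAt_const

theorem dOne_tautForm {G : E → E →L[ℝ] E →L[ℝ] ℝ} {p : E × E}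
    (hG : DifferentiableAt ℝ G p.1) (ξ ξ' : E × E) :
    dOne (tautForm G) p ξ ξ' = fderiv ℝ G p.1 ξ.1 p.2 ξ'.1 + G p.1 ξ.2 ξ'.1
      - (fderiv ℝ G p.1 ξ'.1 p.2 ξ.1 + G p.1 ξ'.2 ξ.1) := by
  have h1 : DifferentiableAt ℝ (fun z : E × E ↦ G z.1 z.2) p :=
    (differentiableAt_metric_fst hG).clm_apply differentiableAt_snd
  have h2 : ∀ ζ, fderiv ℝ (tautForm G) p ζ =
      (fderiv ℝ (fun z : E × E ↦ G z.1 z.2) p ζ).comp (ContinuousLinearMap.fst ℝ E E) := by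
    intro ζ
    rw [show tautForm G = fun z : E × E ↦
      (G z.1 z.2).comp (ContinuousLinearMap.fst ℝ E E) from rfl,
      fderiv_clm_comp h1 (differentiableAt_const _)]
    simp
  simp [dOne, h2, fderiv_metric_apply hG]

namespace IsLocalModel

variable {G : E → E →L[ℝ] E →L[ℝ] ℝ} {Q : E × E → T} {Θ : T → T →L[ℝ] ℝ} {p₀ : E × E}

theorem differentiableAt_metric (hm : IsLocalModel G Q Θ p₀) : DifferentiableAt ℝ G p₀.1 :=
  hm.contDiffAt_metric.differentiableAt (by simp)

theorem fderiv_vertical (hm : IsLocalModel G Q Θ p₀) (w : E) :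
    fderiv ℝ (nullFun G) p₀ (0, w) = 2 * G p₀.1 p₀.2 w := by
  simp [fderiv_nullFun hm.symm hm.differentiableAt_metric]

theorem fderiv_ne_zero (hm : IsLocalModel G Q Θ p₀) : fderiv ℝ (nullFun G) p₀ ≠ 0 := by
  intro h
  refine hm.metric_ne_zero (ContinuousLinearMap.ext fun w ↦ ?_)
  have := hm.fderiv_vertical w
  rw [h] at this
  simpa using this.symm

theorem contDiffAt_nullFun (hm : IsLocalModel G Q Θ p₀) : ContDiffAt ℝ ∞ (nullFun G) p₀ :=
  PenroseLimit.contDiffAt_nullFun hm.contDiffAt_metric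

/-- Every displacement of the base point extends to a variation tangent to the null cone. -/
theorem exists_tangent (hm : IsLocalModel G Q Θ p₀) (w : E) :
    ∃ κ, fderiv ℝ (nullFun G) p₀ (w, κ) = 0 := by
  obtain ⟨b, hb⟩ : ∃ b, G p₀.1 p₀.2 b ≠ 0 := by
    by_contra! h
    exact hm.metric_ne_zero (ContinuousLinearMap.ext h)
  refine ⟨(-(fderiv ℝ G p₀.1 w p₀.2 p₀.2) / 2 / G p₀.1 p₀.2 b) • b, ?_⟩
  rw [fderiv_nullFun hm.symm hm.differentiableAt_metric]
  simp
  field_simp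
  ring

/-- The degenerate directions of the metric on `k₀^⊥` are the multiples of `k₀`. -/
theorem mem_span_of_forall (hm : IsLocalModel G Q Θ p₀) {b : E}
    (hb : ∀ w, G p₀.1 p₀.2 w = 0 → G p₀.1 w b = 0) : b ∈ Submodule.span ℝ {p₀.2} := by
  have h1 := hb p₀.2 hm.null
  exact hm.mem_span b h1 (hb b h1)

/-- A variation whose displacement is a multiple of `k₀` can be replaced by a vertical one
representing the same tangent vector of the quotient. -/
theorem exists_vertical (hm : IsLocalModel G Q Θ p₀) {ξ : E × E}
    (hξ : fderiv ℝ (nullFun G) p₀ ξ = 0) (h : ξ.1 ∈ Submodule.span ℝ {p₀.2}) :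
    ∃ κ, fderiv ℝ (nullFun G) p₀ (0, κ) = 0 ∧ fderiv ℝ Q p₀ (0, κ) = fderiv ℝ Q p₀ ξ := by
  obtain ⟨a, ha, ha'⟩ := hm.geodesic.self_of_nhds hm.null
  obtain ⟨s, hs⟩ := Submodule.mem_span_singleton.1 h
  have e : ((0 : E), ξ.2 - s • a) = ξ - s • (p₀.2, a) := by
    ext <;> simp [hs]
  refine ⟨ξ.2 - s • a, ?_, ?_⟩ <;> rw [e, map_sub, map_smul] <;> simp [hξ, ha, ha']

theorem fderiv_quotient_vertical_eq_zero (hm : IsLocalModel G Q Θ p₀) {κ : E}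
    (hκ : κ ∈ Submodule.span ℝ {p₀.2}) : fderiv ℝ Q p₀ (0, κ) = 0 := by
  obtain ⟨s, rfl⟩ := Submodule.mem_span_singleton.1 hκ
  rw [show ((0 : E), s • p₀.2) = s • ((0 : E), p₀.2) by simp, map_smul,
    hm.scaling.self_of_nhds hm.null, smul_zero]

variable [FiniteDimensional ℝ E]

/-- At the null vectors, the quotient map and the equation of the null cone have a common kernel of
dimension two, spanned by the geodesic direction and the scaling direction. -/
theorem eventually_kernel [FiniteDimensional ℝ T] (hm : IsLocalModel G Q Θ p₀) :
    ∀ᶠ p in 𝓝 p₀, nullFun G p = 0 → ∀ a, fderiv ℝ (nullFun G) p (p.2, a) = 0 →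
      fderiv ℝ Q p (p.2, a) = 0 → ∀ ξ, fderiv ℝ (nullFun G) p ξ = 0 → fderiv ℝ Q p ξ = 0 →
      ∃ s t : ℝ, ξ = s • (p.2, a) + t • ((0 : E), p.2) := by
  have h1 : ∀ᶠ p in 𝓝 p₀, p.2 ≠ 0 := continuousAt_snd.eventually_ne hm.ne_zero
  have h2 : ∀ᶠ p in 𝓝 p₀, fderiv ℝ (nullFun G) p ≠ 0 :=
    (hm.contDiffAt_nullFun.fderiv_right (m := 0) (by simp)).continuousAt.eventually_ne
      hm.fderiv_ne_zero
  have h3 : ∀ᶠ p in 𝓝 p₀, ContDiffAt ℝ 1 G p.1 :=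
    continuousAt_fst.eventually ((hm.contDiffAt_metric.of_le
      ENat.LEInfty.out : ContDiffAt ℝ 1 G p₀.1).eventually (by simp))
  filter_upwards [h1, h2, h3, hm.submersion, hm.scaling]
    with p hp hF hG hsub hsc hnull a ha ha' ξ hξ hξ'
  have hvert : fderiv ℝ (nullFun G) p (0, p.2) = 0 := by
    rw [fderiv_nullFun hm.symm (hG.differentiableAt one_ne_zero)]
    simpa [nullFun] using hnull
  set B : E × E →L[ℝ] ℝ × T := (fderiv ℝ (nullFun G) p).prod (fderiv ℝ Q p) with hB
  have hBs : LinearMap.range B.toLinearMap = ⊤ := by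
    rw [LinearMap.range_eq_top]
    rintro ⟨c, η⟩
    obtain ⟨w, hw⟩ : ∃ w, fderiv ℝ (nullFun G) p w ≠ 0 := by
      by_contra! h
      exact hF (ContinuousLinearMap.ext h)
    obtain ⟨ζ, hζ, hζ'⟩ := hsub hnull (η - (c / fderiv ℝ (nullFun G) p w) • fderiv ℝ Q p w)
    refine ⟨ζ + (c / fderiv ℝ (nullFun G) p w) • w, ?_⟩
    ext
    · simp [hB, hζ, hw]
    · simp [hB, hζ']
  have hdim := LinearMap.finrank_range_add_finrank_ker B.toLinearMap
  rw [hBs, finrank_top, Module.finrank_prod, Module.finrank_prod, Module.finrank_self] at hdim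
  have hker : Module.finrank ℝ (LinearMap.ker B.toLinearMap) = 2 := by
    have := hm.finrank_eq
    omega
  have hli : LinearIndependent ℝ ![(p.2, a), ((0 : E), p.2)] := by
    rw [LinearIndependent.pair_iff]
    intro s t hst
    have e1 : s • p.2 = 0 := by simpa using congrArg Prod.fst hst
    have hs : s = 0 := (smul_eq_zero.1 e1).resolve_right hp
    have e2 : t • p.2 = 0 := by simpa [hs] using congrArg Prod.snd hst
    exact ⟨hs, (smul_eq_zero.1 e2).resolve_right hp⟩
  have hspan : Submodule.span ℝ (Set.range ![(p.2, a), ((0 : E), p.2)]) =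
      LinearMap.ker B.toLinearMap := by
    apply Submodule.eq_of_le_of_finrank_eq
    · rw [Submodule.span_le]
      rintro _ ⟨i, rfl⟩
      fin_cases i
      · simp [hB, ha, ha']
      · simp [hB, hvert, hsc hnull]
    · rw [finrank_span_eq_card hli, hker]
      simp
  have hmem : ξ ∈ Submodule.span ℝ (Set.range ![(p.2, a), ((0 : E), p.2)]) := by
    rw [hspan]
    simp [hB, hξ, hξ']
  rw [Matrix.range_cons, Matrix.range_cons, Matrix.range_empty, Set.union_empty,
    Set.singleton_union, Submodule.mem_span_pair] at hmem
  obtain ⟨s, t, h⟩ := hmem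
  exact ⟨s, t, h.symm⟩

theorem eventually_fst_mem_span [FiniteDimensional ℝ T] (hm : IsLocalModel G Q Θ p₀) :
    ∀ᶠ p in 𝓝 p₀, nullFun G p = 0 → ∀ ξ, fderiv ℝ (nullFun G) p ξ = 0 → fderiv ℝ Q p ξ = 0 →
      ξ.1 ∈ Submodule.span ℝ {p.2} := by
  filter_upwards [hm.eventually_kernel, hm.geodesic] with p h1 h2 hp ξ hξ hξ'
  obtain ⟨a, ha, ha'⟩ := h2 hp
  obtain ⟨s, t, h⟩ := h1 hp a ha ha' ξ hξ hξ'
  rw [Submodule.mem_span_singleton]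
  exact ⟨s, by simp [h]⟩

/-- The Levi form of the contact scale is, up to a nonzero factor, the differential of the
tautological form. -/
theorem exists_dOne_eq (hm : IsLocalModel G Q Θ p₀) :
    ∃ f : ℝ, f ≠ 0 ∧ ∀ ξ ξ', fderiv ℝ (nullFun G) p₀ ξ = 0 → G p₀.1 p₀.2 ξ.1 = 0 →
      fderiv ℝ (nullFun G) p₀ ξ' = 0 → G p₀.1 p₀.2 ξ'.1 = 0 →
      dOne Θ (Q p₀) (fderiv ℝ Q p₀ ξ) (fderiv ℝ Q p₀ ξ') = f * dOne (tautForm G) p₀ ξ ξ' := by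
  obtain ⟨b, hb⟩ : ∃ b, G p₀.1 p₀.2 b ≠ 0 := by
    by_contra! h
    exact hm.metric_ne_zero (ContinuousLinearMap.ext h)
  obtain ⟨κ, hκ⟩ := hm.exists_tangent b
  have hc := hm.contact.self_of_nhds hm.null
  have hζ : Θ (Q p₀) (fderiv ℝ Q p₀ (b, κ)) ≠ 0 := fun h ↦ hb ((hc _ hκ).1 h)
  refine ⟨Θ (Q p₀) (fderiv ℝ Q p₀ (b, κ)) / G p₀.1 p₀.2 b, div_ne_zero hζ hb, ?_⟩
  intro ξ ξ' hξ hξα hξ' hξα'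
  have hQ2 : ContDiffAt ℝ 2 Q p₀ := hm.contDiffAt_quotient.of_le ENat.LEInfty.out
  have hΘd : DifferentiableAt ℝ Θ (Q p₀) := hm.contDiffAt_scale.differentiableAt (by simp)
  rw [← dOne_pullback hQ2 hΘd]
  refine dOne_eq_mul_dOne (hm.contDiffAt_nullFun.of_le ENat.LEInfty.out)
    ((contDiffAt_tautForm hm.contDiffAt_metric).of_le ENat.LEInfty.out) ?_
    hm.null ?_ hm.fderiv_ne_zero ⟨(b, κ), hκ, hb⟩ ?_ hξ hξα hξ' hξα'
  · exact (hΘd.comp p₀ (hQ2.differentiableAt (by norm_num))).clm_comp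
      ((hQ2.fderiv_right (m := 1) (by norm_num)).differentiableAt one_ne_zero)
  · filter_upwards [hm.contact] with z hz hFz ζ hζ hα
    exact (hz hFz ζ hζ).2 hα
  · intro ζ hζ'
    -- the combination of `ζ` and `(b, κ)` that is killed by the tautological form
    have h := (hc (ζ - (G p₀.1 p₀.2 ζ.1 / G p₀.1 p₀.2 b) • (b, κ))
      (by rw [map_sub, map_smul, hζ', hκ]; simp)).2 (by simp [hb])
    rw [map_sub, map_sub, map_smul, map_smul] at h
    simp only [ContinuousLinearMap.comp_apply, tautForm, ContinuousLinearMap.coe_fst']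
    simp only [smul_eq_mul] at h
    linear_combination h

/-- A tangent vector of the quotient that lies in the contact hyperplane and is orthogonal for the
Levi form to all vertical variations is itself represented by a vertical variation. -/
theorem exists_vertical_of_orthogonal (hm : IsLocalModel G Q Θ p₀) {X : T}
    (hX : Θ (Q p₀) X = 0)
    (h : ∀ κ, fderiv ℝ (nullFun G) p₀ (0, κ) = 0 → dOne Θ (Q p₀) X (fderiv ℝ Q p₀ (0, κ)) = 0) :
    ∃ κ, fderiv ℝ (nullFun G) p₀ (0, κ) = 0 ∧ fderiv ℝ Q p₀ (0, κ) = X := by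
  obtain ⟨f, hf, hd⟩ := hm.exists_dOne_eq
  obtain ⟨ξ, hξ, rfl⟩ := hm.submersion.self_of_nhds hm.null X
  have hξα := (hm.contact.self_of_nhds hm.null ξ hξ).1 hX
  refine hm.exists_vertical hξ (hm.mem_span_of_forall fun w hw ↦ ?_)
  have hw' : fderiv ℝ (nullFun G) p₀ (0, w) = 0 := by rw [hm.fderiv_vertical, hw, mul_zero]
  have := h w hw'
  rw [hd ξ (0, w) hξ hξα hw' (by simp), dOne_tautForm hm.differentiableAt_metric] at this
  simpa [hf] using this

theorem dOne_vertical (hm : IsLocalModel G Q Θ p₀) {κ κ' : E}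
    (hκ : fderiv ℝ (nullFun G) p₀ (0, κ) = 0) (hκ' : fderiv ℝ (nullFun G) p₀ (0, κ') = 0) :
    dOne Θ (Q p₀) (fderiv ℝ Q p₀ (0, κ)) (fderiv ℝ Q p₀ (0, κ')) = 0 := by
  obtain ⟨f, hf, hd⟩ := hm.exists_dOne_eq
  rw [hd _ _ hκ (by simp) hκ' (by simp), dOne_tautForm hm.differentiableAt_metric]
  simp

/-- The Levi form pairs a vertical variation with an abreast one by the metric, up to a factor. -/
theorem metric_eq_zero_of_dOne_eq_zero (hm : IsLocalModel G Q Θ p₀) {κ : E} {ξ : E × E}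
    (hκ : fderiv ℝ (nullFun G) p₀ (0, κ) = 0) (hξ : fderiv ℝ (nullFun G) p₀ ξ = 0)
    (hξα : G p₀.1 p₀.2 ξ.1 = 0)
    (h : dOne Θ (Q p₀) (fderiv ℝ Q p₀ (0, κ)) (fderiv ℝ Q p₀ ξ) = 0) : G p₀.1 κ ξ.1 = 0 := by
  obtain ⟨f, hf, hd⟩ := hm.exists_dOne_eq
  rw [hd _ _ hκ (by simp) hξ hξα, dOne_tautForm hm.differentiableAt_metric] at h
  simpa [hf] using h

/-- The Levi form is nondegenerate on the contact hyperplane. -/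
theorem eq_zero_of_dOne (hm : IsLocalModel G Q Θ p₀) {X : T} (hX : Θ (Q p₀) X = 0)
    (h : ∀ Y, Θ (Q p₀) Y = 0 → dOne Θ (Q p₀) X Y = 0) : X = 0 := by
  have hc := hm.contact.self_of_nhds hm.null
  obtain ⟨κ, hκ, rfl⟩ := hm.exists_vertical_of_orthogonal hX fun κ hκ ↦
    h _ ((hc _ hκ).2 (by simp))
  refine hm.fderiv_quotient_vertical_eq_zero (hm.mem_span_of_forall fun w hw ↦ ?_)
  obtain ⟨a, ha⟩ := hm.exists_tangent w
  rw [hm.symm]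
  exact hm.metric_eq_zero_of_dOne_eq_zero hκ ha hw (h _ ((hc _ ha).2 hw))

end IsLocalModel

end LocalModel

/-! ### Smooth lifts and isolated degeneracies in the coordinate model -/

section LocalModelFrames

variable {E T : Type*} [NormedAddCommGroup E] [NormedSpace ℝ E]
  [NormedAddCommGroup T] [NormedSpace ℝ T]

/-- If a differentiable curve of linear maps has a kernel on `Λ` at parameters accumulating at `u₀`,
then the derivative maps some nonzero vector of the kernel at `u₀` into the image of `Λ`: a limit of
unit vectors in the kernels, since the difference quotients take these vectors into that image. -/
theorem exists_kernel_derivative_mem_map [FiniteDimensional ℝ T] {S : ℝ → T →L[ℝ] E}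
    {S' : T →L[ℝ] E} {u₀ : ℝ} (hS : HasDerivAt S S' u₀) (Λ : Submodule ℝ T)
    (h : ∃ᶠ u in 𝓝[≠] u₀, ∃ X ∈ Λ, X ≠ 0 ∧ S u X = 0) :
    ∃ X ∈ Λ, X ≠ 0 ∧ S u₀ X = 0 ∧ S' X ∈ Λ.map (S u₀).toLinearMap := by
  obtain ⟨u, hu, hX⟩ := exists_seq_forall_of_frequently h
  have hX' : ∀ m, ∃ X ∈ Λ, ‖X‖ = 1 ∧ S (u m) X = 0 := by
    intro m
    obtain ⟨X, hΛ, h0, hSX⟩ := hX m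
    refine ⟨‖X‖⁻¹ • X, Λ.smul_mem _ hΛ, ?_, by simp [hSX]⟩
    rw [norm_smul, norm_inv, norm_norm, inv_mul_cancel₀ (norm_ne_zero_iff.2 h0)]
  choose X hXΛ hX1 hSX using hX'
  have : ProperSpace T := FiniteDimensional.proper ℝ T
  obtain ⟨X₀, hX₀, φ, hφ, hlim⟩ := (isCompact_sphere (0 : T) 1).tendsto_subseq
    (x := X) (fun m ↦ by simp [hX1])
  have hu0 : Tendsto (u ∘ φ) atTop (𝓝[≠] u₀) := hu.comp hφ.tendsto_atTop
  have hu0' : Tendsto (u ∘ φ) atTop (𝓝 u₀) := hu0.mono_right nhdsWithin_le_nhds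
  have hclosed : IsClosed (Λ : Set T) := Λ.closed_of_finiteDimensional
  have hX₀Λ : X₀ ∈ Λ := hclosed.mem_of_tendsto hlim (Eventually.of_forall fun m ↦ hXΛ _)
  have happly : ∀ {A : ℕ → T →L[ℝ] E} {A₀ : T →L[ℝ] E}, Tendsto A atTop (𝓝 A₀) →
      Tendsto (fun m ↦ A m (X (φ m))) atTop (𝓝 (A₀ X₀)) := fun {A A₀} hA ↦
    (isBoundedBilinearMap_apply (𝕜 := ℝ) (E := T) (F := E)).continuous.tendsto (A₀, X₀) |>.comp
      (hA.prodMk_nhds hlim)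
  have hker : S u₀ X₀ = 0 := by
    have h1 : Tendsto (fun m ↦ S (u (φ m)) (X (φ m))) atTop (𝓝 (S u₀ X₀)) :=
      happly (hS.continuousAt.tendsto.comp hu0')
    simp only [hSX] at h1
    exact tendsto_nhds_unique h1 tendsto_const_nhds |>.symm ▸ rfl
  refine ⟨X₀, hX₀Λ, ?_, hker, ?_⟩
  · rintro rfl
    simp at hX₀
  · have h1 : Tendsto (fun m ↦ slope S u₀ (u (φ m)) (X (φ m))) atTop (𝓝 (S' X₀)) :=
      happly ((hasDerivAt_iff_tendsto_slope.1 hS).comp hu0)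
    have hcl : IsClosed ((Λ.map (S u₀).toLinearMap : Submodule ℝ E) : Set E) :=
      Submodule.closed_of_finiteDimensional _
    refine hcl.mem_of_tendsto h1 (Eventually.of_forall fun m ↦ ?_)
    refine ⟨-(u (φ m) - u₀)⁻¹ • X (φ m), Λ.smul_mem _ (hXΛ _), ?_⟩
    simp [slope_def_module, hSX]

namespace IsLocalModel

variable {G : E → E →L[ℝ] E →L[ℝ] ℝ} {Q : E × E → T} {Θ : T → T →L[ℝ] ℝ} {p₀ : E × E}

/-- The equation of the null cone, the quotient map and a functional normalizing the displacement
have surjective joint differential. -/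
theorem surjective_normalized (hm : IsLocalModel G Q Θ p₀) {ℓ : E →L[ℝ] ℝ} (hℓ : ℓ p₀.2 ≠ 0) :
    Function.Surjective ((fderiv ℝ Q p₀).prod ((fderiv ℝ (nullFun G) p₀).prod
      (ℓ.comp (ContinuousLinearMap.fst ℝ E E)))) := by
  rintro ⟨η, c, d⟩
  obtain ⟨w, hw⟩ : ∃ w, fderiv ℝ (nullFun G) p₀ w ≠ 0 := by
    by_contra! h
    exact hm.fderiv_ne_zero (ContinuousLinearMap.ext h)
  obtain ⟨a, ha, ha'⟩ := hm.geodesic.self_of_nhds hm.null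
  set r := c / fderiv ℝ (nullFun G) p₀ w with hr
  obtain ⟨ζ, hζ, hζ'⟩ := hm.submersion.self_of_nhds hm.null (η - r • fderiv ℝ Q p₀ w)
  refine ⟨(ζ + r • w) + ((d - ℓ (ζ + r • w).1) / ℓ p₀.2) • (p₀.2, a), ?_⟩
  simp only [ContinuousLinearMap.prod_apply, map_add, map_smul, ha, ha', hζ, hζ']
  refine Prod.ext (by simp) (Prod.ext ?_ ?_)
  · simp [hr, hw]
  · simp [hℓ]

/-- Differentiating `A_p(r(p)) = c` for the differential `A = dΦ` of a function. -/
theorem fderiv_fderiv_field {V : Type*} [NormedAddCommGroup V] [NormedSpace ℝ V] {Φ : E × E → V}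
    (hΦ : ContDiffAt ℝ 2 Φ p₀) {r : E × E → E × E} (hr : DifferentiableAt ℝ r p₀) {c : V}
    (hc : ∀ᶠ p in 𝓝 p₀, fderiv ℝ Φ p (r p) = c) (ζ : E × E) :
    fderiv ℝ (fderiv ℝ Φ) p₀ ζ (r p₀) + fderiv ℝ Φ p₀ (fderiv ℝ r p₀ ζ) = 0 := by
  rw [← fderiv_clm_apply_field ((hΦ.fderiv_right (m := 1) (by norm_num)).differentiableAt
    one_ne_zero) hr]
  have : (fun p ↦ fderiv ℝ Φ p (r p)) =ᶠ[𝓝 p₀] fun _ ↦ c := hc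
  rw [this.fderiv_eq]
  simp

variable [FiniteDimensional ℝ E] [FiniteDimensional ℝ T]

/-- Near `p₀` the tangent vectors of the quotient lift to variations tangent to the null cone,
smoothly in the point and normalized by `ℓ`. Along the geodesic direction `(k₀, a)` the derivative
of the displacement of the lift is, modulo `k₀`, its velocity component. This replaces the Jacobi
equation: it follows from the symmetry of the second derivatives and from the fact that the
displacement of a field spanning the geodesic direction is proportional to `k` at every null
vector. -/
theorem exists_frame (hm : IsLocalModel G Q Θ p₀) {ℓ : E →L[ℝ] ℝ} (hℓ : ℓ p₀.2 ≠ 0) :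
    ∃ X : E × E → T →L[ℝ] E × E, ContDiffAt ℝ ∞ X p₀ ∧
      (∀ᶠ p in 𝓝 p₀, ∀ η, fderiv ℝ (nullFun G) p (X p η) = 0 ∧ fderiv ℝ Q p (X p η) = η ∧
        ℓ (X p η).1 = 0) ∧
      (∀ᶠ p in 𝓝 p₀, ContDiffAt ℝ ∞ G p.1 → ContDiffAt ℝ ∞ Q p → ContDiffAt ℝ ∞ X p) ∧
      ∀ a, fderiv ℝ (nullFun G) p₀ (p₀.2, a) = 0 → fderiv ℝ Q p₀ (p₀.2, a) = 0 → ∀ η,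
        ∃ c : ℝ, (fderiv ℝ X p₀ (p₀.2, a) η).1 = (X p₀ η).2 + c • p₀.2 := by
  set B : E × E → E × E →L[ℝ] T × ℝ × ℝ := fun p ↦ (fderiv ℝ Q p).prod
    ((fderiv ℝ (nullFun G) p).prod (ℓ.comp (ContinuousLinearMap.fst ℝ E E))) with hBdef
  have hB' : ∀ p : E × E, ContDiffAt ℝ ∞ G p.1 → ContDiffAt ℝ ∞ Q p → ContDiffAt ℝ ∞ B p :=
    fun p hG hQ ↦ contDiffAt_clm_prod (hQ.fderiv_right (by simp)) (contDiffAt_clm_prod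
      ((PenroseLimit.contDiffAt_nullFun hG).fderiv_right (by simp)) contDiffAt_const)
  have hB : ContDiffAt ℝ ∞ B p₀ := hB' p₀ hm.contDiffAt_metric hm.contDiffAt_quotient
  have hBs : Function.Surjective (B p₀) := hm.surjective_normalized hℓ
  obtain ⟨R, hR, hBR⟩ := exists_contDiffAt_rightInverse hB hBs
  have hX : ContDiffAt ℝ ∞ (fun p ↦ (R p).comp (ContinuousLinearMap.inl ℝ T (ℝ × ℝ))) p₀ :=
    hR.clm_comp contDiffAt_const
  set X : E × E → T →L[ℝ] E × E := fun p ↦ (R p).comp (ContinuousLinearMap.inl ℝ T (ℝ × ℝ))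
    with hXdef
  have hXev : ∀ᶠ p in 𝓝 p₀, ∀ η, fderiv ℝ (nullFun G) p (X p η) = 0 ∧
      fderiv ℝ Q p (X p η) = η ∧ ℓ (X p η).1 = 0 := by
    filter_upwards [hBR] with p hp η
    have h := hp.2 (η, 0)
    exact ⟨congrArg (fun v ↦ v.2.1) h, congrArg Prod.fst h, congrArg (fun v ↦ v.2.2) h⟩
  refine ⟨X, hX, hXev, ?_, fun a ha ha' η ↦ ?_⟩
  · filter_upwards [hBR] with p hp hG hQ
    exact (hp.1 (hB' p hG hQ)).clm_comp contDiffAt_const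
  have hXd : DifferentiableAt ℝ X p₀ := hX.differentiableAt (by simp)
  have hXη : ∀ ζ, fderiv ℝ (fun p ↦ X p η) p₀ ζ = fderiv ℝ X p₀ ζ η := fun ζ ↦ by
    rw [fderiv_clm_apply_field hXd (differentiableAt_const η)]
    simp
  -- a field `Z` in the common kernel, normalized by `ℓ`, equal to `(k₀, a)` at `p₀`
  obtain ⟨Z, hZ, hZp, hBZ⟩ := exists_contDiffAt_solution hB hBs (ξ := (p₀.2, a))
    (c := (0, 0, ℓ p₀.2)) (by simp [hBdef, ha, ha'])
  have hZd : DifferentiableAt ℝ Z p₀ := hZ.differentiableAt (by simp)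
  have hQ2 : ContDiffAt ℝ 2 Q p₀ := hm.contDiffAt_quotient.of_le ENat.LEInfty.out
  have hF2 : ContDiffAt ℝ 2 (nullFun G) p₀ := hm.contDiffAt_nullFun.of_le ENat.LEInfty.out
  obtain ⟨hξ, -, -⟩ := hXev.self_of_nhds η
  have hXηd : DifferentiableAt ℝ (fun p ↦ X p η) p₀ := hXd.clm_apply (differentiableAt_const η)
  have q1 := fderiv_fderiv_field hQ2 hXηd (hXev.mono fun p h ↦ (h η).2.1) (p₀.2, a)
  have q2 := fderiv_fderiv_field hQ2 hZd (hBZ.mono fun p h ↦ congrArg Prod.fst h) (X p₀ η)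
  have f1 := fderiv_fderiv_field hF2 hXηd (hXev.mono fun p h ↦ (h η).1) (p₀.2, a)
  have f2 := fderiv_fderiv_field hF2 hZd (hBZ.mono fun p h ↦ congrArg (fun v ↦ v.2.1) h) (X p₀ η)
  rw [hZp] at q2 f2
  have hQs : fderiv ℝ (fderiv ℝ Q) p₀ (X p₀ η) (p₀.2, a) =
    fderiv ℝ (fderiv ℝ Q) p₀ (p₀.2, a) (X p₀ η) := hQ2.isSymmSndFDerivAt (by simp) _ _
  have hFs : fderiv ℝ (fderiv ℝ (nullFun G)) p₀ (X p₀ η) (p₀.2, a) =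
    fderiv ℝ (fderiv ℝ (nullFun G)) p₀ (p₀.2, a) (X p₀ η) := hF2.isSymmSndFDerivAt (by simp) _ _
  have hmem := hm.eventually_fst_mem_span.self_of_nhds hm.null
    (fderiv ℝ (fun p ↦ X p η) p₀ (p₀.2, a) - fderiv ℝ Z p₀ (X p₀ η))
    (by rw [map_sub, eq_neg_of_add_eq_zero_right f1, eq_neg_of_add_eq_zero_right f2, hFs, sub_self])
    (by rw [map_sub, eq_neg_of_add_eq_zero_right q1, eq_neg_of_add_eq_zero_right q2, hQs, sub_self])
  obtain ⟨s, hs⟩ := Submodule.mem_span_singleton.1 hmem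
  -- at the null vectors the displacement of `Z` is proportional to `k`
  have hvan : ∀ᶠ p in 𝓝 p₀, nullFun G p = 0 → ℓ p.2 • (Z p).1 - ℓ p₀.2 • p.2 = 0 := by
    filter_upwards [hBZ, hm.eventually_fst_mem_span] with p hp hspan hnull
    obtain ⟨t, ht⟩ := Submodule.mem_span_singleton.1
      (hspan hnull (Z p) (congrArg (fun v ↦ v.2.1) hp) (congrArg Prod.fst hp))
    have hl : ℓ (Z p).1 = ℓ p₀.2 := congrArg (fun v ↦ v.2.2) hp
    rw [← hl, ← ht]
    simp [smul_smul, mul_comm]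
  have hd : HasFDerivAt (fun p : E × E ↦ ℓ p.2 • (Z p).1 - ℓ p₀.2 • p.2)
      ((ℓ p₀.2 • (ContinuousLinearMap.fst ℝ E E).comp (fderiv ℝ Z p₀) +
        (ℓ.comp (ContinuousLinearMap.snd ℝ E E)).smulRight (Z p₀).1) -
        ℓ p₀.2 • ContinuousLinearMap.snd ℝ E E) p₀ := by
    refine HasFDerivAt.sub (HasFDerivAt.smul (c := fun p : E × E ↦ ℓ p.2)
      (ℓ.comp (ContinuousLinearMap.snd ℝ E E)).hasFDerivAt hZd.hasFDerivAt.fst) ?_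
    exact (ℓ p₀.2 • ContinuousLinearMap.snd ℝ E E).hasFDerivAt
  have h0 := fderiv_apply_eq_zero_of_vanishing_on_zeroLocus (hF2.of_le (by norm_num)) hm.null
    hm.fderiv_ne_zero hd.differentiableAt hvan hξ
  rw [hd.fderiv, hZp] at h0
  have h1 : (fderiv ℝ Z p₀ (X p₀ η)).1 = (X p₀ η).2 - (ℓ (X p₀ η).2 / ℓ p₀.2) • p₀.2 := by
    have h2 : ℓ p₀.2 • (fderiv ℝ Z p₀ (X p₀ η)).1 + ℓ (X p₀ η).2 • p₀.2
      - ℓ p₀.2 • (X p₀ η).2 = 0 := by simpa using h0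
    have h3 : (fderiv ℝ Z p₀ (X p₀ η)).1 = (ℓ p₀.2)⁻¹ • (ℓ p₀.2 • (fderiv ℝ Z p₀ (X p₀ η)).1) := by
      rw [smul_smul, inv_mul_cancel₀ hℓ, one_smul]
    rw [h3, show ℓ p₀.2 • (fderiv ℝ Z p₀ (X p₀ η)).1 =
      ℓ p₀.2 • (X p₀ η).2 - ℓ (X p₀ η).2 • p₀.2 by rw [← sub_eq_zero, ← h2]; abel, smul_sub,
      smul_smul, smul_smul, inv_mul_cancel₀ hℓ, one_smul, div_eq_inv_mul]
  refine ⟨s - ℓ (X p₀ η).2 / ℓ p₀.2, ?_⟩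
  rw [hXη, Prod.fst_sub, h1] at hs
  rw [sub_smul, hs]
  abel

/-- An isotropic subspace of the contact hyperplane contains no nonzero vertical variation at the
nearby points of a null geodesic. If it did at parameters accumulating at `u₀`, a limit would be a
nonzero vector of the subspace represented by a vertical variation `(0, κ)` with `κ` orthogonal to
itself, which is impossible because the metric is positive definite on the screen. -/
theorem eventually_eq_zero_of_vertical (hm : IsLocalModel G Q Θ p₀) {p : ℝ → E × E} {u₀ : ℝ}
    {p' : E × E} (hp : HasDerivAt p p' u₀) (hpu : p u₀ = p₀) (hp' : p'.1 = p₀.2)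
    (hnull : ∀ᶠ u in 𝓝 u₀, nullFun G (p u) = 0) (hQ : ∀ᶠ u in 𝓝 u₀, Q (p u) = Q p₀)
    {Λ : Submodule ℝ T} (hΛ : ∀ X ∈ Λ, Θ (Q p₀) X = 0)
    (hiso : ∀ X ∈ Λ, ∀ Y ∈ Λ, dOne Θ (Q p₀) X Y = 0) :
    ∀ᶠ u in 𝓝[≠] u₀, ∀ X ∈ Λ, ∀ κ, fderiv ℝ (nullFun G) (p u) (0, κ) = 0 →
      fderiv ℝ Q (p u) (0, κ) = X → X = 0 := by
  subst hpu
  obtain ⟨ℓ, -, hℓ⟩ := exists_dual_vector ℝ (p u₀).2 (norm_ne_zero_iff.2 hm.ne_zero)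
  have hℓ' : ℓ (p u₀).2 ≠ 0 := by
    rw [hℓ]; simpa using hm.ne_zero
  obtain ⟨X, hX, hXev, -, hXd⟩ := hm.exists_frame hℓ'
  have hpc : Tendsto p (𝓝 u₀) (𝓝 (p u₀)) := hp.continuousAt.tendsto
  have hkF : fderiv ℝ (nullFun G) (p u₀) p' = 0 := by
    have h1 := (hm.contDiffAt_nullFun.differentiableAt (by simp)).hasFDerivAt.comp_hasDerivAt u₀ hp
    have h2 : (nullFun G ∘ p) =ᶠ[𝓝 u₀] fun _ ↦ 0 := hnull
    exact h1.unique ((hasDerivAt_const u₀ (0 : ℝ)).congr_of_eventuallyEq h2)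
  have hkQ : fderiv ℝ Q (p u₀) p' = 0 := by
    have h1 := (hm.contDiffAt_quotient.differentiableAt (by simp)).hasFDerivAt.comp_hasDerivAt u₀ hp
    have h2 : (Q ∘ p) =ᶠ[𝓝 u₀] fun _ ↦ Q (p u₀) := hQ
    exact h1.unique ((hasDerivAt_const u₀ (Q (p u₀))).congr_of_eventuallyEq h2)
  have hpe : p' = ((p u₀).2, p'.2) := Prod.ext hp' rfl
  rw [hpe] at hkF hkQ
  set S : ℝ → T →L[ℝ] E := fun u ↦ (ContinuousLinearMap.fst ℝ E E).comp (X (p u)) with hSdef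
  have hS : HasDerivAt S ((ContinuousLinearMap.fst ℝ E E).comp (fderiv ℝ X (p u₀) p')) u₀ := by
    have h1 : HasDerivAt (fun u ↦ X (p u)) (fderiv ℝ X (p u₀) p') u₀ :=
      (hX.differentiableAt (by simp)).hasFDerivAt.comp_hasDerivAt u₀ hp
    have h2 := (hasDerivAt_const u₀ (ContinuousLinearMap.fst ℝ E E)).clm_comp h1
    simpa using h2
  by_contra hcon
  have hfreq : ∃ᶠ u in 𝓝[≠] u₀, ∃ Y ∈ Λ, Y ≠ 0 ∧ S u Y = 0 := by
    have hev : ∀ᶠ u in 𝓝[≠] u₀, ∀ Y κ, fderiv ℝ (nullFun G) (p u) (0, κ) = 0 →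
        fderiv ℝ Q (p u) (0, κ) = Y → S u Y = 0 := by
      apply Filter.Eventually.filter_mono nhdsWithin_le_nhds
      have hℓ2 : ∀ᶠ u in 𝓝 u₀, ℓ (p u).2 ≠ 0 :=
        (ℓ.continuous.comp continuous_snd).continuousAt.comp hp.continuousAt |>.eventually_ne hℓ'
      filter_upwards [hnull, hpc.eventually hXev, hpc.eventually hm.eventually_fst_mem_span, hℓ2]
        with u h1 h2 h3 h4 Y κ hκ hκ'
      obtain ⟨a1, a2, a3⟩ := h2 Y
      -- two lifts of `Y` differ by a multiple of `k` in the displacement, which `ℓ` excludes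
      obtain ⟨t, ht⟩ := Submodule.mem_span_singleton.1 (h3 h1 (X (p u) Y - (0, κ))
        (by rw [map_sub, a1, hκ, sub_zero]) (by rw [map_sub, a2, hκ', sub_self]))
      rw [Prod.fst_sub, sub_zero] at ht
      have : t = 0 := by
        rw [← ht, map_smul] at a3
        exact (smul_eq_zero.1 a3).resolve_right h4
      change (X (p u) Y).1 = 0
      rw [← ht, this, zero_smul]
    refine (Filter.not_eventually.1 hcon).mp (hev.mono fun u hu hn ↦ ?_)
    push Not at hn
    obtain ⟨Y, hY, κ, h1, h2, h3⟩ := hn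
    exact ⟨Y, hY, h3, hu Y κ h1 h2⟩
  obtain ⟨Y, hYΛ, hY0, hSY, Y', hY'Λ, hY'⟩ := exists_kernel_derivative_mem_map hS Λ hfreq
  apply hY0
  have hXev0 := hXev.self_of_nhds
  obtain ⟨c, hc⟩ := hXd p'.2 hkF hkQ Y
  set κ := (X (p u₀) Y).2 with hκdef
  have hXY : X (p u₀) Y = (0, κ) := Prod.ext hSY rfl
  obtain ⟨b1, b2, -⟩ := hXev0 Y
  obtain ⟨b1', b2', -⟩ := hXev0 Y'
  rw [hXY] at b1 b2
  have hcon := hm.contact.self_of_nhds hm.null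
  have hperp : G (p u₀).1 (p u₀).2 κ = 0 := by
    have := hm.fderiv_vertical κ
    rw [b1] at this
    linarith
  have hY'eq : (X (p u₀) Y').1 = κ + c • (p u₀).2 := by
    rw [← hc, ← hpe]
    exact hY'
  have h0 := hm.metric_eq_zero_of_dOne_eq_zero b1 b1'
    ((hcon _ b1').1 (by rw [b2']; exact hΛ _ hY'Λ))
    (by rw [b2, b2']; exact hiso _ hYΛ _ hY'Λ)
  rw [hY'eq, map_add, map_smul, hm.symm _ κ (p u₀).2, hperp, smul_zero, add_zero] at h0
  rw [← b2]
  exact hm.fderiv_quotient_vertical_eq_zero (hm.mem_span κ hperp h0)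

end IsLocalModel

end LocalModelFrames

/-! ### Charts of a manifold and of its tangent bundle -/

section Charts

variable {E : Type*} [NormedAddCommGroup E] [NormedSpace ℝ E]
  {H : Type*} [TopologicalSpace H] {I : ModelWithCorners ℝ E H} [I.Boundaryless]
  {X : Type*} [TopologicalSpace X] [ChartedSpace H X] 

theorem eventually_fst_mem_extChartAt_target {x : X} {p : E × E}
    (hp : p.1 ∈ (extChartAt I x).target) :
    ∀ᶠ p' in 𝓝 p, p'.1 ∈ (extChartAt I x).target :=
  continuousAt_fst.eventually ((isOpen_extChartAt_target x).mem_nhds hp)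

section
variable [IsManifold I 1 X]

theorem mdifferentiableAt_extChartAt_symm {x : X} {z : E} (hz : z ∈ (extChartAt I x).target) :
    MDifferentiableAt 𝓘(ℝ, E) I (extChartAt I x).symm z := by
  have := mdifferentiableWithinAt_extChartAt_symm hz
  rwa [I.range_eq_univ, mdifferentiableWithinAt_univ] at this

theorem isInvertible_mfderiv_extChartAt_symm {x : X} {z : E} (hz : z ∈ (extChartAt I x).target) :
    (mfderiv 𝓘(ℝ, E) I (extChartAt I x).symm z).IsInvertible := by
  have := isInvertible_mfderivWithin_extChartAt_symm hz
  rwa [I.range_eq_univ, mfderivWithin_univ] at this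

theorem bijective_mfderiv_extChartAt_symm {x : X} {z : E} (hz : z ∈ (extChartAt I x).target) :
    Function.Bijective (mfderiv 𝓘(ℝ, E) I (extChartAt I x).symm z) := by
  obtain ⟨e, he⟩ := isInvertible_mfderiv_extChartAt_symm hz
  rw [← he]
  exact e.bijective

theorem mfderiv_extChartAt_symm_self (x : X) :
    mfderiv 𝓘(ℝ, E) I (extChartAt I x).symm (extChartAt I x x) = ContinuousLinearMap.id ℝ E := by
  have := mfderivWithin_range_extChartAt_symm (I := I) (x := x)
  rwa [I.range_eq_univ, mfderivWithin_univ] at this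

theorem mfderiv_extChartAt_symm_comp {x : X} {z : E} (hz : z ∈ (extChartAt I x).target)
    (w : TangentSpace I ((extChartAt I x).symm z)) :
    mfderiv 𝓘(ℝ, E) I (extChartAt I x).symm z
      (mfderiv I 𝓘(ℝ, E) (extChartAt I x) ((extChartAt I x).symm z) w) = w := by
  have := mfderivWithin_extChartAt_symm_comp_mfderiv_extChartAt hz
  rw [I.range_eq_univ, mfderivWithin_univ] at this
  exact congrArg (fun f ↦ f w) this

end

end Charts

section TangentCharts

variable {E : Type*} [NormedAddCommGroup E] [NormedSpace ℝ E]
  {X : Type*} [TopologicalSpace X] [ChartedSpace E X] [IsManifold 𝓘(ℝ, E) ∞ X]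

theorem tangent_extChartAt_target (v : TangentBundle 𝓘(ℝ, E) X) :
    (extChartAt 𝓘(ℝ, E).tangent v).target = (extChartAt 𝓘(ℝ, E) v.proj).target ×ˢ univ := by
  ext p
  have h1 : p ∈ (extChartAt 𝓘(ℝ, E).tangent v).target ↔ p ∈ (chartAt (ModelProd E E) v).target := by
    rw [extChartAt_target]
    exact ⟨fun h ↦ h.1, fun h ↦ ⟨h, by rw [ModelWithCorners.range_eq_univ]; trivial⟩⟩
  rw [h1, TangentBundle.mem_chart_target_iff]
  simp

/-- The inverse chart of the tangent bundle is the tangent map of the inverse chart. -/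
theorem tangent_extChartAt_symm (v : TangentBundle 𝓘(ℝ, E) X) {z : E}
    (hz : z ∈ (extChartAt 𝓘(ℝ, E) v.proj).target) (w : E) :
    (extChartAt 𝓘(ℝ, E).tangent v).symm (z, w) =
      ⟨(extChartAt 𝓘(ℝ, E) v.proj).symm z,
        mfderiv 𝓘(ℝ, E) 𝓘(ℝ, E) (extChartAt 𝓘(ℝ, E) v.proj).symm z w⟩ := by
  have h := tangentMap_chart_symm (I := 𝓘(ℝ, E)) (p := v) (q := ⟨z, w⟩) (by simpa using hz)
  have h1 : (extChartAt 𝓘(ℝ, E).tangent v).symm (z, w) =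
    (chartAt (ModelProd E E) v).symm (z, w) := rfl
  rw [h1]
  refine h.symm.trans ?_
  rfl

theorem tangent_extChartAt_source (v : TangentBundle 𝓘(ℝ, E) X) :
    (extChartAt 𝓘(ℝ, E).tangent v).source =
      Bundle.TotalSpace.proj ⁻¹' (extChartAt 𝓘(ℝ, E) v.proj).source := by
  ext p
  rw [extChartAt_source, mem_preimage, extChartAt_source, TangentBundle.mem_chart_source_iff]

/-- The chart of the tangent bundle is the tangent map of the chart. -/
theorem tangent_extChartAt_apply (v w : TangentBundle 𝓘(ℝ, E) X)
    (hw : w.proj ∈ (extChartAt 𝓘(ℝ, E) v.proj).source) :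
    extChartAt 𝓘(ℝ, E).tangent v w = (extChartAt 𝓘(ℝ, E) v.proj w.proj,
      mfderiv 𝓘(ℝ, E) 𝓘(ℝ, E) (extChartAt 𝓘(ℝ, E) v.proj) w.proj w.snd) := by
  have h := tangentMap_chart (I := 𝓘(ℝ, E)) (p := v) (q := w) (by simpa using hw)
  have h2 := congrArg (Bundle.TotalSpace.toProd E E) h
  exact h2.symm

theorem tangent_extChartAt_self (v : TangentBundle 𝓘(ℝ, E) X) :
    extChartAt 𝓘(ℝ, E).tangent v v = (extChartAt 𝓘(ℝ, E) v.proj v.proj, v.snd) := by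
  rw [tangent_extChartAt_apply v v (mem_extChartAt_source _), mfderiv_extChartAt_self]
  rfl

/-- The velocity of a curve in the tangent chart is given by the curve in the chart and its
derivative. -/
theorem tangent_extChartAt_mfderiv (v : TangentBundle 𝓘(ℝ, E) X) {σ : ℝ → X} {t : ℝ}
    (hσ : MDifferentiableAt 𝓘(ℝ, ℝ) 𝓘(ℝ, E) σ t)
    (ht : σ t ∈ (extChartAt 𝓘(ℝ, E) v.proj).source) :
    extChartAt 𝓘(ℝ, E).tangent v ⟨σ t, mfderiv 𝓘(ℝ, ℝ) 𝓘(ℝ, E) σ t (1 : ℝ)⟩ =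
      (extChartAt 𝓘(ℝ, E) v.proj (σ t), deriv (fun s ↦ extChartAt 𝓘(ℝ, E) v.proj (σ s)) t) := by
  rw [tangent_extChartAt_apply v _ ht]
  refine Prod.ext rfl ?_
  have h := mfderiv_comp t (mdifferentiableAt_extChartAt (I := 𝓘(ℝ, E))
    (by rwa [extChartAt_source] at ht)) hσ
  have h2 : deriv (fun s ↦ extChartAt 𝓘(ℝ, E) v.proj (σ s)) t =
      mfderiv 𝓘(ℝ, ℝ) 𝓘(ℝ, E) (extChartAt 𝓘(ℝ, E) v.proj ∘ σ) t (1 : ℝ) := by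
    rw [mfderiv_eq_fderiv]
    exact fderiv_apply_one_eq_deriv.symm
  rw [h2, h]
  rfl

/-- The coordinate vector fields are smooth. -/
theorem contMDiffOn_mfderiv_extChartAt_symm (x : X) (a : E) :
    ContMDiffOn 𝓘(ℝ, E) 𝓘(ℝ, E).tangent ∞
      (fun z ↦ (⟨(extChartAt 𝓘(ℝ, E) x).symm z,
        mfderiv 𝓘(ℝ, E) 𝓘(ℝ, E) (extChartAt 𝓘(ℝ, E) x).symm z a⟩ : TangentBundle 𝓘(ℝ, E) X))
      (extChartAt 𝓘(ℝ, E) x).target := by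
  let v : TangentBundle 𝓘(ℝ, E) X := ⟨x, 0⟩
  have h1 : ContMDiffOn 𝓘(ℝ, E) 𝓘(ℝ, E × E) ∞ (fun z ↦ (z, a)) (extChartAt 𝓘(ℝ, E) x).target :=
    (contDiff_prodMk_left a).contMDiff.contMDiffOn
  have h0 : ContMDiffOn 𝓘(ℝ, E × E) 𝓘(ℝ, E).tangent ∞ (extChartAt 𝓘(ℝ, E).tangent v).symm
    (extChartAt 𝓘(ℝ, E).tangent v).target := contMDiffOn_extChartAt_symm v
  have h2 := h0.comp h1
    (fun z hz ↦ by rw [mem_preimage, tangent_extChartAt_target]; exact ⟨hz, trivial⟩)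
  exact h2.congr fun z hz ↦ (tangent_extChartAt_symm v hz a).symm

theorem mfderiv_proj_tangent_extChartAt_symm (v : TangentBundle 𝓘(ℝ, E) X) {p : E × E}
    (hp : p.1 ∈ (extChartAt 𝓘(ℝ, E) v.proj).target) (ξ : E × E) :
    mfderiv 𝓘(ℝ, E).tangent 𝓘(ℝ, E)
      (fun w : TangentBundle 𝓘(ℝ, E) X ↦ w.proj) ((extChartAt 𝓘(ℝ, E).tangent v).symm p)
      (mfderiv 𝓘(ℝ, E × E) 𝓘(ℝ, E).tangent (extChartAt 𝓘(ℝ, E).tangent v).symm p ξ) =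
    mfderiv 𝓘(ℝ, E) 𝓘(ℝ, E) (extChartAt 𝓘(ℝ, E) v.proj).symm p.1 ξ.1 := by
  have hp' : p ∈ (extChartAt 𝓘(ℝ, E).tangent v).target := by
    rw [tangent_extChartAt_target]; exact ⟨hp, trivial⟩
  have hd : MDifferentiableAt 𝓘(ℝ, E).tangent 𝓘(ℝ, E)
      (fun w : TangentBundle 𝓘(ℝ, E) X ↦ w.proj) ((extChartAt 𝓘(ℝ, E).tangent v).symm p) :=
    (Bundle.contMDiff_proj (n := 1) (TangentSpace 𝓘(ℝ, E) : X → Type _)).mdifferentiableAt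
      one_ne_zero
  have h1 := mfderiv_comp p hd (mdifferentiableAt_extChartAt_symm hp')
  have h2 := mfderiv_comp (f := ⇑(ContinuousLinearMap.fst ℝ E E)) p
    (mdifferentiableAt_extChartAt_symm hp) (ContinuousLinearMap.fst ℝ E E).mdifferentiableAt
  rw [ContinuousLinearMap.mfderiv_eq] at h2
  exact congrArg (fun f ↦ f ξ) (h1.symm.trans h2)

end TangentCharts

/-! ### The metric and the quotient map in charts -/

section LorentzCharts

variable {n : ℕ} {M : Type*} [TopologicalSpace M]
  [ChartedSpace (EuclideanSpace ℝ (Fin (n + 2))) M]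
  [IsManifold (𝓡 (n + 2)) ∞ M]

theorem contMDiffOn_tangent_extChartAt_symm (v : TangentBundle (𝓡 (n + 2)) M) :
    ContMDiffOn 𝓘(ℝ, EuclideanSpace ℝ (Fin (n + 2)) × EuclideanSpace ℝ (Fin (n + 2)))
      (𝓡 (n + 2)).tangent ∞ (extChartAt (𝓡 (n + 2)).tangent v).symm
      (extChartAt (𝓡 (n + 2)).tangent v).target :=
  contMDiffOn_extChartAt_symm v

namespace LorentzMetric

variable (g : LorentzMetric n M)

theorem form_congr {v v' : TangentBundle (𝓡 (n + 2)) M} (h : v = v')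
    (w : EuclideanSpace ℝ (Fin (n + 2))) : g.form v.proj v.snd w = g.form v'.proj v'.snd w := by
  subst h; rfl

theorem inChart_apply (x : M) (z a b : EuclideanSpace ℝ (Fin (n + 2))) :
    g.inChart x z a b = g.form ((extChartAt (𝓡 (n + 2)) x).symm z)
      (mfderiv 𝓘(ℝ, EuclideanSpace ℝ (Fin (n + 2))) (𝓡 (n + 2))
        (extChartAt (𝓡 (n + 2)) x).symm z a)
      (mfderiv 𝓘(ℝ, EuclideanSpace ℝ (Fin (n + 2))) (𝓡 (n + 2))
        (extChartAt (𝓡 (n + 2)) x).symm z b) := rfl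

theorem inChart_symm (x : M) (z a b : EuclideanSpace ℝ (Fin (n + 2))) :
    g.inChart x z a b = g.inChart x z b a := by
  rw [inChart_apply, inChart_apply, g.symm]

theorem contDiffOn_inChart (x : M) :
    ContDiffOn ℝ ∞ (g.inChart x) (extChartAt (𝓡 (n + 2)) x).target := by
  rw [contDiffOn_clm_apply]
  intro a
  rw [contDiffOn_clm_apply]
  intro b
  have hφ : ContMDiffOn 𝓘(ℝ, EuclideanSpace ℝ (Fin (n + 2))) (𝓡 (n + 2)) ∞
      (extChartAt (𝓡 (n + 2)) x).symm (extChartAt (𝓡 (n + 2)) x).target :=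
    contMDiffOn_extChartAt_symm x
  have h : ContMDiffOn 𝓘(ℝ, EuclideanSpace ℝ (Fin (n + 2))) ((𝓡 (n + 2)).prod 𝓘(ℝ)) ∞
      (fun z ↦ Bundle.TotalSpace.mk' ℝ (E := Bundle.Trivial M ℝ)
        ((extChartAt (𝓡 (n + 2)) x).symm z)
        (g.form ((extChartAt (𝓡 (n + 2)) x).symm z)
          (mfderiv 𝓘(ℝ, EuclideanSpace ℝ (Fin (n + 2))) (𝓡 (n + 2))
            (extChartAt (𝓡 (n + 2)) x).symm z a)
          (mfderiv 𝓘(ℝ, EuclideanSpace ℝ (Fin (n + 2))) (𝓡 (n + 2))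
            (extChartAt (𝓡 (n + 2)) x).symm z b)))
      (extChartAt (𝓡 (n + 2)) x).target := by
    apply ContMDiffOn.clm_bundle_apply₂ (F₁ := EuclideanSpace ℝ (Fin (n + 2)))
      (F₂ := EuclideanSpace ℝ (Fin (n + 2))) (E₁ := fun x : M ↦ TangentSpace (𝓡 (n + 2)) x)
      (E₂ := fun x : M ↦ TangentSpace (𝓡 (n + 2)) x)
    · exact g.contMDiff.comp_contMDiffOn hφ
    · exact contMDiffOn_mfderiv_extChartAt_symm x a
    · exact contMDiffOn_mfderiv_extChartAt_symm x b
  rw [← contMDiffOn_iff_contDiffOn]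
  intro z hz
  have := h z hz
  simp only [Bundle.contMDiffWithinAt_totalSpace] at this
  exact this.2

theorem contMDiff_normSq : ContMDiff (𝓡 (n + 2)).tangent 𝓘(ℝ) ∞
    (fun w : TangentBundle (𝓡 (n + 2)) M ↦ g.form w.proj w.snd w.snd) := by
  have hid : ContMDiff (𝓡 (n + 2)).tangent (𝓡 (n + 2)).tangent ∞
      (fun w : TangentBundle (𝓡 (n + 2)) M ↦
        Bundle.TotalSpace.mk' (EuclideanSpace ℝ (Fin (n + 2)))
          (E := fun x : M ↦ TangentSpace (𝓡 (n + 2)) x) w.proj w.snd) := contMDiff_id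
  have h : ContMDiff (𝓡 (n + 2)).tangent ((𝓡 (n + 2)).prod 𝓘(ℝ)) ∞
      (fun w : TangentBundle (𝓡 (n + 2)) M ↦
        Bundle.TotalSpace.mk' ℝ (E := Bundle.Trivial M ℝ) w.proj (g.form w.proj w.snd w.snd)) := by
    apply ContMDiff.clm_bundle_apply₂ (F₁ := EuclideanSpace ℝ (Fin (n + 2)))
      (F₂ := EuclideanSpace ℝ (Fin (n + 2))) (E₁ := fun x : M ↦ TangentSpace (𝓡 (n + 2)) x)
      (E₂ := fun x : M ↦ TangentSpace (𝓡 (n + 2)) x)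
    · exact g.contMDiff.comp (Bundle.contMDiff_proj (TangentSpace (𝓡 (n + 2)) : M → Type _))
    · exact hid
    · exact hid
  intro w
  have := h w
  simp only [Bundle.contMDiffAt_totalSpace] at this
  exact this.2

variable (v : TangentBundle (𝓡 (n + 2)) M)
  {p : EuclideanSpace ℝ (Fin (n + 2)) × EuclideanSpace ℝ (Fin (n + 2))}

theorem nullFun_inChart (hp : p.1 ∈ (extChartAt (𝓡 (n + 2)) v.proj).target) :
    nullFun (g.inChart v.proj) p =
      g.form ((extChartAt (𝓡 (n + 2)).tangent v).symm p).proj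
        ((extChartAt (𝓡 (n + 2)).tangent v).symm p).snd
        ((extChartAt (𝓡 (n + 2)).tangent v).symm p).snd := by
  rw [show p = (p.1, p.2) from rfl, tangent_extChartAt_symm v hp]
  rfl

theorem mem_target_tangent (hp : p.1 ∈ (extChartAt (𝓡 (n + 2)) v.proj).target) :
    p ∈ (extChartAt (𝓡 (n + 2)).tangent v).target := by
  rw [tangent_extChartAt_target]
  exact ⟨hp, trivial⟩

theorem symm_mem_nullCone_iff (hp : p.1 ∈ (extChartAt (𝓡 (n + 2)) v.proj).target) :
    (extChartAt (𝓡 (n + 2)).tangent v).symm p ∈ g.nullCone ↔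
      p.2 ≠ 0 ∧ nullFun (g.inChart v.proj) p = 0 := by
  rw [nullFun_inChart g v hp, nullCone, mem_ofPred_eq, and_congr_left_iff]
  intro _
  rw [show p = (p.1, p.2) from rfl, tangent_extChartAt_symm v hp]
  exact (map_ne_zero_iff _ (bijective_mfderiv_extChartAt_symm hp).1)

theorem symm_mem_coneTangent_iff (hp : p.1 ∈ (extChartAt (𝓡 (n + 2)) v.proj).target)
    (ξ : EuclideanSpace ℝ (Fin (n + 2)) × EuclideanSpace ℝ (Fin (n + 2))) :
    mfderiv 𝓘(ℝ, EuclideanSpace ℝ (Fin (n + 2)) × EuclideanSpace ℝ (Fin (n + 2)))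
        (𝓡 (n + 2)).tangent (extChartAt (𝓡 (n + 2)).tangent v).symm p ξ ∈
        g.coneTangent ((extChartAt (𝓡 (n + 2)).tangent v).symm p) ↔
      fderiv ℝ (nullFun (g.inChart v.proj)) p ξ = 0 := by
  have h := mfderiv_comp p ((g.contMDiff_normSq _).mdifferentiableAt (by simp))
    (mdifferentiableAt_extChartAt_symm (mem_target_tangent v hp))
  have heq : nullFun (g.inChart v.proj) =ᶠ[𝓝 p]
      (fun w : TangentBundle (𝓡 (n + 2)) M ↦ g.form w.proj w.snd w.snd) ∘
        (extChartAt (𝓡 (n + 2)).tangent v).symm := by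
    filter_upwards [eventually_fst_mem_extChartAt_target hp] with p' hp'
    exact nullFun_inChart g v hp'
  rw [← mfderiv_eq_fderiv, heq.mfderiv_eq, h]
  rfl

theorem tautological_symm (hp : p.1 ∈ (extChartAt (𝓡 (n + 2)) v.proj).target)
    (ξ : EuclideanSpace ℝ (Fin (n + 2)) × EuclideanSpace ℝ (Fin (n + 2))) :
    g.tautological ((extChartAt (𝓡 (n + 2)).tangent v).symm p)
      (mfderiv 𝓘(ℝ, EuclideanSpace ℝ (Fin (n + 2)) × EuclideanSpace ℝ (Fin (n + 2)))
        (𝓡 (n + 2)).tangent (extChartAt (𝓡 (n + 2)).tangent v).symm p ξ) =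
      g.inChart v.proj p.1 p.2 ξ.1 := by
  rw [tautological, dproj, mfderiv_proj_tangent_extChartAt_symm v hp ξ, inChart_apply]
  exact g.form_congr (tangent_extChartAt_symm v hp p.2) _

end LorentzMetric

end LorentzCharts

section QuotientCharts

variable {n : ℕ} {M : Type*} [TopologicalSpace M]
  [ChartedSpace (EuclideanSpace ℝ (Fin (n + 2))) M]
  [IsManifold (𝓡 (n + 2)) ∞ M]
  {𝒩 : Type*} [TopologicalSpace 𝒩]
  [ChartedSpace (EuclideanSpace ℝ (Fin (2 * n + 1))) 𝒩]
  [IsManifold (𝓡 (2 * n + 1)) ∞ 𝒩]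
  {g : LorentzMetric n M} (q : NullGeodesicSpace g 𝒩)

namespace NullGeodesicSpace

/-- The quotient map in the preferred charts at the null vector `v` and at the point `y`. -/
noncomputable def inChart (v : TangentBundle (𝓡 (n + 2)) M) (y : 𝒩)
    (p : EuclideanSpace ℝ (Fin (n + 2)) × EuclideanSpace ℝ (Fin (n + 2))) :
    EuclideanSpace ℝ (Fin (2 * n + 1)) :=
  extChartAt (𝓡 (2 * n + 1)) y (q.proj ((extChartAt (𝓡 (n + 2)).tangent v).symm p))

variable (v : TangentBundle (𝓡 (n + 2)) M) (y : 𝒩)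
  {p : EuclideanSpace ℝ (Fin (n + 2)) × EuclideanSpace ℝ (Fin (n + 2))}

theorem contMDiffAt_proj {w : TangentBundle (𝓡 (n + 2)) M} (hw : w ∈ q.dom) :
    ContMDiffAt (𝓡 (n + 2)).tangent (𝓡 (2 * n + 1)) ∞ q.proj w :=
  q.contMDiffOn.contMDiffAt (q.isOpen_dom.mem_nhds hw)

theorem contDiffAt_inChart (hp : p.1 ∈ (extChartAt (𝓡 (n + 2)) v.proj).target)
    (hdom : (extChartAt (𝓡 (n + 2)).tangent v).symm p ∈ q.dom)
    (hy : q.proj ((extChartAt (𝓡 (n + 2)).tangent v).symm p) ∈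
      (extChartAt (𝓡 (2 * n + 1)) y).source) : ContDiffAt ℝ ∞ (q.inChart v y) p := by
  rw [← contMDiffAt_iff_contDiffAt]
  have h1 := (contMDiffOn_tangent_extChartAt_symm v).contMDiffAt
    ((isOpen_extChartAt_target v).mem_nhds (LorentzMetric.mem_target_tangent v hp))
  have h2 := (q.contMDiffAt_proj hdom).comp p h1
  have h3 : ContMDiffAt (𝓡 (2 * n + 1)) 𝓘(ℝ, EuclideanSpace ℝ (Fin (2 * n + 1))) ∞
      (extChartAt (𝓡 (2 * n + 1)) y) (q.proj ((extChartAt (𝓡 (n + 2)).tangent v).symm p)) :=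
    contMDiffAt_extChartAt' (by rwa [extChartAt_source] at hy)
  exact h3.comp p h2

theorem fderiv_inChart (hp : p.1 ∈ (extChartAt (𝓡 (n + 2)) v.proj).target)
    (hdom : (extChartAt (𝓡 (n + 2)).tangent v).symm p ∈ q.dom)
    (hy : q.proj ((extChartAt (𝓡 (n + 2)).tangent v).symm p) ∈
      (extChartAt (𝓡 (2 * n + 1)) y).source)
    (ξ : EuclideanSpace ℝ (Fin (n + 2)) × EuclideanSpace ℝ (Fin (n + 2))) :
    fderiv ℝ (q.inChart v y) p ξ =
      mfderiv (𝓡 (2 * n + 1)) 𝓘(ℝ, EuclideanSpace ℝ (Fin (2 * n + 1)))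
        (extChartAt (𝓡 (2 * n + 1)) y) (q.proj ((extChartAt (𝓡 (n + 2)).tangent v).symm p))
        (mfderiv (𝓡 (n + 2)).tangent (𝓡 (2 * n + 1)) q.proj
          ((extChartAt (𝓡 (n + 2)).tangent v).symm p)
          (mfderiv 𝓘(ℝ, EuclideanSpace ℝ (Fin (n + 2)) × EuclideanSpace ℝ (Fin (n + 2)))
            (𝓡 (n + 2)).tangent (extChartAt (𝓡 (n + 2)).tangent v).symm p ξ)) := by
  have h1 := mdifferentiableAt_extChartAt_symm (LorentzMetric.mem_target_tangent v hp)
  have h2 := (q.contMDiffAt_proj hdom).mdifferentiableAt (by simp)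
  have h3 := mdifferentiableAt_extChartAt (I := 𝓡 (2 * n + 1)) (x := y)
    (by rwa [extChartAt_source] at hy)
  have e1 := mfderiv_comp p h2 h1
  have e2 := mfderiv_comp p h3 (h2.comp p h1)
  rw [e1] at e2
  rw [← mfderiv_eq_fderiv]
  exact congrArg (fun f ↦ f ξ) e2

theorem represents_iff {w : TangentBundle (𝓡 (n + 2)) M} {y : 𝒩} (hw : q.proj w = y)
    (ξ : TangentSpace (𝓡 (n + 2)).tangent w) (η : TangentSpace (𝓡 (2 * n + 1)) y) :
    q.Represents w ξ y η ↔ ξ ∈ g.coneTangent w ∧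
      (mfderiv (𝓡 (n + 2)).tangent (𝓡 (2 * n + 1)) q.proj w ξ :
        EuclideanSpace ℝ (Fin (2 * n + 1))) = η := by
  subst hw
  rw [Represents, tangentMap]
  exact and_congr_right fun _ ↦ Bundle.TotalSpace.mk_inj

theorem represents_symm_iff (hp : p.1 ∈ (extChartAt (𝓡 (n + 2)) v.proj).target)
    (hdom : (extChartAt (𝓡 (n + 2)).tangent v).symm p ∈ q.dom)
    (hy : q.proj ((extChartAt (𝓡 (n + 2)).tangent v).symm p) = y)
    (ξ : EuclideanSpace ℝ (Fin (n + 2)) × EuclideanSpace ℝ (Fin (n + 2)))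
    (η : TangentSpace (𝓡 (2 * n + 1)) y) :
    q.Represents ((extChartAt (𝓡 (n + 2)).tangent v).symm p)
      (mfderiv 𝓘(ℝ, EuclideanSpace ℝ (Fin (n + 2)) × EuclideanSpace ℝ (Fin (n + 2)))
        (𝓡 (n + 2)).tangent (extChartAt (𝓡 (n + 2)).tangent v).symm p ξ) y η ↔
      fderiv ℝ (nullFun (g.inChart v.proj)) p ξ = 0 ∧ fderiv ℝ (q.inChart v y) p ξ = η := by
  rw [q.represents_iff hy, g.symm_mem_coneTangent_iff v hp,
    q.fderiv_inChart v y hp hdom (by rw [hy]; exact mem_extChartAt_source y), hy,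
    mfderiv_extChartAt_self]
  rfl

end NullGeodesicSpace

end QuotientCharts

/-! ### Null geodesics and contact scales in charts -/

section NullVectors

variable {n : ℕ} {M : Type*} [TopologicalSpace M]
  [ChartedSpace (EuclideanSpace ℝ (Fin (n + 2))) M]
  [IsManifold (𝓡 (n + 2)) ∞ M]

namespace LorentzMetric

variable (g : LorentzMetric n M)

theorem form_ne_zero_of_null {x : M} {k : TangentSpace (𝓡 (n + 2)) x} (hk : k ≠ 0)
    (hkk : g.form x k k = 0) : g.form x k ≠ 0 := by
  intro h
  obtain ⟨t, -, ht⟩ := g.lorentzian x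
  have := ht k (by rw [g.symm, h]; rfl) hk
  exact this.ne' hkk

/-- A null vector orthogonal to a nonzero null vector is a multiple of it. -/
theorem mem_span_of_null {x : M} {k w : TangentSpace (𝓡 (n + 2)) x} (hk : k ≠ 0)
    (hkk : g.form x k k = 0) (hkw : g.form x k w = 0) (hww : g.form x w w = 0) :
    w ∈ Submodule.span ℝ {k} := by
  obtain ⟨t, -, ht⟩ := g.lorentzian x
  have htk : g.form x t k ≠ 0 := fun h ↦ (ht k h hk).ne' hkk
  set c := g.form x t w / g.form x t k with hc
  have h1 : g.form x t (w - c • k) = 0 := by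
    rw [map_sub, map_smul, hc, smul_eq_mul, div_mul_cancel₀ _ htk, sub_self]
  have h2 : g.form x (w - c • k) (w - c • k) = 0 := by
    have hwk : g.form x w k = 0 := by rw [g.symm, hkw]
    simp [hww, hkw, hkk, hwk]
  have h3 : w - c • k = 0 := by
    by_contra h
    exact (ht _ h1 h).ne' h2
  rw [Submodule.mem_span_singleton]
  exact ⟨c, (sub_eq_zero.1 h3).symm⟩

variable {g}

theorem IsNullGeodesicOn.sameNullGeodesic {σ : ℝ → M} {J : Set ℝ} (hJ : IsOpen J)
    (hJ' : J.OrdConnected) (hσ : g.IsNullGeodesicOn σ J) {a b : ℝ} (ha : a ∈ J) (hb : b ∈ J) :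
    g.SameNullGeodesic (velocity n σ a) (velocity n σ b) :=
  ⟨σ, J, hJ, hJ', hσ, a, ha, b, hb, rfl, 1, one_pos, by simp only [one_smul]⟩

variable (v : TangentBundle (𝓡 (n + 2)) M) {σ : ℝ → M} {J : Set ℝ}

theorem IsNullGeodesicOn.contMDiffAt (hJ : IsOpen J) (hσ : g.IsNullGeodesicOn σ J) {a : ℝ}
    (ha : a ∈ J) : ContMDiffAt 𝓘(ℝ, ℝ) (𝓡 (n + 2)) ∞ σ a :=
  hσ.1.1.contMDiffAt (hJ.mem_nhds ha)

theorem IsNullGeodesicOn.eventually_velocity (hJ : IsOpen J) (hσ : g.IsNullGeodesicOn σ J) {a : ℝ}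
    (ha : a ∈ J) (hs : σ a ∈ (extChartAt (𝓡 (n + 2)) v.proj).source) :
    ∀ᶠ s in 𝓝 a, s ∈ J ∧ (extChartAt (𝓡 (n + 2)).tangent v (velocity n σ s)).1 ∈
        (extChartAt (𝓡 (n + 2)) v.proj).target ∧
      (extChartAt (𝓡 (n + 2)).tangent v).symm
        (extChartAt (𝓡 (n + 2)).tangent v (velocity n σ s)) = velocity n σ s ∧
      extChartAt (𝓡 (n + 2)).tangent v (velocity n σ s) = (extChartAt (𝓡 (n + 2)) v.proj (σ s),
        deriv (fun s ↦ extChartAt (𝓡 (n + 2)) v.proj (σ s)) s) := by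
  have hsrc : ∀ᶠ s in 𝓝 a, σ s ∈ (extChartAt (𝓡 (n + 2)) v.proj).source :=
    (hσ.contMDiffAt hJ ha).continuousAt.eventually
      ((isOpen_extChartAt_source v.proj).mem_nhds hs)
  filter_upwards [hsrc, hJ.mem_nhds ha] with s h1 h2
  have h3 : velocity n σ s ∈ (extChartAt (𝓡 (n + 2)).tangent v).source := by
    rw [tangent_extChartAt_source]
    exact h1
  refine ⟨h2, ?_, (extChartAt (𝓡 (n + 2)).tangent v).left_inv h3,
    tangent_extChartAt_mfderiv v ((hσ.contMDiffAt hJ h2).mdifferentiableAt (by simp)) h1⟩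
  have := (extChartAt (𝓡 (n + 2)).tangent v).map_source h3
  rw [tangent_extChartAt_target] at this
  exact this.1

theorem IsNullGeodesicOn.contDiffAt_velocity (hJ : IsOpen J) (hσ : g.IsNullGeodesicOn σ J) {a : ℝ}
    (ha : a ∈ J) (hs : σ a ∈ (extChartAt (𝓡 (n + 2)) v.proj).source) :
    ContDiffAt ℝ ∞ (fun s ↦ extChartAt (𝓡 (n + 2)).tangent v (velocity n σ s)) a ∧
    (deriv (fun s ↦ extChartAt (𝓡 (n + 2)).tangent v (velocity n σ s)) a).1 =
      (extChartAt (𝓡 (n + 2)).tangent v (velocity n σ a)).2 := by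
  have hev := hσ.eventually_velocity v hJ ha hs
  have heq : (fun s ↦ extChartAt (𝓡 (n + 2)).tangent v (velocity n σ s)) =ᶠ[𝓝 a]
      fun s ↦ (extChartAt (𝓡 (n + 2)) v.proj (σ s),
        deriv (fun s ↦ extChartAt (𝓡 (n + 2)) v.proj (σ s)) s) := hev.mono fun s h ↦ h.2.2.2
  have hc : ContDiffAt ℝ ∞ (fun s ↦ extChartAt (𝓡 (n + 2)) v.proj (σ s)) a := by
    rw [← contMDiffAt_iff_contDiffAt]
    have h3 : ContMDiffAt (𝓡 (n + 2)) 𝓘(ℝ, EuclideanSpace ℝ (Fin (n + 2))) ∞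
      (extChartAt (𝓡 (n + 2)) v.proj) (σ a) :=
      contMDiffAt_extChartAt' (by rwa [extChartAt_source] at hs)
    exact h3.comp a (hσ.contMDiffAt hJ ha)
  have hd : ContDiffAt ℝ ∞ (deriv (fun s ↦ extChartAt (𝓡 (n + 2)) v.proj (σ s))) a :=
    hc.derivWithin (m := ∞) (by simp)
  refine ⟨(hc.prodMk hd).congr_of_eventuallyEq heq, ?_⟩
  rw [heq.deriv_eq, hev.self_of_nhds.2.2.2]
  have h1 := (hc.differentiableAt (by simp)).hasDerivAt.prodMk
    (hd.differentiableAt (by simp)).hasDerivAt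
  rw [h1.deriv]

end LorentzMetric

end NullVectors

section ContactScaleCharts

variable {n : ℕ} {M : Type*} [TopologicalSpace M]
  [ChartedSpace (EuclideanSpace ℝ (Fin (n + 2))) M]
  [IsManifold (𝓡 (n + 2)) ∞ M]
  {𝒩 : Type*} [TopologicalSpace 𝒩]
  [ChartedSpace (EuclideanSpace ℝ (Fin (2 * n + 1))) 𝒩]
  [IsManifold (𝓡 (2 * n + 1)) ∞ 𝒩]
  {g : LorentzMetric n M} {q : NullGeodesicSpace g 𝒩} {y : 𝒩} (θ : ContactScale q y)

namespace NullGeodesicSpace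

theorem exists_null_geodesic (q : NullGeodesicSpace g 𝒩) {w : TangentBundle (𝓡 (n + 2)) M}
    (hw : w ∈ g.nullCone) : ∃ (σ : ℝ → M) (J : Set ℝ), IsOpen J ∧ J.OrdConnected ∧
      g.IsNullGeodesicOn σ J ∧ ∃ a ∈ J, velocity n σ a = w := by
  obtain ⟨σ, J, hJ, hJ', hσ, a, ha, -, -, hv, -⟩ := (q.fiber w hw w hw).1 rfl
  exact ⟨σ, J, hJ, hJ', hσ, a, ha, hv⟩

theorem proj_velocity_eq (q : NullGeodesicSpace g 𝒩) {σ : ℝ → M} {J : Set ℝ} (hJ : IsOpen J)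
    (hJ' : J.OrdConnected) (hσ : g.IsNullGeodesicOn σ J) {a b : ℝ} (ha : a ∈ J) (hb : b ∈ J) :
    q.proj (velocity n σ a) = q.proj (velocity n σ b) :=
  (q.fiber _ (hσ.2 a ha) _ (hσ.2 b hb)).2 (hσ.sameNullGeodesic hJ hJ' ha hb)

theorem proj_smul (q : NullGeodesicSpace g 𝒩) {w : TangentBundle (𝓡 (n + 2)) M}
    (hw : w ∈ g.nullCone) {c : ℝ} (hc : 0 < c) : q.proj ⟨w.proj, c • w.snd⟩ = q.proj w := by
  have hw' : (⟨w.proj, c • w.snd⟩ : TangentBundle (𝓡 (n + 2)) M) ∈ g.nullCone :=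
    ⟨smul_ne_zero hc.ne' hw.1, by simp [hw.2]⟩
  obtain ⟨σ, J, hJ, hJ', hσ, a, ha, hv⟩ := q.exists_null_geodesic hw
  refine ((q.fiber w hw _ hw').2
    ⟨σ, J, hJ, hJ', hσ, a, ha, a, ha, hv, c⁻¹, inv_pos.2 hc, ?_⟩).symm
  simp only [smul_smul, inv_mul_cancel₀ hc.ne', one_smul]
  exact hv

end NullGeodesicSpace

namespace ContactScale

/-- The pullback of the contact scale to the null cone vanishes exactly where the tautological form
does: one inclusion is the definition of the contact hyperplane, the other holds because otherwise
the contact scale would vanish identically. -/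
theorem form_mfderiv_proj_eq_zero_iff {w : TangentBundle (𝓡 (n + 2)) M} (hw : w ∈ g.nullCone)
    (hdom : q.proj w ∈ θ.dom) {ξ : TangentSpace (𝓡 (n + 2)).tangent w} (hξ : ξ ∈ g.coneTangent w) :
    θ.form (q.proj w) (mfderiv (𝓡 (n + 2)).tangent (𝓡 (2 * n + 1)) q.proj w ξ) = 0 ↔
      g.tautological w ξ = 0 := by
  have key : ∀ ζ ∈ g.coneTangent w, g.tautological w ζ = 0 →
      θ.form (q.proj w) (mfderiv (𝓡 (n + 2)).tangent (𝓡 (2 * n + 1)) q.proj w ζ) = 0 := by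
    intro ζ hζ hα
    have : mfderiv (𝓡 (n + 2)).tangent (𝓡 (2 * n + 1)) q.proj w ζ ∈
        q.contactHyperplane (q.proj w) :=
      Submodule.subset_span ⟨w, hw, ζ, hα, hζ, rfl⟩
    rw [← θ.ker_form _ hdom] at this
    exact this
  refine ⟨fun h ↦ ?_, key ξ hξ⟩
  by_contra hα
  refine θ.form_ne_zero _ hdom (ContinuousLinearMap.ext fun η ↦ ?_)
  obtain ⟨ζ, hζ, rfl⟩ := q.submersion w hw η
  have h1 := key (ζ - (g.tautological w ζ / g.tautological w ξ) • ξ)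
    (Submodule.sub_mem _ hζ (Submodule.smul_mem _ _ hξ)) (by
      have : ∀ c : ℝ, g.tautological w (ζ - c • ξ) =
        g.tautological w ζ - c * g.tautological w ξ := fun c ↦ by
          simp only [LorentzMetric.tautological, map_sub, map_smul, smul_eq_mul]
      rw [this, div_mul_cancel₀ _ hα, sub_self])
  rw [map_sub, map_smul, map_sub, map_smul, h, smul_zero, sub_zero] at h1
  rw [h1]; rfl

theorem inChart_apply (z t : EuclideanSpace ℝ (Fin (2 * n + 1))) :
    θ.inChart z t = θ.form ((extChartAt (𝓡 (2 * n + 1)) y).symm z)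
      (mfderiv 𝓘(ℝ, EuclideanSpace ℝ (Fin (2 * n + 1))) (𝓡 (2 * n + 1))
      (extChartAt (𝓡 (2 * n + 1)) y).symm z t) := rfl

theorem inChart_extChartAt {z : 𝒩} (hz : z ∈ (extChartAt (𝓡 (2 * n + 1)) y).source)
    (τ : TangentSpace (𝓡 (2 * n + 1)) z) :
    θ.inChart (extChartAt (𝓡 (2 * n + 1)) y z)
      (mfderiv (𝓡 (2 * n + 1)) 𝓘(ℝ, EuclideanSpace ℝ (Fin (2 * n + 1)))
        (extChartAt (𝓡 (2 * n + 1)) y) z τ) = θ.form z τ := by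
  obtain ⟨t, ht, rfl⟩ : ∃ t ∈ (extChartAt (𝓡 (2 * n + 1)) y).target,
      (extChartAt (𝓡 (2 * n + 1)) y).symm t = z :=
    ⟨_, (extChartAt (𝓡 (2 * n + 1)) y).map_source hz, (extChartAt (𝓡 (2 * n + 1)) y).left_inv hz⟩
  rw [(extChartAt (𝓡 (2 * n + 1)) y).right_inv ht]
  exact (θ.inChart_apply t _).trans (congrArg _ (mfderiv_extChartAt_symm_comp ht τ))

theorem inChart_self (τ : TangentSpace (𝓡 (2 * n + 1)) y) :
    θ.inChart (extChartAt (𝓡 (2 * n + 1)) y y) τ = θ.form y τ := by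
  have := θ.inChart_extChartAt (mem_extChartAt_source y) τ
  rwa [mfderiv_extChartAt_self] at this

theorem contDiffAt_inChart : ContDiffAt ℝ ∞ θ.inChart (extChartAt (𝓡 (2 * n + 1)) y y) := by
  set U := (extChartAt (𝓡 (2 * n + 1)) y).target ∩
    (extChartAt (𝓡 (2 * n + 1)) y).symm ⁻¹' θ.dom with hU
  have hUo : IsOpen U :=
    (continuousOn_extChartAt_symm y).isOpen_inter_preimage (isOpen_extChartAt_target y)
      θ.isOpen_dom
  have hmem : extChartAt (𝓡 (2 * n + 1)) y y ∈ U :=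
    ⟨mem_extChartAt_target y, by rw [mem_preimage, extChartAt_to_inv]; exact θ.mem_dom⟩
  suffices h : ContDiffOn ℝ ∞ θ.inChart U from h.contDiffAt (hUo.mem_nhds hmem)
  rw [contDiffOn_clm_apply]
  intro a
  have hφ : ContMDiffOn 𝓘(ℝ, EuclideanSpace ℝ (Fin (2 * n + 1))) (𝓡 (2 * n + 1)) ∞
      (extChartAt (𝓡 (2 * n + 1)) y).symm (extChartAt (𝓡 (2 * n + 1)) y).target :=
    contMDiffOn_extChartAt_symm y
  have h : ContMDiffOn 𝓘(ℝ, EuclideanSpace ℝ (Fin (2 * n + 1)))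
      ((𝓡 (2 * n + 1)).prod 𝓘(ℝ)) ∞
      (fun z ↦ Bundle.TotalSpace.mk' ℝ (E := Bundle.Trivial 𝒩 ℝ)
        ((extChartAt (𝓡 (2 * n + 1)) y).symm z)
        (θ.form ((extChartAt (𝓡 (2 * n + 1)) y).symm z)
          (mfderiv 𝓘(ℝ, EuclideanSpace ℝ (Fin (2 * n + 1))) (𝓡 (2 * n + 1))
            (extChartAt (𝓡 (2 * n + 1)) y).symm z a))) U := by
    apply ContMDiffOn.clm_bundle_apply (F₁ := EuclideanSpace ℝ (Fin (2 * n + 1)))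
      (E₁ := fun x : 𝒩 ↦ TangentSpace (𝓡 (2 * n + 1)) x)
    · exact θ.contMDiffOn.comp (hφ.mono inter_subset_left) inter_subset_right
    · exact (contMDiffOn_mfderiv_extChartAt_symm y a).mono inter_subset_left
  rw [← contMDiffOn_iff_contDiffOn]
  intro z hz
  have := h z hz
  simp only [Bundle.contMDiffWithinAt_totalSpace] at this
  exact this.2

/-- Near a null vector, the metric, the quotient map and the contact scale in the preferred charts
form a local model. -/
theorem isLocalModel {v : TangentBundle (𝓡 (n + 2)) M} (hv : v ∈ g.nullCone)
    (hy : q.proj v = y) : IsLocalModel (g.inChart v.proj) (q.inChart v y) θ.inChart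
      (extChartAt (𝓡 (n + 2)).tangent v v) := by
  set p₀ := extChartAt (𝓡 (n + 2)).tangent v v with hp₀
  have hψ₀ : (extChartAt (𝓡 (n + 2)).tangent v).symm p₀ = v := extChartAt_to_inv v
  have hp₀t : p₀.1 ∈ (extChartAt (𝓡 (n + 2)) v.proj).target := by
    rw [hp₀, tangent_extChartAt_self]
    exact mem_extChartAt_target v.proj
  have hnull := (g.symm_mem_nullCone_iff v hp₀t).1 (by rwa [hψ₀])
  have hcont : ContinuousAt (extChartAt (𝓡 (n + 2)).tangent v).symm p₀ :=
    continuousAt_extChartAt_symm v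
  have hdom₀ : v ∈ q.dom := q.nullCone_subset hv
  have hev1 : ∀ᶠ p in 𝓝 p₀, p.1 ∈ (extChartAt (𝓡 (n + 2)) v.proj).target :=
    eventually_fst_mem_extChartAt_target hp₀t
  have hev2 : ∀ᶠ p in 𝓝 p₀, (extChartAt (𝓡 (n + 2)).tangent v).symm p ∈ q.dom :=
    hcont.eventually (by rw [hψ₀]; exact q.isOpen_dom.mem_nhds hdom₀)
  have hcontq : ContinuousAt (fun p ↦ q.proj ((extChartAt (𝓡 (n + 2)).tangent v).symm p)) p₀ := by
    refine ContinuousAt.comp (g := q.proj) ?_ hcont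
    rw [hψ₀]
    exact (q.contMDiffAt_proj hdom₀).continuousAt
  have hq₀ : q.proj ((extChartAt (𝓡 (n + 2)).tangent v).symm p₀) = y := by rw [hψ₀, hy]
  have hev3 : ∀ᶠ p in 𝓝 p₀, q.proj ((extChartAt (𝓡 (n + 2)).tangent v).symm p) ∈
      (extChartAt (𝓡 (2 * n + 1)) y).source :=
    hcontq.eventually (by beta_reduce; rw [hq₀]; exact extChartAt_source_mem_nhds y)
  have hev4 : ∀ᶠ p in 𝓝 p₀, q.proj ((extChartAt (𝓡 (n + 2)).tangent v).symm p) ∈ θ.dom :=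
    hcontq.eventually (by beta_reduce; rw [hq₀]; exact θ.isOpen_dom.mem_nhds θ.mem_dom)
  have hev5 : ∀ᶠ p in 𝓝 p₀, p.2 ≠ 0 := continuousAt_snd.eventually_ne hnull.1
  have hF : ∀ p : EuclideanSpace ℝ (Fin (n + 2)) × EuclideanSpace ℝ (Fin (n + 2)),
      p.1 ∈ (extChartAt (𝓡 (n + 2)) v.proj).target →
        DifferentiableAt ℝ (nullFun (g.inChart v.proj)) p :=
    fun p hp ↦ (contDiffAt_nullFun (((g.contDiffOn_inChart v.proj).contDiffAt
      ((isOpen_extChartAt_target v.proj).mem_nhds hp)).of_le ENat.LEInfty.out)).differentiableAt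
        one_ne_zero
  have hbij := bijective_mfderiv_extChartAt_symm hp₀t
  have hk0 := (map_ne_zero_iff _ hbij.1).2 hnull.1
  exact
  { finrank_eq := by
      simp only [finrank_euclideanSpace, Fintype.card_fin]
      ring
    symm := g.inChart_symm v.proj
    contDiffAt_metric := (g.contDiffOn_inChart v.proj).contDiffAt
      ((isOpen_extChartAt_target v.proj).mem_nhds hp₀t)
    contDiffAt_quotient := q.contDiffAt_inChart v y hp₀t (by rwa [hψ₀])
      (by rw [hq₀]; exact mem_extChartAt_source y)
    contDiffAt_scale := by
      have : q.inChart v y p₀ = extChartAt (𝓡 (2 * n + 1)) y y := by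
        rw [NullGeodesicSpace.inChart, hq₀]
      rw [this]
      exact θ.contDiffAt_inChart
    ne_zero := hnull.1
    null := hnull.2
    metric_ne_zero := by
      intro h
      refine g.form_ne_zero_of_null hk0 hnull.2 (ContinuousLinearMap.ext fun b ↦ ?_)
      obtain ⟨b, rfl⟩ := hbij.2 b
      exact congrArg (fun f ↦ f b) h
    mem_span := by
      intro w h1 h2
      have h := g.mem_span_of_null hk0 hnull.2 h1 h2
      obtain ⟨c, hc⟩ := Submodule.mem_span_singleton.1 h
      exact Submodule.mem_span_singleton.2 ⟨c, hbij.1 ((map_smul _ c _).trans hc)⟩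
    submersion := by
      filter_upwards [hev1, hev2, hev3, hev5] with p h1 h2 h3 h5 hFp η
      have hnc := (g.symm_mem_nullCone_iff v h1).2 ⟨h5, hFp⟩
      obtain ⟨e, he⟩ := isInvertible_mfderiv_extChartAt h3
      obtain ⟨ξ', hξ', hη⟩ := q.submersion _ hnc (e.symm η)
      obtain ⟨ξ, rfl⟩ :=
        (bijective_mfderiv_extChartAt_symm (LorentzMetric.mem_target_tangent v h1)).2 ξ'
      refine ⟨ξ, (g.symm_mem_coneTangent_iff v h1 ξ).1 hξ', ?_⟩
      refine ((q.fderiv_inChart v y h1 h2 h3 ξ).trans (congrArg _ hη)).trans ?_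
      rw [← he]
      exact e.apply_symm_apply η
    geodesic := by
      filter_upwards [hev1, hev2, hev3, hev5] with p h1 h2 h3 h5 hFp
      have hnc := (g.symm_mem_nullCone_iff v h1).2 ⟨h5, hFp⟩
      obtain ⟨σ, J, hJ, hJ', hσ, a, ha, hva⟩ := q.exists_null_geodesic hnc
      have hsrc : σ a ∈ (extChartAt (𝓡 (n + 2)) v.proj).source := by
        have := (extChartAt (𝓡 (n + 2)).tangent v).map_target
          (LorentzMetric.mem_target_tangent v h1)
        rw [← hva, tangent_extChartAt_source] at this
        exact this
      have hPa : extChartAt (𝓡 (n + 2)).tangent v (velocity n σ a) = p := by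
        rw [hva]
        exact (extChartAt (𝓡 (n + 2)).tangent v).right_inv (LorentzMetric.mem_target_tangent v h1)
      obtain ⟨hPd, hP1⟩ := hσ.contDiffAt_velocity v hJ ha hsrc
      have hev := hσ.eventually_velocity v hJ ha hsrc
      set P := fun s ↦ extChartAt (𝓡 (n + 2)).tangent v (velocity n σ s) with hP
      have hPder : HasDerivAt P (deriv P a) a := (hPd.differentiableAt (by simp)).hasDerivAt
      rw [hPa] at hP1
      have hpair : (p.2, (deriv P a).2) = deriv P a := Prod.ext hP1.symm rfl
      refine ⟨(deriv P a).2, ?_, ?_⟩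
      · rw [hpair]
        have h6 : HasFDerivAt (nullFun (g.inChart v.proj))
            (fderiv ℝ (nullFun (g.inChart v.proj)) p) (P a) := by
          rw [show P a = p from hPa]
          exact (hF p h1).hasFDerivAt
        have h7 : nullFun (g.inChart v.proj) ∘ P =ᶠ[𝓝 a] fun _ ↦ 0 := by
          filter_upwards [hev] with s hs
          rw [Function.comp_apply, LorentzMetric.nullFun_inChart g v hs.2.1, hs.2.2.1]
          exact (hσ.2 s hs.1).2
        exact (h6.comp_hasDerivAt a hPder).unique
          ((hasDerivAt_const a (0 : ℝ)).congr_of_eventuallyEq h7)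
      · rw [hpair]
        have h6 : HasFDerivAt (q.inChart v y) (fderiv ℝ (q.inChart v y) p) (P a) := by
          rw [show P a = p from hPa]
          exact ((q.contDiffAt_inChart v y h1 h2 h3).differentiableAt (by simp)).hasFDerivAt
        have h7 : q.inChart v y ∘ P =ᶠ[𝓝 a] fun _ ↦ q.inChart v y p := by
          filter_upwards [hev] with s hs
          rw [Function.comp_apply, NullGeodesicSpace.inChart, hs.2.2.1,
            q.proj_velocity_eq hJ hJ' hσ hs.1 ha, hva]
          rfl
        exact (h6.comp_hasDerivAt a hPder).unique
          ((hasDerivAt_const a _).congr_of_eventuallyEq h7)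
    scaling := by
      filter_upwards [hev1, hev2, hev3, hev5] with p h1 h2 h3 h5 hFp
      have hnc := (g.symm_mem_nullCone_iff v h1).2 ⟨h5, hFp⟩
      have hder : HasDerivAt (fun s : ℝ ↦ (p.1, (1 + s) • p.2)) ((0 : _), p.2) 0 := by
        have h6 : HasDerivAt (fun s : ℝ ↦ (1 + s) • p.2) ((1 : ℝ) • p.2) 0 :=
          ((hasDerivAt_id (0 : ℝ)).const_add 1).smul_const p.2
        rw [one_smul] at h6
        exact (hasDerivAt_const (0 : ℝ) p.1).prodMk h6
      have h6 : HasFDerivAt (q.inChart v y) (fderiv ℝ (q.inChart v y) p)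
          (p.1, (1 + (0 : ℝ)) • p.2) := by
        rw [add_zero, one_smul]
        exact ((q.contDiffAt_inChart v y h1 h2 h3).differentiableAt (by simp)).hasFDerivAt
      have h7 : q.inChart v y ∘ (fun s : ℝ ↦ (p.1, (1 + s) • p.2)) =ᶠ[𝓝 0]
          fun _ ↦ q.inChart v y p := by
        have hpos : ∀ᶠ s in 𝓝 (0 : ℝ), 0 < 1 + s := by
          have : ContinuousAt (fun s : ℝ ↦ 1 + s) 0 := by fun_prop
          exact this.eventually (lt_mem_nhds (by norm_num))
        filter_upwards [hpos] with s hs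
        have e1 := tangent_extChartAt_symm v h1 p.2
        have e2 : (extChartAt (𝓡 (n + 2)).tangent v).symm (p.1, (1 + s) • p.2) =
            ⟨((extChartAt (𝓡 (n + 2)).tangent v).symm p).proj,
              (1 + s) • ((extChartAt (𝓡 (n + 2)).tangent v).symm p).snd⟩ := by
          refine (tangent_extChartAt_symm v h1 ((1 + s) • p.2)).trans ?_
          rw [show (extChartAt (𝓡 (n + 2)).tangent v).symm p = _ from e1]
          exact congrArg (Bundle.TotalSpace.mk _) (map_smul _ (1 + s) p.2)
        exact congrArg (extChartAt (𝓡 (2 * n + 1)) y)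
          ((congrArg q.proj e2).trans (q.proj_smul hnc hs))
      exact (h6.comp_hasDerivAt 0 hder).unique ((hasDerivAt_const 0 _).congr_of_eventuallyEq h7)
    contact := by
      filter_upwards [hev1, hev2, hev3, hev4, hev5] with p h1 h2 h3 h4 h5 hFp ξ hξ
      have hnc := (g.symm_mem_nullCone_iff v h1).2 ⟨h5, hFp⟩
      rw [q.fderiv_inChart v y h1 h2 h3, NullGeodesicSpace.inChart, θ.inChart_extChartAt h3,
        θ.form_mfderiv_proj_eq_zero_iff hnc h4 ((g.symm_mem_coneTangent_iff v h1 ξ).2 hξ),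
        g.tautological_symm v h1] }

end ContactScale

end ContactScaleCharts

/-! ### Variations representing tangent vectors of the space of null geodesics -/

section Variations

variable {n : ℕ} {M : Type*} [TopologicalSpace M]
  [ChartedSpace (EuclideanSpace ℝ (Fin (n + 2))) M]
  [IsManifold (𝓡 (n + 2)) ∞ M]
  {𝒩 : Type*} [TopologicalSpace 𝒩]
  [ChartedSpace (EuclideanSpace ℝ (Fin (2 * n + 1))) 𝒩]
  [IsManifold (𝓡 (2 * n + 1)) ∞ 𝒩]
  {g : LorentzMetric n M} {q : NullGeodesicSpace g 𝒩} {y : 𝒩}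

instance (z : 𝒩) : FiniteDimensional ℝ (TangentSpace (𝓡 (2 * n + 1)) z) :=
  inferInstanceAs (FiniteDimensional ℝ (EuclideanSpace ℝ (Fin (2 * n + 1))))

instance (x : M) : FiniteDimensional ℝ (TangentSpace (𝓡 (n + 2)) x) :=
  inferInstanceAs (FiniteDimensional ℝ (EuclideanSpace ℝ (Fin (n + 2))))

namespace NullGeodesicSpace

/-- The variations of a null vector `w` in the tangent chart at a nearby vector `v`: their
components there, the tangent vectors they represent and their displacements. -/
theorem exists_chart_variations (q : NullGeodesicSpace g 𝒩) {v w : TangentBundle (𝓡 (n + 2)) M}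
    {p : EuclideanSpace ℝ (Fin (n + 2)) × EuclideanSpace ℝ (Fin (n + 2))}
    (hp : p.1 ∈ (extChartAt (𝓡 (n + 2)) v.proj).target)
    (hpw : (extChartAt (𝓡 (n + 2)).tangent v).symm p = w) (hw : w ∈ q.dom) (hy : q.proj w = y) :
    ∃ e : EuclideanSpace ℝ (Fin (n + 2)) × EuclideanSpace ℝ (Fin (n + 2)) →
        TangentSpace (𝓡 (n + 2)).tangent w, Function.Surjective e ∧
      ∀ ξ, (∀ η : TangentSpace (𝓡 (2 * n + 1)) y, q.Represents w (e ξ) y η ↔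
          fderiv ℝ (nullFun (g.inChart v.proj)) p ξ = 0 ∧ fderiv ℝ (q.inChart v y) p ξ = η) ∧
        (dproj w (e ξ) : EuclideanSpace ℝ (Fin (n + 2))) =
          mfderiv 𝓘(ℝ, EuclideanSpace ℝ (Fin (n + 2))) (𝓡 (n + 2))
            (extChartAt (𝓡 (n + 2)) v.proj).symm p.1 ξ.1 ∧
        (dproj w (e ξ) = 0 ↔ ξ.1 = 0) ∧
        (dproj w (e ξ) ∈ Submodule.span ℝ {w.snd} ↔ ξ.1 ∈ Submodule.span ℝ {p.2}) := by
  subst hpw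
  have hb := bijective_mfderiv_extChartAt_symm hp
  have hd := fun ξ ↦ mfderiv_proj_tangent_extChartAt_symm v hp ξ
  have hsnd : (((extChartAt (𝓡 (n + 2)).tangent v).symm p).snd :
      EuclideanSpace ℝ (Fin (n + 2))) = mfderiv 𝓘(ℝ, EuclideanSpace ℝ (Fin (n + 2))) (𝓡 (n + 2))
            (extChartAt (𝓡 (n + 2)) v.proj).symm p.1 p.2 := by
    have := congrArg (fun w : TangentBundle (𝓡 (n + 2)) M ↦
      (w.snd : EuclideanSpace ℝ (Fin (n + 2)))) (tangent_extChartAt_symm v hp p.2)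
    exact this
  refine ⟨mfderiv 𝓘(ℝ, EuclideanSpace ℝ (Fin (n + 2)) × EuclideanSpace ℝ (Fin (n + 2)))
        (𝓡 (n + 2)).tangent (extChartAt (𝓡 (n + 2)).tangent v).symm p,
    (bijective_mfderiv_extChartAt_symm (LorentzMetric.mem_target_tangent v hp)).2, fun ξ ↦
    ⟨fun η ↦ q.represents_symm_iff v y hp hw hy ξ η, hd ξ, ?_, ?_⟩⟩
  · exact (Eq.congr_left (hd ξ)).trans (map_eq_zero_iff _ hb.1)
  · constructor
    · intro h
      obtain ⟨c, hc⟩ := Submodule.mem_span_singleton.1 h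
      refine Submodule.mem_span_singleton.2 ⟨c, hb.1 ?_⟩
      exact ((map_smul _ c p.2).trans (congrArg (c • ·) hsnd.symm)).trans (hc.trans (hd ξ))
    · intro h
      obtain ⟨c, hc⟩ := Submodule.mem_span_singleton.1 h
      refine Submodule.mem_span_singleton.2 ⟨c, ?_⟩
      refine (congrArg (c • ·) hsnd).trans (Eq.trans ?_ (hd ξ).symm)
      exact (map_smul _ c p.2).symm.trans (congrArg _ hc)

variable {v : TangentBundle (𝓡 (n + 2)) M}

theorem exists_represents (q : NullGeodesicSpace g 𝒩) (hv : v ∈ g.nullCone) (hy : q.proj v = y)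
    (η : TangentSpace (𝓡 (2 * n + 1)) y) : ∃ ξ, q.Represents v ξ y η := by
  subst hy
  obtain ⟨ξ, hξ, h⟩ := q.submersion v hv η
  exact ⟨ξ, (q.represents_iff rfl ξ η).2 ⟨hξ, h⟩⟩

theorem Represents.add {ξ ξ' : TangentSpace (𝓡 (n + 2)).tangent v}
    {η η' : TangentSpace (𝓡 (2 * n + 1)) y} (h : q.Represents v ξ y η)
    (h' : q.Represents v ξ' y η') : q.Represents v (ξ + ξ') y (η + η') := by
  obtain rfl : q.proj v = y := congrArg Bundle.TotalSpace.proj h.2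
  rw [q.represents_iff rfl] at h h' ⊢
  exact ⟨Submodule.add_mem _ h.1 h'.1, (map_add _ ξ ξ').trans (congrArg₂ _ h.2 h'.2)⟩

theorem Represents.smul {ξ : TangentSpace (𝓡 (n + 2)).tangent v}
    {η : TangentSpace (𝓡 (2 * n + 1)) y} (h : q.Represents v ξ y η) (c : ℝ) :
    q.Represents v (c • ξ) y (c • η) := by
  obtain rfl : q.proj v = y := congrArg Bundle.TotalSpace.proj h.2
  rw [q.represents_iff rfl] at h ⊢
  exact ⟨Submodule.smul_mem _ c h.1, (map_smul _ c ξ).trans (congrArg (c • ·) h.2)⟩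

theorem Represents.sub {ξ ξ' : TangentSpace (𝓡 (n + 2)).tangent v}
    {η η' : TangentSpace (𝓡 (2 * n + 1)) y} (h : q.Represents v ξ y η)
    (h' : q.Represents v ξ' y η') : q.Represents v (ξ - ξ') y (η - η') := by
  have := h.add (h'.smul (-1))
  rwa [neg_one_smul, neg_one_smul, ← sub_eq_add_neg, ← sub_eq_add_neg] at this

/-- A linear choice of representing variations. -/
theorem exists_linear_represents (q : NullGeodesicSpace g 𝒩) (hv : v ∈ g.nullCone)
    (hy : q.proj v = y) :
    ∃ s : TangentSpace (𝓡 (2 * n + 1)) y →ₗ[ℝ] TangentSpace (𝓡 (n + 2)).tangent v,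
      ∀ η, q.Represents v (s η) y η := by
  subst hy
  obtain ⟨s, hs⟩ := LinearMap.exists_rightInverse_of_surjective
    ((mfderiv (𝓡 (n + 2)).tangent (𝓡 (2 * n + 1)) q.proj v).toLinearMap.domRestrict
      (g.coneTangent v)) (LinearMap.range_eq_top.2 fun η ↦ by
        obtain ⟨ξ, hξ, h⟩ := q.submersion v hv η
        exact ⟨⟨ξ, hξ⟩, h⟩)
  refine ⟨(g.coneTangent v).subtype ∘ₗ s, fun η ↦ (q.represents_iff rfl _ _).2 ⟨(s η).2, ?_⟩⟩
  exact congrArg (fun f ↦ f η) hs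

theorem mem_vertical_iff (hv : v ∈ g.nullCone) (hy : q.proj v = y)
    {X : q.contactHyperplane y} :
    X ∈ q.vertical v y ↔ ∃ ξ, dproj v ξ = 0 ∧ q.Represents v ξ y X := by
  refine ⟨fun h ↦ ?_, fun h ↦ Submodule.subset_span h⟩
  induction h using Submodule.span_induction with
  | mem X h => exact h
  | zero =>
    obtain ⟨s, hs⟩ := q.exists_linear_represents hv hy
    have := hs 0
    rw [map_zero] at this
    exact ⟨0, map_zero _, this⟩
  | add X Y _ _ hX hY =>
    obtain ⟨ξ, h1, h2⟩ := hX
    obtain ⟨ξ', h1', h2'⟩ := hY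
    exact ⟨ξ + ξ', by rw [map_add, h1, h1', add_zero], h2.add h2'⟩
  | smul c X _ hX =>
    obtain ⟨ξ, h1, h2⟩ := hX
    exact ⟨c • ξ, by rw [map_smul, h1, smul_zero], h2.smul c⟩

end NullGeodesicSpace

namespace ContactScale

variable (θ : ContactScale q y) {v : TangentBundle (𝓡 (n + 2)) M}

theorem mem_contactHyperplane_iff {η : TangentSpace (𝓡 (2 * n + 1)) y} :
    η ∈ q.contactHyperplane y ↔ θ.form y η = 0 := by
  rw [← θ.ker_form y θ.mem_dom]
  rfl

theorem dproj_mem_perp_iff (θ : ContactScale q y) (hv : v ∈ g.nullCone)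
    {ξ : TangentSpace (𝓡 (n + 2)).tangent v}
    {η : TangentSpace (𝓡 (2 * n + 1)) y} (h : q.Represents v ξ y η) :
    dproj v ξ ∈ g.perp v ↔ η ∈ q.contactHyperplane y := by
  obtain rfl : q.proj v = y := congrArg Bundle.TotalSpace.proj h.2
  rw [q.represents_iff rfl] at h
  obtain ⟨h1, rfl⟩ := h
  rw [θ.mem_contactHyperplane_iff]
  exact (θ.form_mfderiv_proj_eq_zero_iff hv θ.mem_dom h1).symm

end ContactScale

end Variations

/-! ### The Levi form -/

section LeviForm

variable {n : ℕ} {M : Type*} [TopologicalSpace M]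
  [ChartedSpace (EuclideanSpace ℝ (Fin (n + 2))) M]
  [IsManifold (𝓡 (n + 2)) ∞ M]
  {𝒩 : Type*} [TopologicalSpace 𝒩]
  [ChartedSpace (EuclideanSpace ℝ (Fin (2 * n + 1))) 𝒩]
  [IsManifold (𝓡 (2 * n + 1)) ∞ 𝒩]
  {g : LorentzMetric n M} {q : NullGeodesicSpace g 𝒩} {y : 𝒩}

namespace ContactScale

variable (θ : ContactScale q y) {v : TangentBundle (𝓡 (n + 2)) M}

/-- At the centre of the tangent chart the displacement of a variation is its first component. -/
theorem exists_centered_chart_variations (hv : v ∈ g.nullCone) (hy : q.proj v = y) :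
    q.inChart v y (extChartAt (𝓡 (n + 2)).tangent v v) = extChartAt (𝓡 (2 * n + 1)) y y ∧
    ∃ e : EuclideanSpace ℝ (Fin (n + 2)) × EuclideanSpace ℝ (Fin (n + 2)) →
        TangentSpace (𝓡 (n + 2)).tangent v, Function.Surjective e ∧
      ∀ ξ, (∀ η : TangentSpace (𝓡 (2 * n + 1)) y, q.Represents v (e ξ) y η ↔
          fderiv ℝ (nullFun (g.inChart v.proj)) (extChartAt (𝓡 (n + 2)).tangent v v) ξ = 0 ∧
          fderiv ℝ (q.inChart v y) (extChartAt (𝓡 (n + 2)).tangent v v) ξ = η) ∧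
        (dproj v (e ξ) : EuclideanSpace ℝ (Fin (n + 2))) = ξ.1 ∧
        (dproj v (e ξ) = 0 ↔ ξ.1 = 0) ∧
        (dproj v (e ξ) ∈ Submodule.span ℝ {v.snd} ↔
          ξ.1 ∈ Submodule.span ℝ {(extChartAt (𝓡 (n + 2)).tangent v v).2}) := by
  have hψ : (extChartAt (𝓡 (n + 2)).tangent v).symm (extChartAt (𝓡 (n + 2)).tangent v v) = v :=
    extChartAt_to_inv v
  have hp : (extChartAt (𝓡 (n + 2)).tangent v v).1 ∈ (extChartAt (𝓡 (n + 2)) v.proj).target := by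
    rw [tangent_extChartAt_self]
    exact mem_extChartAt_target v.proj
  refine ⟨by rw [NullGeodesicSpace.inChart, hψ, hy], ?_⟩
  obtain ⟨e, he, h⟩ := q.exists_chart_variations hp hψ (q.nullCone_subset hv) hy
  refine ⟨e, he, fun ξ ↦ ⟨(h ξ).1, (h ξ).2.1.trans ?_, (h ξ).2.2⟩⟩
  rw [tangent_extChartAt_self, mfderiv_extChartAt_symm_self]
  rfl

/-- The variations representing zero are the combinations of the geodesic and scaling directions;
only the former has a displacement, which is a multiple of `k`. -/
theorem dproj_mem_span_of_represents_zero (θ : ContactScale q y) (hv : v ∈ g.nullCone)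
    {ξ : TangentSpace (𝓡 (n + 2)).tangent v} (h : q.Represents v ξ y 0) :
    dproj v ξ ∈ Submodule.span ℝ {v.snd} := by
  obtain rfl : q.proj v = y := congrArg Bundle.TotalSpace.proj h.2
  have hm := θ.isLocalModel hv rfl
  obtain ⟨-, e, he, hd⟩ := exists_centered_chart_variations (q := q) hv rfl
  obtain ⟨ξ, rfl⟩ := he ξ
  obtain ⟨h1, h2⟩ := ((hd ξ).1 _).1 h
  exact (hd ξ).2.2.2.2 (hm.eventually_fst_mem_span.self_of_nhds hm.null ξ h1 h2)

theorem exists_represents_dproj_eq (θ : ContactScale q y) (hv : v ∈ g.nullCone)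
    (hy : q.proj v = y) (w : TangentSpace (𝓡 (n + 2)) v.proj) :
    ∃ ξ η, q.Represents v ξ y η ∧ dproj v ξ = w := by
  have hm := θ.isLocalModel hv hy
  obtain ⟨-, e, he, hd⟩ := exists_centered_chart_variations (q := q) hv hy
  obtain ⟨κ, hκ⟩ := hm.exists_tangent w
  exact ⟨e (w, κ), _, ((hd _).1 _).2 ⟨hκ, rfl⟩, (hd _).2.1⟩

theorem mem_vertical_of_dproj_mem_span (θ : ContactScale q y) (hv : v ∈ g.nullCone)
    {ξ : TangentSpace (𝓡 (n + 2)).tangent v} {X : q.contactHyperplane y}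
    (h : q.Represents v ξ y X) (hξ : dproj v ξ ∈ Submodule.span ℝ {v.snd}) :
    X ∈ q.vertical v y := by
  have hy : q.proj v = y := congrArg Bundle.TotalSpace.proj h.2
  have hm := θ.isLocalModel hv hy
  obtain ⟨-, e, he, hd⟩ := exists_centered_chart_variations (q := q) hv hy
  obtain ⟨ξ, rfl⟩ := he ξ
  obtain ⟨h1, h2⟩ := ((hd ξ).1 _).1 h
  obtain ⟨κ, hκ, hκ'⟩ := hm.exists_vertical h1 ((hd ξ).2.2.2.1 hξ)
  exact (NullGeodesicSpace.mem_vertical_iff hv hy).2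
    ⟨e (0, κ), (hd _).2.2.1.2 rfl, ((hd _).1 _).2 ⟨hκ, hκ'.trans h2⟩⟩

theorem mem_vertical_iff_chart (hv : v ∈ g.nullCone) (hy : q.proj v = y)
    {X : q.contactHyperplane y} : X ∈ q.vertical v y ↔
      ∃ κ, fderiv ℝ (nullFun (g.inChart v.proj)) (extChartAt (𝓡 (n + 2)).tangent v v) (0, κ) = 0 ∧
        fderiv ℝ (q.inChart v y) (extChartAt (𝓡 (n + 2)).tangent v v) (0, κ) =
          (X : TangentSpace (𝓡 (2 * n + 1)) y) := by
  obtain ⟨-, e, he, hd⟩ := exists_centered_chart_variations (q := q) hv hy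
  rw [NullGeodesicSpace.mem_vertical_iff hv hy]
  constructor
  · rintro ⟨ξ, h1, h2⟩
    obtain ⟨ξ, rfl⟩ := he ξ
    have h3 : ξ = (0, ξ.2) := Prod.ext ((hd ξ).2.2.1.1 h1) rfl
    have := ((hd ξ).1 _).1 h2
    rw [h3] at this
    exact ⟨ξ.2, this⟩
  · rintro ⟨κ, h⟩
    exact ⟨e (0, κ), (hd _).2.2.1.2 rfl, ((hd _).1 _).2 h⟩

/-- The variations vanishing at the base point of `v` form a Lagrangian subspace of the contact
hyperplane. -/
theorem isLagrangian_vertical (hv : v ∈ g.nullCone) (hy : q.proj v = y) :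
    θ.IsLagrangian (q.vertical v y) := by
  have hm := θ.isLocalModel hv hy
  obtain ⟨hQ, -⟩ := exists_centered_chart_variations (q := q) hv hy
  have hc := hm.contact.self_of_nhds hm.null
  intro X
  constructor
  · intro hX Y hY
    obtain ⟨κ, h1, h2⟩ := (mem_vertical_iff_chart hv hy).1 hX
    obtain ⟨κ', h1', h2'⟩ := (mem_vertical_iff_chart hv hy).1 hY
    have := hm.dOne_vertical h1 h1'
    rw [hQ, h2, h2'] at this
    exact this
  · intro h
    rw [mem_vertical_iff_chart hv hy]
    refine hm.exists_vertical_of_orthogonal ?_ fun κ hκ ↦ ?_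
    · rw [hQ]
      exact (θ.inChart_self X).trans (θ.mem_contactHyperplane_iff.1 X.2)
    · have hmem : fderiv ℝ (q.inChart v y) (extChartAt (𝓡 (n + 2)).tangent v v) (0, κ) ∈
          q.contactHyperplane y := by
        refine θ.mem_contactHyperplane_iff.2 ((θ.inChart_self _).symm.trans ?_)
        have h3 := (hc _ hκ).2 (by simp)
        rw [hQ] at h3
        exact h3
      have := h ⟨_, hmem⟩ ((mem_vertical_iff_chart hv hy).2 ⟨κ, hκ, rfl⟩)
      rw [hQ]
      exact this

/-- The Levi form `dθ` on the contact hyperplane. -/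
noncomputable def leviForm : LinearMap.BilinForm ℝ (q.contactHyperplane y) :=
  LinearMap.mk₂ ℝ (fun X Y ↦ θ.extDeriv X Y) (by simp) (by simp) (by simp) (by simp)

@[simp]
theorem leviForm_apply (X Y : q.contactHyperplane y) : θ.leviForm X Y = θ.extDeriv X Y := rfl

theorem extDeriv_swap (X Y : TangentSpace (𝓡 (2 * n + 1)) y) :
    θ.extDeriv X Y = -θ.extDeriv Y X :=
  (neg_sub (fderiv ℝ θ.inChart (extChartAt (𝓡 (2 * n + 1)) y y) Y X) _).symm

theorem extDeriv_sub_left (X X' Y : TangentSpace (𝓡 (2 * n + 1)) y) :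
    θ.extDeriv (X - X') Y = θ.extDeriv X Y - θ.extDeriv X' Y := by
  rw [map_sub]
  rfl

theorem nondegenerate_leviForm : θ.leviForm.Nondegenerate := by
  obtain ⟨v, hv, hy⟩ := q.surjective y
  have hm := θ.isLocalModel hv hy
  obtain ⟨hQ, -⟩ := exists_centered_chart_variations (q := q) hv hy
  have key : ∀ X, (∀ Y, θ.leviForm X Y = 0) → X = 0 := by
    intro X h
    apply Subtype.ext
    refine hm.eq_zero_of_dOne ?_ ?_
    · rw [hQ]
      exact (θ.inChart_self X).trans (θ.mem_contactHyperplane_iff.1 X.2)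
    · rw [hQ]
      intro Y hY
      exact h ⟨Y, θ.mem_contactHyperplane_iff.2 ((θ.inChart_self Y).symm.trans hY)⟩
  refine ⟨key, fun Y h ↦ key Y fun X ↦ ?_⟩
  have := h X
  rw [leviForm_apply, extDeriv_swap, neg_eq_zero] at this
  exact this

theorem finrank_contactHyperplane (θ : ContactScale q y) :
    Module.finrank ℝ (q.contactHyperplane y) = 2 * n := by
  have h := LinearMap.finrank_range_add_finrank_ker (θ.form y).toLinearMap
  rw [LinearMap.range_eq_top.2 θ.form_surjective, finrank_top, Module.finrank_self,
    θ.ker_form y θ.mem_dom] at h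
  have h2 : Module.finrank ℝ (TangentSpace (𝓡 (2 * n + 1)) y) = 2 * n + 1 :=
    finrank_euclideanSpace_fin
  omega

theorem finrank_contactLine (θ : ContactScale q y) :
    Module.finrank ℝ (q.ContactLine y) = 1 :=
  θ.lineEquiv.finrank_eq.trans (Module.finrank_self ℝ)

/-- A subspace equal to its orthogonal for the nondegenerate Levi form has half the dimension of the
contact hyperplane. -/
theorem IsLagrangian.finrank_eq {θ : ContactScale q y} {Λ : Submodule ℝ (q.contactHyperplane y)}
    (hΛ : θ.IsLagrangian Λ) : Module.finrank ℝ Λ = n := by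
  have h := LinearMap.BilinForm.finrank_orthogonal θ.nondegenerate_leviForm Λ
  have h2 : θ.leviForm.orthogonal Λ = Λ := by
    ext X
    rw [hΛ X, LinearMap.BilinForm.mem_orthogonal_iff]
    refine forall₂_congr fun Y _ ↦ ?_
    rw [leviForm_apply, extDeriv_swap, neg_eq_zero]
  have h3 := Λ.finrank_le
  rw [h2] at h
  rw [θ.finrank_contactHyperplane] at h h3
  omega

theorem forall_bracket_eq_zero_iff (X : θ.HeisenbergTangent) :
    (∀ Y : θ.HeisenbergTangent, ⁅X, Y⁆ = 0) ↔ X.1 = 0 := by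
  constructor
  · intro h
    refine θ.nondegenerate_leviForm.1 X.1 fun Y ↦ ?_
    have h1 := congrArg Prod.snd (h ((Y, 0) : q.contactHyperplane y × q.ContactLine y))
    have h2 : θ.lineEquiv.symm (-(θ.extDeriv X.1 Y)) = 0 := h1
    rw [LinearEquiv.map_eq_zero_iff, neg_eq_zero] at h2
    exact h2
  · intro h Y
    refine θ.ext_heisenberg rfl ?_
    rw [snd_bracket, h]
    simp
    rfl

/-- The Reeb vector exists and is unique because the Levi form is nondegenerate on the contact
hyperplane, which is the kernel of `θ`. -/
theorem existsUnique_isReeb : ∃! R : TangentSpace (𝓡 (2 * n + 1)) y, θ.IsReeb R := by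
  obtain ⟨R₀, hR₀⟩ := θ.form_surjective 1
  have hR₀' : θ.form y R₀ = 1 := hR₀
  -- correct `R₀` by the contact vector that represents `dθ(R₀, ·)` through the Levi form
  set f : Module.Dual ℝ (q.contactHyperplane y) :=
    (θ.extDeriv R₀).toLinearMap ∘ₗ (q.contactHyperplane y).subtype
  set Z := (θ.leviForm.toDual θ.nondegenerate_leviForm).symm f
  have hZ : ∀ Y : q.contactHyperplane y, θ.extDeriv Z Y = θ.extDeriv R₀ Y := fun Y ↦
    LinearMap.BilinForm.apply_toDual_symm_apply (hB := θ.nondegenerate_leviForm) f Y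
  have hθZ : θ.form y Z = 0 := θ.mem_contactHyperplane_iff.1 Z.2
  refine ⟨R₀ - Z, ⟨by rw [map_sub, hR₀', hθZ, sub_zero], fun X ↦ ?_⟩, fun R hR ↦ ?_⟩
  · have hX : X - θ.form y X • (R₀ - Z) ∈ q.contactHyperplane y := by
      rw [θ.mem_contactHyperplane_iff, map_sub, map_smul, map_sub, hR₀', hθZ]
      simp
    have h1 := hZ ⟨_, hX⟩
    have h2 := θ.extDeriv_self (R₀ - Z)
    have h3 : θ.extDeriv (R₀ - Z) (X - θ.form y X • (R₀ - Z)) = 0 := by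
      rw [extDeriv_sub_left]
      exact sub_eq_zero.2 h1.symm
    rw [map_sub, map_smul, h2, smul_zero, sub_zero] at h3
    exact h3
  · have hmem : R - (R₀ - Z) ∈ q.contactHyperplane y := by
      rw [θ.mem_contactHyperplane_iff, map_sub, hR.1, map_sub, hR₀', hθZ]
      simp
    have h0 := θ.nondegenerate_leviForm.1 ⟨_, hmem⟩ fun Y ↦ by
      rw [leviForm_apply, extDeriv_sub_left, extDeriv_sub_left, hR.2, hZ, sub_self, sub_zero]
    exact sub_eq_zero.1 (congrArg Subtype.val h0)

end ContactScale

end LeviForm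

/-! ### Graded evaluation -/

section GradedSum

variable {A B C D : Type*} [AddCommGroup A] [Module ℝ A] [AddCommGroup B] [Module ℝ B]
  [AddCommGroup C] [Module ℝ C] [AddCommGroup D] [Module ℝ D]

theorem prodCongr_dilation (e : A ≃ₗ[ℝ] B) (f : C ≃ₗ[ℝ] D) (r : ℝ) (p : A × C) :
    e.prodCongr f (dilation A C r p) = dilation B D r (e.prodCongr f p) :=
  Prod.ext (map_smul e r p.1) (map_smul f (r ^ 2) p.2)

theorem map_prodCongr_prod (e : A ≃ₗ[ℝ] B) (f : C ≃ₗ[ℝ] D) (S : Submodule ℝ A)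
    (S' : Submodule ℝ C) : (S.prod S').map (e.prodCongr f).toLinearMap =
      (S.map e.toLinearMap).prod (S'.map f.toLinearMap) :=
  SetLike.coe_injective (prodMap_image_prod e f S S')

end GradedSum

section Evaluation

variable {n : ℕ} {M : Type*} [TopologicalSpace M]
  [ChartedSpace (EuclideanSpace ℝ (Fin (n + 2))) M]
  [IsManifold (𝓡 (n + 2)) ∞ M]
  {𝒩 : Type*} [TopologicalSpace 𝒩]
  [ChartedSpace (EuclideanSpace ℝ (Fin (2 * n + 1))) 𝒩]
  [IsManifold (𝓡 (2 * n + 1)) ∞ 𝒩]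
  {g : LorentzMetric n M} {q : NullGeodesicSpace g 𝒩} {y : 𝒩}

theorem LorentzMetric.span_le_perp {v : TangentBundle (𝓡 (n + 2)) M} (hv : v ∈ g.nullCone) :
    Submodule.span ℝ {v.snd} ≤ g.perp v := by
  rw [Submodule.span_singleton_le_iff_mem]
  exact hv.2

namespace ContactScale

variable (θ : ContactScale q y) {v : TangentBundle (𝓡 (n + 2)) M}

/-- The displacement of any representing variation defines a graded evaluation map. -/
theorem exists_isGradedEvaluation (hv : v ∈ g.nullCone) (hy : q.proj v = y) :
    ∃ Φ : θ.HeisenbergTangent →ₗ[ℝ] g.WeightedNormal v, θ.IsGradedEvaluation v Φ := by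
  obtain ⟨s, hs⟩ := q.exists_linear_represents hv hy
  set D : TangentSpace (𝓡 (2 * n + 1)) y →ₗ[ℝ] TangentSpace (𝓡 (n + 2)) v.proj :=
    (dproj v).toLinearMap ∘ₗ s
  have hD : ∀ η, D η ∈ g.perp v ↔ η ∈ q.contactHyperplane y := fun η ↦
    θ.dproj_mem_perp_iff hv (hs η)
  -- two variations representing the same vector have displacements differing by a multiple of `k`
  have hspan : ∀ ξ η, q.Represents v ξ y η → D η - dproj v ξ ∈ Submodule.span ℝ {v.snd} := by
    intro ξ η h
    have h0 := (hs η).sub h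
    rw [sub_self] at h0
    have := θ.dproj_mem_span_of_represents_zero hv h0
    rwa [map_sub] at this
  set D₁ : q.contactHyperplane y →ₗ[ℝ] g.perp v :=
    D.restrict fun η h ↦ (hD η).2 h
  set Φ₁ : q.contactHyperplane y →ₗ[ℝ] g.Screen v :=
    ((Submodule.span ℝ {v.snd}).submoduleOf (g.perp v)).mkQ ∘ₗ D₁
  set Φ₂ : q.ContactLine y →ₗ[ℝ] g.NullLine v :=
    (q.contactHyperplane y).mapQ (g.perp v) D fun η h ↦ (hD η).2 h
  refine ⟨Φ₁.prodMap Φ₂, Φ₁, Φ₂, fun X ↦ rfl, fun ξ η h ↦ ?_, fun ξ X h ↦ ?_⟩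
  · exact (Submodule.Quotient.eq _).2 (LorentzMetric.span_le_perp hv (hspan ξ η h))
  · refine ⟨(θ.dproj_mem_perp_iff hv h).2 X.2, (Submodule.Quotient.eq _).2 ?_⟩
    rw [Submodule.submoduleOf, Submodule.mem_comap]
    exact hspan ξ X h

variable {θ}

theorem IsGradedEvaluation.map_heisenbergDilation
    {Φ : θ.HeisenbergTangent →ₗ[ℝ] g.WeightedNormal v} (hΦ : θ.IsGradedEvaluation v Φ)
    (r : ℝ) (X : θ.HeisenbergTangent) :
    Φ (θ.heisenbergDilation r X) = dilation _ _ r (Φ X) := by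
  obtain ⟨Φ₁, Φ₂, h, -, -⟩ := hΦ
  rw [h, h]
  exact Prod.ext (map_smul Φ₁ r X.1) (map_smul Φ₂ (r ^ 2) X.2)

/-- A graded evaluation is onto in each weight, injective on the contact line, and kills exactly the
vertical variations in the contact hyperplane. -/
theorem IsGradedEvaluation.exists_components {Φ : θ.HeisenbergTangent →ₗ[ℝ] g.WeightedNormal v}
    (hΦ : θ.IsGradedEvaluation v Φ) (hv : v ∈ g.nullCone) (hy : q.proj v = y) :
    ∃ (Φ₁ : q.contactHyperplane y →ₗ[ℝ] g.Screen v) (Φ₂ : q.ContactLine y →ₗ[ℝ] g.NullLine v),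
      (∀ X, Φ X = (Φ₁ X.1, Φ₂ X.2)) ∧ Function.Surjective Φ₁ ∧ Function.Bijective Φ₂ ∧
      LinearMap.ker Φ₁ = q.vertical v y := by
  obtain ⟨Φ₁, Φ₂, h, h₂, h₁⟩ := hΦ
  refine ⟨Φ₁, Φ₂, h, fun e ↦ ?_, ⟨?_, fun e ↦ ?_⟩, ?_⟩
  · obtain ⟨⟨w, hw⟩, rfl⟩ := Submodule.Quotient.mk_surjective _ e
    obtain ⟨ξ, η, hξ, rfl⟩ := θ.exists_represents_dproj_eq hv hy w
    exact ⟨⟨η, (θ.dproj_mem_perp_iff hv hξ).1 hw⟩, (h₁ ξ ⟨η, _⟩ hξ).2⟩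
  · rw [injective_iff_map_eq_zero]
    intro l hl
    obtain ⟨η, rfl⟩ := Submodule.Quotient.mk_surjective _ l
    obtain ⟨ξ, hξ⟩ := q.exists_represents hv hy η
    have h0 := (h₂ ξ η hξ).symm.trans hl
    rw [Submodule.mkQ_apply, Submodule.Quotient.mk_eq_zero, θ.dproj_mem_perp_iff hv hξ] at h0
    exact (Submodule.Quotient.mk_eq_zero _).2 h0
  · obtain ⟨w, rfl⟩ := Submodule.Quotient.mk_surjective _ e
    obtain ⟨ξ, η, hξ, rfl⟩ := θ.exists_represents_dproj_eq hv hy w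
    exact ⟨_, h₂ ξ η hξ⟩
  · ext X
    rw [LinearMap.mem_ker]
    constructor
    · intro h0
      obtain ⟨ξ, hξ⟩ := q.exists_represents hv hy X
      obtain ⟨hp, h3⟩ := h₁ ξ X hξ
      rw [h0] at h3
      have h4 := (Submodule.Quotient.mk_eq_zero
        ((Submodule.span ℝ {v.snd}).submoduleOf (g.perp v))).1 h3.symm
      exact θ.mem_vertical_of_dproj_mem_span hv hξ h4
    · intro hX
      obtain ⟨ξ, h0, hξ⟩ := (NullGeodesicSpace.mem_vertical_iff hv hy).1 hX
      obtain ⟨hp, h3⟩ := h₁ ξ X hξ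
      rw [h3, Submodule.Quotient.mk_eq_zero, Submodule.submoduleOf, Submodule.mem_comap]
      exact h0 ▸ Submodule.zero_mem _

theorem IsGradedEvaluation.surjective {Φ : θ.HeisenbergTangent →ₗ[ℝ] g.WeightedNormal v}
    (hΦ : θ.IsGradedEvaluation v Φ) (hv : v ∈ g.nullCone) (hy : q.proj v = y) :
    Function.Surjective Φ := by
  obtain ⟨Φ₁, Φ₂, h, h₁, h₂, -⟩ := hΦ.exists_components hv hy
  rintro ⟨e, ν⟩
  obtain ⟨X, rfl⟩ := h₁ e
  obtain ⟨V, rfl⟩ := h₂.2 ν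
  exact ⟨((X, V) : q.contactHyperplane y × q.ContactLine y), h _⟩

theorem IsGradedEvaluation.eq_zero_iff {Φ : θ.HeisenbergTangent →ₗ[ℝ] g.WeightedNormal v}
    (hΦ : θ.IsGradedEvaluation v Φ) (hv : v ∈ g.nullCone) (hy : q.proj v = y)
    (X : θ.HeisenbergTangent) : Φ X = 0 ↔ X.1 ∈ q.vertical v y ∧ X.2 = 0 := by
  obtain ⟨Φ₁, Φ₂, h, -, h₂, hk⟩ := hΦ.exists_components hv hy
  rw [h, Prod.mk_eq_zero, ← hk, LinearMap.mem_ker]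
  exact and_congr_right fun _ ↦ map_eq_zero_iff Φ₂ h₂.1

set_option maxHeartbeats 1000000 in
/-- A Lagrangian polarization has the dimension of the screen, because the kernel of the evaluation
is Lagrangian as well; where the two Lagrangians are transverse, the evaluation restricts to an
isomorphism. -/
theorem IsGradedEvaluation.exists_polarized_equiv
    {Φ : θ.HeisenbergTangent →ₗ[ℝ] g.WeightedNormal v} (hΦ : θ.IsGradedEvaluation v Φ)
    (hv : v ∈ g.nullCone) (hy : q.proj v = y) {Λ : Submodule ℝ (q.contactHyperplane y)}
    (hΛ : θ.IsLagrangian Λ) :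
    ∃ Ψ : θ.Polarized Λ ≃ₗ[ℝ] g.WeightedNormal v,
      (∀ (r : ℝ) (p : θ.Polarized Λ), Ψ (dilation _ _ r p) = dilation _ _ r (Ψ p)) ∧
      Submodule.map Ψ.toLinearMap (Submodule.prod ⊤ ⊥) = Submodule.prod ⊤ ⊥ ∧
      Submodule.map Ψ.toLinearMap (Submodule.prod ⊥ ⊤) = Submodule.prod ⊥ ⊤ ∧
      (∀ ℓ : q.ContactLine y, Ψ (0, ℓ) = Φ (θ.polarizedInclusion Λ (0, ℓ))) ∧
      (Disjoint Λ (q.vertical v y) →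
        IsCompl Λ (q.vertical v y) ∧
        ∀ p : θ.Polarized Λ, Ψ p = Φ (θ.polarizedInclusion Λ p)) := by
  obtain ⟨Φ₁, Φ₂, h, h₁, h₂, hk⟩ := hΦ.exists_components hv hy
  have hdH := (θ.isLagrangian_vertical hv hy).finrank_eq
  have hdΛ := hΛ.finrank_eq
  have hdE : Module.finrank ℝ Λ = Module.finrank ℝ (g.Screen v) := by
    have h3 := LinearMap.finrank_range_add_finrank_ker Φ₁
    rw [LinearMap.range_eq_top.2 h₁, finrank_top, hk, hdH, θ.finrank_contactHyperplane] at h3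
    omega
  obtain ⟨e₁, he₁⟩ : ∃ e₁ : Λ ≃ₗ[ℝ] g.Screen v,
      Disjoint Λ (q.vertical v y) → ∀ X : Λ, e₁ X = Φ₁ X := by
    by_cases hd : Disjoint Λ (q.vertical v y)
    · have hinj : Function.Injective (Φ₁ ∘ₗ Λ.subtype) := by
        rw [injective_iff_map_eq_zero]
        intro X hX
        have hX' : (X : q.contactHyperplane y) ∈ q.vertical v y := by
          rw [← hk]
          exact hX
        exact Subtype.ext (Submodule.disjoint_def.1 hd X X.2 hX')
      exact ⟨LinearEquiv.ofInjectiveOfFinrankEq _ hinj hdE, fun _ X ↦ rfl⟩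
    · exact ⟨LinearEquiv.ofFinrankEq _ _ hdE, fun hd' ↦ absurd hd' hd⟩
  set e₂ : q.ContactLine y ≃ₗ[ℝ] g.NullLine v := LinearEquiv.ofBijective Φ₂ h₂
  refine ⟨e₁.prodCongr e₂, prodCongr_dilation e₁ e₂, ?_, ?_, fun l ↦ ?_, fun hd ↦ ⟨?_, fun p ↦ ?_⟩⟩
  · rw [map_prodCongr_prod, Submodule.map_bot, Submodule.map_top, LinearEquiv.range]
  · rw [map_prodCongr_prod, Submodule.map_bot, Submodule.map_top, LinearEquiv.range]
  · rw [h]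
    exact Prod.ext ((map_zero e₁).trans (map_zero Φ₁).symm) rfl
  · refine ⟨hd, ?_⟩
    rw [codisjoint_iff]
    apply Submodule.eq_top_of_finrank_eq
    have h3 := Submodule.finrank_sup_add_finrank_inf_eq Λ (q.vertical v y)
    rw [hd.eq_bot, finrank_bot, hdH, hdΛ] at h3
    rw [θ.finrank_contactHyperplane]
    omega
  · rw [h]
    exact Prod.ext (he₁ hd p.1) rfl

end ContactScale

end Evaluation

/-! ### Evaluation along a null geodesic -/

section AlongGeodesic

variable {n : ℕ} {M : Type*} [TopologicalSpace M]
  [ChartedSpace (EuclideanSpace ℝ (Fin (n + 2))) M]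
  [IsManifold (𝓡 (n + 2)) ∞ M]
  {𝒩 : Type*} [TopologicalSpace 𝒩]
  [ChartedSpace (EuclideanSpace ℝ (Fin (2 * n + 1))) 𝒩]
  [IsManifold (𝓡 (2 * n + 1)) ∞ 𝒩]
  {g : LorentzMetric n M} {q : NullGeodesicSpace g 𝒩} {y : 𝒩} (θ : ContactScale q y)
  {γ : ℝ → M} {I : Set ℝ}

namespace ContactScale

/-- A Lagrangian polarization contains no variation vanishing at the parameters near a given one. -/
theorem eventually_disjoint_vertical (hI : IsOpen I) (hγ : g.IsNullGeodesicOn γ I)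
    (hy : ∀ u ∈ I, q.proj (velocity n γ u) = y) {Λ : Submodule ℝ (q.contactHyperplane y)}
    (hΛ : θ.IsLagrangian Λ) {u₀ : ℝ} (hu₀ : u₀ ∈ I) :
    ∀ᶠ u in 𝓝[≠] u₀, Disjoint Λ (q.vertical (velocity n γ u) y) := by
  set v := velocity n γ u₀ with hv
  have hvn : v ∈ g.nullCone := hγ.2 u₀ hu₀
  have hm := θ.isLocalModel hvn (hy u₀ hu₀)
  have hsrc : γ u₀ ∈ (extChartAt (𝓡 (n + 2)) v.proj).source := mem_extChartAt_source v.proj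
  obtain ⟨hPd, hP1⟩ := hγ.contDiffAt_velocity v hI hu₀ hsrc
  have hev := hγ.eventually_velocity v hI hu₀ hsrc
  have hQ : ∀ u ∈ I, (extChartAt (𝓡 (n + 2)).tangent v).symm
      (extChartAt (𝓡 (n + 2)).tangent v (velocity n γ u)) = velocity n γ u →
      q.inChart v y (extChartAt (𝓡 (n + 2)).tangent v (velocity n γ u)) =
        extChartAt (𝓡 (2 * n + 1)) y y := fun u hu h ↦ by
    rw [NullGeodesicSpace.inChart, h, hy u hu]
  have hQ₀ := hQ u₀ hu₀ hev.self_of_nhds.2.2.1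
  have hform : ∀ X ∈ Λ.map (q.contactHyperplane y).subtype,
      θ.inChart (extChartAt (𝓡 (2 * n + 1)) y y) X = 0 := by
    rintro _ ⟨X, -, rfl⟩
    exact (θ.inChart_self _).trans (θ.mem_contactHyperplane_iff.1 X.2)
  have hiso : ∀ X ∈ Λ.map (q.contactHyperplane y).subtype,
      ∀ Y ∈ Λ.map (q.contactHyperplane y).subtype,
      dOne θ.inChart (extChartAt (𝓡 (2 * n + 1)) y y) X Y = 0 := by
    rintro _ ⟨X, hX, rfl⟩ _ ⟨Y, hY, rfl⟩
    exact (hΛ X).1 hX Y hY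
  have key := hm.eventually_eq_zero_of_vertical
    (p := fun u ↦ extChartAt (𝓡 (n + 2)).tangent v (velocity n γ u))
    (hPd.differentiableAt (by simp)).hasDerivAt rfl hP1
    (by
      filter_upwards [hev] with u hu
      rw [LorentzMetric.nullFun_inChart g v hu.2.1, hu.2.2.1]
      exact (hγ.2 u hu.1).2)
    (by
      filter_upwards [hev] with u hu
      rw [hQ u hu.1 hu.2.2.1]
      exact hQ₀.symm)
    (Λ := Λ.map (q.contactHyperplane y).subtype)
    (by
      rw [hQ₀]
      exact hform)
    (by
      rw [hQ₀]
      exact hiso)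
  filter_upwards [key, hev.filter_mono nhdsWithin_le_nhds] with u hu hu'
  rw [Submodule.disjoint_def]
  intro X hX hXv
  obtain ⟨e, he, hd⟩ := q.exists_chart_variations hu'.2.1 hu'.2.2.1
    (q.nullCone_subset (hγ.2 u hu'.1)) (hy u hu'.1)
  obtain ⟨ξ, h1, h2⟩ := (NullGeodesicSpace.mem_vertical_iff (hγ.2 u hu'.1) (hy u hu'.1)).1 hXv
  obtain ⟨ξ, rfl⟩ := he ξ
  obtain ⟨h3, h4⟩ := ((hd ξ).1 _).1 h2
  rw [show ξ = (0, ξ.2) from Prod.ext ((hd ξ).2.2.1.1 h1) rfl] at h3 h4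
  exact Subtype.ext (hu _ ⟨X, hX, rfl⟩ _ h3 h4)

/-- Each tangent vector of the space of null geodesics is represented, near each parameter, by
variations whose displacements form a smooth vector field along the geodesic. -/
theorem exists_smooth_representing_field (θ : ContactScale q y) (hI : IsOpen I)
    (hγ : g.IsNullGeodesicOn γ I)
    (hy : ∀ u ∈ I, q.proj (velocity n γ u) = y) {u₀ : ℝ} (hu₀ : u₀ ∈ I)
    (η : TangentSpace (𝓡 (2 * n + 1)) y) :
    ∃ (U : Set ℝ) (J : ∀ u : ℝ, TangentSpace (𝓡 (n + 2)) (γ u)),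
      IsOpen U ∧ u₀ ∈ U ∧ U ⊆ I ∧
      ContMDiffOn 𝓘(ℝ, ℝ) (𝓡 (n + 2)).tangent ∞
        (fun u ↦ (⟨γ u, J u⟩ : TangentBundle (𝓡 (n + 2)) M)) U ∧
      ∀ u ∈ U, ∃ ξ, q.Represents (velocity n γ u) ξ y η ∧ dproj (velocity n γ u) ξ = J u := by
  set v := velocity n γ u₀ with hv
  have hvn : v ∈ g.nullCone := hγ.2 u₀ hu₀
  have hm := θ.isLocalModel hvn (hy u₀ hu₀)
  have hsrc : γ u₀ ∈ (extChartAt (𝓡 (n + 2)) v.proj).source := mem_extChartAt_source v.proj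
  have hcont := (hγ.contDiffAt_velocity v hI hu₀ hsrc).1.continuousAt.tendsto
  have hev := hγ.eventually_velocity v hI hu₀ hsrc
  obtain ⟨ℓ, -, hℓ⟩ := exists_dual_vector ℝ (extChartAt (𝓡 (n + 2)).tangent v v).2
    (norm_ne_zero_iff.2 hm.ne_zero)
  have hℓ' : ℓ (extChartAt (𝓡 (n + 2)).tangent v v).2 ≠ 0 := by
    rw [hℓ]
    simpa using hm.ne_zero
  obtain ⟨X, -, hXev, hXs, -⟩ := hm.exists_frame hℓ'
  have hsrc' : ∀ᶠ u in 𝓝 u₀, γ u ∈ (extChartAt (𝓡 (n + 2)) v.proj).source :=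
    (hγ.contMDiffAt hI hu₀).continuousAt.eventually
      ((isOpen_extChartAt_source v.proj).mem_nhds hsrc)
  obtain ⟨U, hU, hUo, hu₀U⟩ := eventually_nhds_iff.1
    ((hev.and hsrc').and ((hcont.eventually hXev).and (hcont.eventually hXs)))
  set P := fun u ↦ extChartAt (𝓡 (n + 2)).tangent v (velocity n γ u) with hP
  refine ⟨U, fun u ↦ mfderiv 𝓘(ℝ, EuclideanSpace ℝ (Fin (n + 2))) (𝓡 (n + 2))
    (extChartAt (𝓡 (n + 2)) v.proj).symm (P u).1 (X (P u) η).1, hUo, hu₀U,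
    fun u hu ↦ (hU u hu).1.1.1, ?_, fun u hu ↦ ?_⟩
  · have hs : ContMDiffOn 𝓘(ℝ, ℝ) (𝓡 (n + 2)).tangent ∞
        (fun u ↦ (extChartAt (𝓡 (n + 2)).tangent v).symm ((P u).1, (X (P u) η).1)) U := by
      intro u hu
      obtain ⟨⟨⟨h1, h2, h3, h4⟩, h5⟩, h6, h7⟩ := hU u hu
      have hPu := (hγ.contDiffAt_velocity v hI h1 h5).1
      have hX : ContDiffAt ℝ ∞ X (P u) := h7
        ((g.contDiffOn_inChart v.proj).contDiffAt ((isOpen_extChartAt_target v.proj).mem_nhds h2))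
        (q.contDiffAt_inChart v y h2 (by rw [h3]; exact q.nullCone_subset (hγ.2 u h1))
          (by rw [h3, hy u h1]; exact mem_extChartAt_source y))
      have h8 : ContDiffAt ℝ ∞ (fun u ↦ ((P u).1, (X (P u) η).1)) u :=
        hPu.fst.prodMk ((hX.comp u hPu).clm_apply contDiffAt_const).fst
      have h9 := (contMDiffOn_tangent_extChartAt_symm v).contMDiffAt
        ((isOpen_extChartAt_target v).mem_nhds
          (LorentzMetric.mem_target_tangent v (p := ((P u).1, (X (P u) η).1)) h2))
      exact (h9.comp u h8.contMDiffAt).contMDiffWithinAt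
    refine hs.congr fun u hu ↦ ?_
    obtain ⟨⟨⟨h1, h2, h3, h4⟩, h5⟩, h6, h7⟩ := hU u hu
    rw [tangent_extChartAt_symm v h2]
    have h10 : (extChartAt (𝓡 (n + 2)) v.proj).symm (P u).1 = γ u := by
      rw [show P u = _ from h4]
      exact (extChartAt (𝓡 (n + 2)) v.proj).left_inv h5
    exact congrArg (fun x : M ↦ (⟨x, (mfderiv 𝓘(ℝ, EuclideanSpace ℝ (Fin (n + 2))) (𝓡 (n + 2))
      (extChartAt (𝓡 (n + 2)) v.proj).symm (P u).1 (X (P u) η).1 :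
        EuclideanSpace ℝ (Fin (n + 2)))⟩ : TangentBundle (𝓡 (n + 2)) M)) h10.symm
  · obtain ⟨⟨⟨h1, h2, h3, h4⟩, h5⟩, h6, h7⟩ := hU u hu
    obtain ⟨e, -, hd⟩ := q.exists_chart_variations h2 h3 (q.nullCone_subset (hγ.2 u h1)) (hy u h1)
    exact ⟨e (X (P u) η), ((hd _).1 η).2 ⟨(h6 η).1, (h6 η).2.1⟩, (hd _).2.1⟩

end ContactScale

end AlongGeodesic

end PenroseLimit

open PenroseLimit

theorem mainTheorem11 (n : ℕ) {M : Type*} [TopologicalSpace M] [T2Space M]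
    [ChartedSpace (EuclideanSpace ℝ (Fin (n + 2))) M] [IsManifold (𝓡 (n + 2)) ∞ M]
    (g : LorentzMetric n M)
    {𝒩 : Type*} [TopologicalSpace 𝒩]
    [ChartedSpace (EuclideanSpace ℝ (Fin (2 * n + 1))) 𝒩] [IsManifold (𝓡 (2 * n + 1)) ∞ 𝒩]
    (q : NullGeodesicSpace g 𝒩)
    (γ : ℝ → M) (I : Set ℝ) (hI : IsOpen I) (hI' : I.OrdConnected) (hγ : g.IsNullGeodesicOn γ I)
    (y : 𝒩) (hy : ∃ u ∈ I, q.proj (velocity n γ u) = y)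
    (θ : ContactScale q y)
    (Λ : Submodule ℝ (q.contactHyperplane y)) (hΛ : θ.IsLagrangian Λ) :
    -- the tangent model is the Heisenberg algebra of dimension `2n + 1`, with centre the contact line
    (Module.finrank ℝ (q.contactHyperplane y) = 2 * n ∧
      Module.finrank ℝ (q.ContactLine y) = 1 ∧
      ∀ X : θ.HeisenbergTangent, (∀ Y : θ.HeisenbergTangent, ⁅X, Y⁆ = 0) ↔ X.1 = 0) ∧
    -- the contact scale represents the contact line by the Reeb direction
    (∃! R : TangentSpace (𝓡 (2 * n + 1)) y, θ.IsReeb R) ∧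
    ∃ Φ : ∀ u : ℝ, θ.HeisenbergTangent →ₗ[ℝ] g.WeightedNormal (velocity n γ u),
      (∀ u ∈ I,
        -- `E ⊕ N` is the quotient of the Heisenberg model by a Lagrangian, through evaluation
        θ.IsGradedEvaluation (velocity n γ u) (Φ u) ∧
        (∀ (r : ℝ) (X : θ.HeisenbergTangent),
          Φ u (θ.heisenbergDilation r X) = dilation _ _ r (Φ u X)) ∧
        Function.Surjective (Φ u) ∧
        θ.IsLagrangian (q.vertical (velocity n γ u) y) ∧
        (∀ X : θ.HeisenbergTangent,
          Φ u X = 0 ↔ X.1 ∈ q.vertical (velocity n γ u) y ∧ X.2 = 0) ∧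
        -- identification with the polarized slice `Λ ⊕ L`
        ∃ Ψ : θ.Polarized Λ ≃ₗ[ℝ] g.WeightedNormal (velocity n γ u),
          (∀ (r : ℝ) (p : θ.Polarized Λ), Ψ (dilation _ _ r p) = dilation _ _ r (Ψ p)) ∧
          Submodule.map Ψ.toLinearMap (Submodule.prod ⊤ ⊥) = Submodule.prod ⊤ ⊥ ∧
          Submodule.map Ψ.toLinearMap (Submodule.prod ⊥ ⊤) = Submodule.prod ⊥ ⊤ ∧
          (∀ ℓ : q.ContactLine y, Ψ (0, ℓ) = Φ u (θ.polarizedInclusion Λ (0, ℓ))) ∧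
          (Disjoint Λ (q.vertical (velocity n γ u) y) →
            IsCompl Λ (q.vertical (velocity n γ u) y) ∧
            ∀ p : θ.Polarized Λ, Ψ p = Φ u (θ.polarizedInclusion Λ p))) ∧
      -- the polarization is transverse to the evaluation kernel except at isolated parameters
      (∀ u₀ ∈ I, ∀ᶠ u in 𝓝[≠] u₀, Disjoint Λ (q.vertical (velocity n γ u) y)) ∧
      -- the evaluation maps depend smoothly on the parameter
      ∀ u₀ ∈ I, ∀ η : TangentSpace (𝓡 (2 * n + 1)) y,
        ∃ (U : Set ℝ) (J : ∀ u : ℝ, TangentSpace (𝓡 (n + 2)) (γ u)),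
          IsOpen U ∧ u₀ ∈ U ∧ U ⊆ I ∧
          ContMDiffOn 𝓘(ℝ, ℝ) (𝓡 (n + 2)).tangent ∞
            (fun u ↦ (⟨γ u, J u⟩ : TangentBundle (𝓡 (n + 2)) M)) U ∧
          ∀ u ∈ U,
            (∀ X : θ.HeisenbergTangent, X.2 = (q.contactHyperplane y).mkQ η →
              (Φ u X).2 = (g.perp (velocity n γ u)).mkQ (J u)) ∧
            ∀ X : θ.HeisenbergTangent, (X.1 : TangentSpace (𝓡 (2 * n + 1)) y) = η →
              ∃ h : J u ∈ g.perp (velocity n γ u),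
                (Φ u X).1 = Submodule.Quotient.mk ⟨J u, h⟩ := by
  have hy' : ∀ u ∈ I, q.proj (velocity n γ u) = y := by
    obtain ⟨a, ha, rfl⟩ := hy
    exact fun u hu ↦ q.proj_velocity_eq hI hI' hγ hu ha
  have hΦ : ∀ u, ∃ Φ : θ.HeisenbergTangent →ₗ[ℝ] g.WeightedNormal (velocity n γ u),
      u ∈ I → θ.IsGradedEvaluation (velocity n γ u) Φ := by
    intro u
    by_cases hu : u ∈ I
    · obtain ⟨Φ, h⟩ := θ.exists_isGradedEvaluation (hγ.2 u hu) (hy' u hu)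
      exact ⟨Φ, fun _ ↦ h⟩
    · exact ⟨0, fun h ↦ absurd h hu⟩
  choose Φ hΦ using hΦ
  refine ⟨⟨θ.finrank_contactHyperplane, θ.finrank_contactLine, θ.forall_bracket_eq_zero_iff⟩,
    θ.existsUnique_isReeb, Φ, fun u hu ↦ ⟨hΦ u hu, (hΦ u hu).map_heisenbergDilation,
      (hΦ u hu).surjective (hγ.2 u hu) (hy' u hu), θ.isLagrangian_vertical (hγ.2 u hu) (hy' u hu),
      (hΦ u hu).eq_zero_iff (hγ.2 u hu) (hy' u hu),
      (hΦ u hu).exists_polarized_equiv (hγ.2 u hu) (hy' u hu) hΛ⟩,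
    fun u₀ hu₀ ↦ θ.eventually_disjoint_vertical hI hγ hy' hΛ hu₀, fun u₀ hu₀ η ↦ ?_⟩
  obtain ⟨U, J, hU, hu₀U, hUI, hJ, hrep⟩ := θ.exists_smooth_representing_field hI hγ hy' hu₀ η
  refine ⟨U, J, hU, hu₀U, hUI, hJ, fun u hu ↦ ?_⟩
  obtain ⟨ξ, hξ, hξJ⟩ := hrep u hu
  obtain ⟨Φ₁, Φ₂, h, h₂, h₁⟩ := hΦ u (hUI hu)
  rw [← hξJ]
  refine ⟨fun X hX ↦ ?_, fun X hX ↦ ?_⟩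
  · rw [h, hX]
    exact h₂ ξ η hξ
  · rw [h]
    exact h₁ ξ X.1 (hX ▸ hξ)
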